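/- Let $\mathfrak A$ be an essentially small Karoubian $\mathbb Q$-linear tensor category, that is, an additive $\mathbb Q$-linear category with finite direct sums in which every idempotent splits, with a $\mathbb Q$-bilinear symmetric monoidal structure $(\otimes,\mathbb 1)$. Let $K_0(\mathfrak A)$ be its Grothendieck ring: the abelian group generated by the classes $\mathrm{cl}(X)$ of objects with the relations $\mathrm{cl}(X\oplus Y)=\mathrm{cl}(X)+\mathrm{cl}(Y)$, with product $\mathrm{cl}(X)\,\mathrm{cl}(Y)=\mathrm{cl}(X\otimes Y)$. Let $R=\bigoplus_{n\ge 0}R_n$, where $R_n$ is the Grothendieck group of finite-dimensional $\mathbb Q$-representations of the symmetric group $\Sigma_n$, with the commutative ring structure $\mathrm{cl}(V)\,\mathrm{cl}(W)=\mathrm{cl}\bigl(\mathrm{Ind}_{\Sigma_p\times\Sigma_q}^{\Sigma_{p+q}}(V\otimes W)\bigr)$. For a partition $\mu$ of $n=|\mu|$ let $V_\mu$ be the corresponding irreducible $\mathbb Q\Sigma_n$-module (the left ideal generated by a Young symmetrizer of shape $\mu$, so that $V_{(n)}$ is trivial), let $e_\mu\in\mathbb Q\Sigma_n$ be an idempotent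 with $V_\mu=\mathbb Q\Sigma_n e_\mu$, and for an object $X$ let $S_\mu(X)$ be the image of $e_\mu$ acting on $X^{\otimes n}$, where $\Sigma_n$ acts through the commutativity constraint. Put $$\lambda_\Sigma(X)=\sum_{\mu}\mathrm{cl}\bigl(S_\mu(X)\bigr)\otimes\mathrm{cl}(V_\mu)\,t^{|\mu|}\in\bigl(K_0(\mathfrak A)\otimes_{\mathbb Z}R\bigr)[[t]],$$ the sum being over all partitions $\mu$ of all integers $|\mu|\ge 0$. For partitions $\mu$ of $p$, $\eta$ of $q$ and $\pi$ of $p+q$ let $c^\pi_{\mu\eta}=\dim_{\mathbb Q}\mathrm{Hom}_{\Sigma_{p+q}}\bigl(V_\pi,\mathrm{Ind}_{\Sigma_p\times\Sigma_q}^{\Sigma_{p+q}}(V_\mu\otimes V_\eta)\bigr)$ (the Littlewood--Richardson coefficient). Then: 1. There is an injective homomorphism of abelian groups from $K_0(\mathfrak A)$ to the multiplicative group $1+t\,\bigl(K_0(\mathfrak A)\otimes_{\mathbb Z}R\bigr)[[t]]$ that sends $\mathrm{cl}(X)$ to $\lambda_\Sigma(X)$ for every object $X$; that is, $\lambda_\Sigma$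 is a well-defined monomorphism of abelian groups on $K_0(\mathfrak A)$. 2. For all $p,q\ge 0$ and all partitions $\mu$ of $p$ and $\eta$ of $q$, $\ \mathrm{Ind}_{\Sigma_p\times\Sigma_q}^{\Sigma_{p+q}}(V_\mu\otimes V_\eta)\cong\bigoplus_{|\pi|=p+q}V_\pi^{\oplus c^\pi_{\mu\eta}}$. 3. For every partition $\pi$ and all objects $X,Y$ of $\mathfrak A$, $$S_\pi(X\oplus Y)\cong\bigoplus_{|\mu|+|\eta|=|\pi|}\bigl(S_\mu(X)\otimes S_\eta(Y)\bigr)^{\oplus c^\pi_{\mu\eta}}.$$ -/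

import Mathlib

open CategoryTheory MonoidalCategory Limits
open scoped TensorProduct
universe v u

namespace GLR

noncomputable section

section SymmetricGroup

/-- The embedding `Σ_n → Σ_{n+1}` as the stabilizer of the first letter. -/
def permLift (n : ℕ) : Equiv.Perm (Fin n) →* Equiv.Perm (Fin (n + 1)) where
  toFun τ :=
    { toFun := Fin.cases 0 fun j => (τ j).succ
      invFun := Fin.cases 0 fun j => (τ.symm j).succ
      left_inv := fun x => by induction x using Fin.cases <;> simp
      right_inv := fun x => by induction x using Fin.cases <;> simp }
  map_one' := by ext x; induction x using Fin.cases <;> simp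
  map_mul' σ τ := by ext x; induction x using Fin.cases <;> simp

@[simp] theorem permLift_zero (n : ℕ) (τ : Equiv.Perm (Fin n)) : permLift n τ 0 = 0 := rfl

@[simp] theorem permLift_succ (n : ℕ) (τ : Equiv.Perm (Fin n)) (j : Fin n) :
    permLift n τ j.succ = (τ j).succ := rfl

/-- A permutation of `Fin (n + 1)` that fixes `0`, restricted to the remaining letters
(the value on other permutations is irrelevant). -/
def permRest (n : ℕ) (σ : Equiv.Perm (Fin (n + 1))) : Equiv.Perm (Fin n) :=
  (Equiv.Perm.decomposeFin σ).2

theorem permLift_eq (n : ℕ) (τ : Equiv.Perm (Fin n)) :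
    permLift n τ = Equiv.Perm.decomposeFin.symm (0, τ) := by
  ext x; induction x using Fin.cases <;> simp

theorem permRest_lift (n : ℕ) (τ : Equiv.Perm (Fin n)) : permRest n (permLift n τ) = τ := by
  simp [permRest, permLift_eq]

theorem permLift_rest (n : ℕ) (σ : Equiv.Perm (Fin (n + 1))) (h : σ 0 = 0) :
    permLift n (permRest n σ) = σ := by
  rw [permLift_eq, permRest, Equiv.symm_apply_eq]
  have h1 : (Equiv.Perm.decomposeFin σ).1 = 0 := by
    have := Equiv.Perm.decomposeFin_symm_apply_zero (Equiv.Perm.decomposeFin σ).1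
      (Equiv.Perm.decomposeFin σ).2
    rw [Prod.mk.eta, Equiv.symm_apply_apply] at this
    rw [← this, h]
  ext1
  · exact h1.symm
  · rfl

/- A sequence of monoids `M n` with maps `L : M n → M (n+1)` and elements `t n : M (n+2)` that
satisfy the relations of the first transposition. -/

section Tower

variable {M : ℕ → Type*} [∀ n, Monoid (M n)] (L : ∀ n, M n →* M (n + 1)) (t : ∀ n, M (n + 2))

/-- The image of the transposition of the `i`-th and the `(i+1)`-st letter
(and `1` if `n ≤ i + 1`). -/
def towerSwap : ∀ n : ℕ, ℕ → M n
  | 0, _ => 1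
  | 1, 0 => 1
  | n + 2, 0 => t n
  | n + 1, i + 1 => L n (towerSwap n i)

/-- The image of the cycle that moves the first letter to position `k`. -/
def towerCycle : ∀ n : ℕ, Fin (n + 1) → M (n + 1)
  | 0, _ => 1
  | n + 1, k => Fin.cases 1 (fun j => L (n + 1) (towerCycle n j) * t n) k

/-- The image of a permutation, written as a cycle moving the first letter to its place
after a permutation of the other letters. -/
def towerAct : ∀ n : ℕ, Equiv.Perm (Fin n) → M n
  | 0, _ => 1
  | n + 1, σ => towerCycle L t n (σ 0) *
      L n (towerAct n (permRest n
        ((towerCycle permLift (fun _ => Equiv.swap 0 1) n (σ 0))⁻¹ * σ)))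

theorem towerSwap_succ (n i : ℕ) : towerSwap L t (n + 1) (i + 1) = L n (towerSwap L t n i) := by
  cases n <;> rfl

theorem towerSwap_self (n : ℕ) : towerSwap L t n n = 1 := by
  induction n with
  | zero => rfl
  | succ n ih => rw [towerSwap_succ, ih, map_one]

theorem towerCycle_zero (n : ℕ) : towerCycle L t n 0 = 1 := by
  cases n <;> rfl

theorem towerCycle_succ (n : ℕ) (j : Fin (n + 1)) :
    towerCycle L t (n + 1) j.succ = L (n + 1) (towerCycle L t n j) * t n := rfl

theorem towerSwap_mul_towerCycle
    (hsq : ∀ n, t n * t n = 1)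
    (hcomm : ∀ n x, t n * L (n + 1) (L n x) = L (n + 1) (L n x) * t n)
    (hbraid : ∀ n, t (n + 1) * L (n + 2) (t n) * t (n + 1) =
      L (n + 2) (t n) * t (n + 1) * L (n + 2) (t n))
    : ∀ (n i : ℕ) (k : Fin (n + 1)), ∃ (k' : Fin (n + 1)) (j : ℕ),
    towerSwap L t (n + 1) i * towerCycle L t n k =
      towerCycle L t n k' * L n (towerSwap L t n j) := by
  intro n
  induction n with
  | zero =>
    intro i k
    refine ⟨0, 0, ?_⟩
    obtain rfl : k = 0 := Fin.fin_one_eq_zero k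
    cases i <;> simp [towerCycle_zero, towerSwap]
  | succ n ih =>
    intro i k
    cases i with
    | zero =>
      induction k using Fin.cases with
      | zero =>
        refine ⟨Fin.succ 0, n + 1, ?_⟩
        rw [towerSwap_self, towerCycle_succ, towerCycle_zero, towerCycle_zero]
        simp [towerSwap]
      | succ k =>
        cases n with
        | zero =>
          obtain rfl : k = 0 := Fin.fin_one_eq_zero k
          refine ⟨0, 1, ?_⟩
          rw [towerSwap_self, towerCycle_succ, towerCycle_zero, towerCycle_zero]
          simp [towerSwap, hsq]
        | succ n =>
          induction k using Fin.cases with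
          | zero =>
            refine ⟨0, n + 2, ?_⟩
            rw [towerSwap_self, towerCycle_succ, towerCycle_zero, towerCycle_zero]
            simp [towerSwap, hsq]
          | succ k =>
            refine ⟨k.succ.succ, 0, ?_⟩
            have hb := hbraid n
            simp only [towerCycle_succ, map_mul, towerSwap]
            rw [mul_assoc, mul_assoc, mul_assoc, ← mul_assoc (t (n + 1)) (L _ (L _ _)), hcomm,
              mul_assoc, ← mul_assoc (t (n + 1)), hb, mul_assoc]
    | succ i =>
      rw [towerSwap_succ]
      induction k using Fin.cases with
      | zero => exact ⟨0, i, by simp [towerCycle_zero]⟩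
      | succ k =>
        obtain ⟨k', j, h⟩ := ih i k
        refine ⟨k'.succ, j + 1, ?_⟩
        rw [towerCycle_succ, towerCycle_succ, ← mul_assoc, ← map_mul, h, map_mul, mul_assoc,
          ← hcomm, towerSwap_succ, mul_assoc]

theorem permSwap_sq (n : ℕ) :
    (Equiv.swap 0 1 : Equiv.Perm (Fin (n + 2))) * Equiv.swap 0 1 = 1 :=
  Equiv.swap_mul_self _ _

theorem permSwap_comm (n : ℕ) (x : Equiv.Perm (Fin n)) :
    (Equiv.swap 0 1 : Equiv.Perm (Fin (n + 2))) * permLift (n + 1) (permLift n x) =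
      permLift (n + 1) (permLift n x) * Equiv.swap 0 1 := by
  have h0 : permLift (n + 1) (permLift n x) 0 = 0 := rfl
  have h1 : permLift (n + 1) (permLift n x) 1 = 1 := rfl
  rw [Equiv.mul_swap_eq_swap_mul, h0, h1]

theorem permSwap_braid (n : ℕ) :
    (Equiv.swap 0 1 : Equiv.Perm (Fin (n + 3))) * permLift (n + 2) (Equiv.swap 0 1) *
      Equiv.swap 0 1 =
    permLift (n + 2) (Equiv.swap 0 1) * Equiv.swap 0 1 * permLift (n + 2) (Equiv.swap 0 1) := by
  have h : permLift (n + 2) (Equiv.swap 0 1) = Equiv.swap (Fin.succ 0) (Fin.succ 1) := by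
    ext x
    induction x using Fin.cases with
    | zero => rw [Equiv.swap_apply_of_ne_of_ne (by simp) (Fin.succ_ne_zero _).symm]; rfl
    | succ x =>
      rw [permLift_succ, ← (Fin.succ_injective _).swap_apply]
  have h01 : (0 : Fin (n + 3)) ≠ Fin.succ 0 := (Fin.succ_ne_zero _).symm
  have h02 : (0 : Fin (n + 3)) ≠ Fin.succ 1 := (Fin.succ_ne_zero _).symm
  have h12 : (Fin.succ 0 : Fin (n + 3)) ≠ Fin.succ 1 :=
    fun h => absurd (Fin.succ_injective _ h) (Fin.succ_ne_zero (0 : Fin (n + 1))).symm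
  have e1 := Equiv.swap_mul_swap_mul_swap h12.symm h02.symm
  have e2 := Equiv.swap_mul_swap_mul_swap h01 h02
  rw [Equiv.swap_comm (Fin.succ 0) 0, Equiv.swap_comm (Fin.succ 1) (Fin.succ 0)] at e1
  rw [Equiv.swap_comm (Fin.succ 1) 0] at e2
  rw [h]
  exact e1.trans e2.symm

theorem permCycle_apply_zero (n : ℕ) (k : Fin (n + 1)) :
    towerCycle permLift (fun _ => Equiv.swap 0 1) n k 0 = k := by
  induction n with
  | zero => exact (Fin.fin_one_eq_zero k).symm
  | succ n ih =>
    induction k using Fin.cases with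
    | zero => rfl
    | succ k =>
      rw [towerCycle_succ, Equiv.Perm.mul_apply, Equiv.swap_apply_left]
      change permLift (n + 1) _ (Fin.succ 0) = _
      rw [permLift_succ, ih]

theorem exists_eq_cycle_mul_lift (n : ℕ) (σ : Equiv.Perm (Fin (n + 1))) :
    ∃ τ, σ = towerCycle permLift (fun _ => Equiv.swap 0 1) n (σ 0) * permLift n τ := by
  refine ⟨permRest n ((towerCycle permLift (fun _ => Equiv.swap 0 1) n (σ 0))⁻¹ * σ), ?_⟩
  rw [permLift_rest, mul_inv_cancel_left]
  rw [Equiv.Perm.mul_apply, Equiv.Perm.inv_eq_iff_eq, permCycle_apply_zero]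

theorem towerAct_cycle_mul_lift (n : ℕ) (k : Fin (n + 1)) (τ : Equiv.Perm (Fin n)) :
    towerAct L t (n + 1) (towerCycle permLift (fun _ => Equiv.swap 0 1) n k * permLift n τ) =
      towerCycle L t n k * L n (towerAct L t n τ) := by
  have h0 : (towerCycle permLift (fun _ => Equiv.swap 0 1) n k * permLift n τ) 0 = k := by
    rw [Equiv.Perm.mul_apply, permLift_zero, permCycle_apply_zero]
  rw [towerAct, h0, inv_mul_cancel_left, permRest_lift]

theorem towerAct_one (n : ℕ) : towerAct L t n 1 = 1 := by
  induction n with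
  | zero => rfl
  | succ n ih =>
    have := towerAct_cycle_mul_lift L t n 0 1
    rwa [towerCycle_zero, towerCycle_zero, map_one, mul_one, one_mul, ih, map_one] at this

theorem towerAct_swap_mul
    (hsq : ∀ n, t n * t n = 1)
    (hcomm : ∀ n x, t n * L (n + 1) (L n x) = L (n + 1) (L n x) * t n)
    (hbraid : ∀ n, t (n + 1) * L (n + 2) (t n) * t (n + 1) =
      L (n + 2) (t n) * t (n + 1) * L (n + 2) (t n))
    (n i : ℕ) (σ : Equiv.Perm (Fin n)) :
    towerAct L t n (towerSwap permLift (fun _ => Equiv.swap 0 1) n i * σ) =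
      towerSwap L t n i * towerAct L t n σ := by
  induction n generalizing i with
  | zero => cases i <;> simp [towerAct, towerSwap]
  | succ n ih =>
    obtain ⟨k', j, h⟩ := towerSwap_mul_towerCycle
      (M := fun n => Equiv.Perm (Fin n) × M n)
      (fun n => (permLift n).prodMap (L n)) (fun n => (Equiv.swap 0 1, t n))
      (fun n => Prod.ext (permSwap_sq n) (hsq n))
      (fun n x => Prod.ext (permSwap_comm n x.1) (hcomm n x.2))
      (fun n => Prod.ext (permSwap_braid n) (hbraid n)) n i (σ 0)
    have sw : ∀ n i, towerSwap (M := fun n => Equiv.Perm (Fin n) × M n)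
        (fun n => (permLift n).prodMap (L n)) (fun n => (Equiv.swap 0 1, t n)) n i =
        (towerSwap permLift (fun _ => Equiv.swap 0 1) n i, towerSwap L t n i) := by
      intro n
      induction n with
      | zero => intro i; rfl
      | succ n ih =>
        intro i
        cases i with
        | zero => cases n <;> rfl
        | succ i => rw [towerSwap_succ, towerSwap_succ, towerSwap_succ, ih]; rfl
    have cy : ∀ n k, towerCycle (M := fun n => Equiv.Perm (Fin n) × M n)
        (fun n => (permLift n).prodMap (L n)) (fun n => (Equiv.swap 0 1, t n)) n k =
        (towerCycle permLift (fun _ => Equiv.swap 0 1) n k, towerCycle L t n k) := by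
      intro n
      induction n with
      | zero => intro i; rfl
      | succ n ih =>
        intro k
        induction k using Fin.cases with
        | zero => rfl
        | succ k => rw [towerCycle_succ, towerCycle_succ, towerCycle_succ, ih]; rfl
    rw [sw, sw, cy, cy, Prod.ext_iff] at h
    obtain ⟨hp, hm⟩ := h
    simp only [Prod.fst_mul, Prod.snd_mul, MonoidHom.prodMap_def, MonoidHom.prod_apply,
      MonoidHom.comp_apply, MonoidHom.coe_fst, MonoidHom.coe_snd] at hp hm
    obtain ⟨τ, hτ⟩ := exists_eq_cycle_mul_lift n σ
    conv_lhs => rw [hτ, ← mul_assoc, hp, mul_assoc, ← map_mul, towerAct_cycle_mul_lift, ih,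
      map_mul, ← mul_assoc, ← hm, mul_assoc, ← towerAct_cycle_mul_lift, ← hτ]

theorem permSwap_closure (n : ℕ) : Submonoid.closure
    (Set.range (towerSwap permLift (fun _ => Equiv.swap 0 1) n)) = ⊤ := by
  induction n with
  | zero => exact Subsingleton.elim _ _
  | succ n ih =>
    have hl : ∀ n, Submonoid.closure
        (Set.range (towerSwap permLift (fun _ => Equiv.swap 0 1) n)) = ⊤ → ∀ τ, permLift n τ ∈ 
        Submonoid.closure
          (Set.range (towerSwap permLift (fun _ => Equiv.swap 0 1) (n + 1))) := by
      intro n hn τ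
      have : τ ∈ Submonoid.closure
        (Set.range (towerSwap permLift (fun _ => Equiv.swap 0 1) n)) := hn ▸ Submonoid.mem_top τ
      induction this using Submonoid.closure_induction with
      | mem x hx =>
        obtain ⟨i, rfl⟩ := hx
        exact Submonoid.subset_closure ⟨i + 1, towerSwap_succ _ _ _ _⟩
      | one => rw [map_one]; exact one_mem _
      | mul x y _ _ hx hy => rw [map_mul]; exact mul_mem hx hy
    rw [eq_top_iff]
    intro σ _
    obtain ⟨τ, hτ⟩ := exists_eq_cycle_mul_lift n σ
    rw [hτ]
    refine mul_mem ?_ (hl n ih τ)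
    generalize σ 0 = k
    cases n with
    | zero => exact one_mem _
    | succ n =>
      induction k using Fin.cases with
      | zero => rw [towerCycle_zero]; exact one_mem _
      | succ k =>
        rw [towerCycle_succ]
        exact mul_mem (hl _ ih _) (Submonoid.subset_closure ⟨0, rfl⟩)

/-- The homomorphism from the symmetric group to `M n` that sends the transposition of the `i`-th
and the `(i+1)`-st letter to `towerSwap L t n i`. -/
def towerHom
    (hsq : ∀ n, t n * t n = 1)
    (hcomm : ∀ n x, t n * L (n + 1) (L n x) = L (n + 1) (L n x) * t n)
    (hbraid : ∀ n, t (n + 1) * L (n + 2) (t n) * t (n + 1) =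
      L (n + 2) (t n) * t (n + 1) * L (n + 2) (t n))
    (n : ℕ) : Equiv.Perm (Fin n) →* M n where
  toFun := towerAct L t n
  map_one' := towerAct_one L t n
  map_mul' g σ := by
    have : g ∈ Submonoid.closure
        (Set.range (towerSwap permLift (fun _ => Equiv.swap 0 1) n)) :=
      permSwap_closure n ▸ Submonoid.mem_top g
    induction this using Submonoid.closure_induction generalizing σ with
    | mem x hx =>
      obtain ⟨i, rfl⟩ := hx
      have h1 := towerAct_swap_mul L t hsq hcomm hbraid n i 1
      rw [mul_one, towerAct_one, mul_one] at h1
      rw [towerAct_swap_mul L t hsq hcomm hbraid, h1]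
    | one => rw [one_mul, towerAct_one, one_mul]
    | mul x y _ _ hx hy => rw [mul_assoc, hx, hy, hx y, mul_assoc]

theorem towerHom_swap
    (hsq : ∀ n, t n * t n = 1)
    (hcomm : ∀ n x, t n * L (n + 1) (L n x) = L (n + 1) (L n x) * t n)
    (hbraid : ∀ n, t (n + 1) * L (n + 2) (t n) * t (n + 1) =
      L (n + 2) (t n) * t (n + 1) * L (n + 2) (t n))
    (n i : ℕ) :
    towerHom L t hsq hcomm hbraid n (towerSwap permLift (fun _ => Equiv.swap 0 1) n i) =
      towerSwap L t n i := by
  have h1 := towerAct_swap_mul L t hsq hcomm hbraid n i 1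
  rwa [mul_one, towerAct_one, mul_one] at h1

end Tower

end SymmetricGroup

section TensorPower

variable {A : Type u} [Category.{v} A] [MonoidalCategory A] [SymmetricCategory A]

/-- `X^{⊗ n} = X ⊗ (X ⊗ (⋯ ⊗ (X ⊗ 𝟙)))`. -/
def tensorPow (X : A) : ℕ → A
  | 0 => 𝟙_ A
  | n + 1 => X ⊗ tensorPow X n

/-- The commutativity constraint on the first two factors of `X ⊗ (X ⊗ P)`. -/
def swapFirst (X P : A) : X ⊗ (X ⊗ P) ⟶ X ⊗ (X ⊗ P) :=
  (α_ X X P).inv ≫ (β_ X X).hom ▷ P ≫ (α_ X X P).hom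

theorem swapFirst_sq (X P : A) : swapFirst X P ≫ swapFirst X P = 𝟙 _ := by
  simp [swapFirst, ← comp_whiskerRight_assoc]

theorem swapFirst_natural (X : A) {P Q : A} (f : P ⟶ Q) :
    X ◁ X ◁ f ≫ swapFirst X Q = swapFirst X P ≫ X ◁ X ◁ f := by
  simp only [swapFirst, Category.assoc]
  rw [associator_inv_naturality_right_assoc, whisker_exchange_assoc,
    associator_naturality_right]

theorem swapFirst_braid (X P : A) :
    swapFirst X (X ⊗ P) ≫ X ◁ swapFirst X P ≫ swapFirst X (X ⊗ P) =
      X ◁ swapFirst X P ≫ swapFirst X (X ⊗ P) ≫ X ◁ swapFirst X P := by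
  have h := congrArg (fun f => X ◁ (α_ X X P).inv ≫ (α_ X (X ⊗ X) P).inv ≫ (α_ X X X).inv ▷ P ≫
    f ▷ P ≫ (α_ (X ⊗ X) X P).hom ≫ (α_ X X (X ⊗ P)).hom)
    (BraidedCategory.yang_baxter' X X X)
  convert! h using 1
  all_goals simp only [swapFirst, monoidalComp]; monoidal


/-- `X ◁ -` on endomorphisms, as a homomorphism of monoids. -/
def whiskerLeftEnd (X P : A) : End P →* End (X ⊗ P) where
  toFun f := X ◁ f
  map_one' := whiskerLeft_id X P
  map_mul' f g := whiskerLeft_comp X g f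

/-- The action of `Σ_n` on `X^{⊗ n}` through the commutativity constraint: the transposition of two
neighbouring letters acts by the commutativity constraint of the two corresponding factors. -/
def tensorPowAction (X : A) (n : ℕ) : Equiv.Perm (Fin n) →* End (tensorPow X n) :=
  towerHom (M := fun n => End (tensorPow X n)) (fun n => whiskerLeftEnd X (tensorPow X n))
    (fun n => swapFirst X (tensorPow X n))
    (fun n => swapFirst_sq X (tensorPow X n))
    (fun _ f => swapFirst_natural X f)
    (fun n => by
      have h := swapFirst_braid X (tensorPow X n)
      exact h) n

end TensorPower

section GrothendieckGroup

attribute [instance] hasBinaryBiproducts_of_finite_biproducts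

variable (A : Type u) [Category.{v} A] [Preadditive A] [HasFiniteBiproducts A]

/-- The relations `[Z] = [X] + [Y]` for `Z ≅ X ⊕ Y`; they include `[Z] = [X]` for `Z ≅ X`. -/
def K0Relations : AddSubgroup (FreeAbelianGroup A) :=
  AddSubgroup.closure {r | ∃ X Y Z : A, Nonempty (Z ≅ X ⊞ Y) ∧
    r = FreeAbelianGroup.of Z - FreeAbelianGroup.of X - FreeAbelianGroup.of Y}

/-- The Grothendieck group of an additive category. -/
def K0 : Type u := FreeAbelianGroup A ⧸ K0Relations A

instance : AddCommGroup (K0 A) :=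
  inferInstanceAs (AddCommGroup (FreeAbelianGroup A ⧸ K0Relations A))

variable {A}

/-- The class of an object. -/
def cl (X : A) : K0 A := QuotientAddGroup.mk' (K0Relations A) (FreeAbelianGroup.of X)

theorem cl_of_iso_biprod {X Y Z : A} (e : Z ≅ X ⊞ Y) : cl Z = cl X + cl Y := by
  have h : QuotientAddGroup.mk' (K0Relations A) (FreeAbelianGroup.of Z - FreeAbelianGroup.of X -
      FreeAbelianGroup.of Y) = 0 :=
    (QuotientAddGroup.eq_zero_iff _).2 (AddSubgroup.subset_closure ⟨X, Y, Z, ⟨e⟩, rfl⟩)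
  rw [map_sub, map_sub, sub_sub, sub_eq_zero] at h
  exact h

theorem cl_biprod (X Y : A) : cl (X ⊞ Y) = cl X + cl Y := cl_of_iso_biprod (Iso.refl _)

theorem cl_eq_of_iso {X Y : A} (e : X ≅ Y) : cl X = cl Y := by
  have h : Y ⊞ Y ≅ X ⊞ Y := biprod.mapIso e.symm (Iso.refl Y)
  have h1 := cl_of_iso_biprod h
  rw [cl_biprod] at h1
  exact (add_right_cancel h1).symm

/-- The homomorphism on `K_0` given by a function on objects that is additive on direct sums. -/
def K0.lift {G : Type*} [AddCommGroup G] (f : A → G)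
    (h : ∀ X Y Z : A, Nonempty (Z ≅ X ⊞ Y) → f Z = f X + f Y) : K0 A →+ G :=
  QuotientAddGroup.lift _ (FreeAbelianGroup.lift f) (by
    intro x hx
    induction hx using AddSubgroup.closure_induction with
    | mem x hx =>
      obtain ⟨X, Y, Z, e, rfl⟩ := hx
      simp [h X Y Z e]
    | zero => exact zero_mem _
    | add x y _ _ hx hy => exact add_mem hx hy
    | neg x _ hx => exact neg_mem hx)

@[simp] theorem K0.lift_cl {G : Type*} [AddCommGroup G] (f : A → G)
    (h : ∀ X Y Z : A, Nonempty (Z ≅ X ⊞ Y) → f Z = f X + f Y) (X : A) :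
    K0.lift f h (cl X) = f X :=
  FreeAbelianGroup.lift_apply_of f X

theorem K0.hom_ext {G : Type*} [AddCommGroup G] {f g : K0 A →+ G} (h : ∀ X, f (cl X) = g (cl X)) :
    f = g :=
  QuotientAddGroup.addMonoidHom_ext _ (FreeAbelianGroup.lift_ext _ _ fun X => h X)

theorem K0.induction {p : K0 A → Prop} (x : K0 A) (h0 : ∀ X, p (cl X))
    (hadd : ∀ x y, p x → p y → p (x + y)) (hneg : ∀ x, p x → p (-x)) : p x := by
  obtain ⟨y, rfl⟩ := QuotientAddGroup.mk'_surjective _ x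
  induction y using FreeAbelianGroup.induction_on with
  | zero =>
    have X : A := ⨁ (PEmpty.elim : PEmpty.{1} → A)
    have := hadd _ _ (h0 X) (hneg _ (h0 X))
    rwa [add_neg_cancel] at this
  | of X => exact h0 X
  | neg X h => rw [map_neg]; exact hneg _ h
  | add x y hx hy => rw [map_add]; exact hadd _ _ hx hy

/-- The biadditive map on Grothendieck groups given by a biadditive operation on objects. -/
def K0.lift₂ {B : Type*} [Category* B] [Preadditive B] [HasFiniteBiproducts B]
    {G : Type*} [AddCommGroup G] (f : A → B → G)
    (h₁ : ∀ (X Y Z : A) (W : B), Nonempty (Z ≅ X ⊞ Y) → f Z W = f X W + f Y W)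
    (h₂ : ∀ (W : A) (X Y Z : B), Nonempty (Z ≅ X ⊞ Y) → f W Z = f W X + f W Y) :
    K0 A →+ K0 B →+ G :=
  K0.lift (fun X => K0.lift (f X) (h₂ X)) fun X Y Z e => K0.hom_ext fun W => by
    simp [h₁ X Y Z W e]

@[simp] theorem K0.lift₂_cl {B : Type*} [Category* B] [Preadditive B] [HasFiniteBiproducts B]
    {G : Type*} [AddCommGroup G] (f : A → B → G)
    (h₁ : ∀ (X Y Z : A) (W : B), Nonempty (Z ≅ X ⊞ Y) → f Z W = f X W + f Y W)
    (h₂ : ∀ (W : A) (X Y Z : B), Nonempty (Z ≅ X ⊞ Y) → f W Z = f W X + f W Y) (X : A) (Y : B) :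
    K0.lift₂ f h₁ h₂ (cl X) (cl Y) = f X Y := by
  simp [K0.lift₂]

/-- A function on objects that is the class of an additive functor is additive on direct sums. -/
theorem cl_functor_biprod {B : Type*} [Category* B] [Preadditive B] [HasFiniteBiproducts B]
    (F : A ⥤ B) [F.Additive] (X Y Z : A) (e : Nonempty (Z ≅ X ⊞ Y)) :
    cl (F.obj Z) = cl (F.obj X) + cl (F.obj Y) :=
  haveI := Limits.preservesBinaryBiproducts_of_preservesBiproducts F
  cl_of_iso_biprod (F.mapIso e.some ≪≫ F.mapBiprod X Y)

end GrothendieckGroup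

section GrothendieckRing

variable (A : Type u) [Category.{v} A] [Preadditive A] [HasFiniteBiproducts A]
  [MonoidalCategory A] [MonoidalPreadditive A] [SymmetricCategory A]

/-- The product `[X] [Y] = [X ⊗ Y]` on the Grothendieck group. -/
def K0.mulHom : K0 A →+ K0 A →+ K0 A :=
  K0.lift₂ (fun X Y => cl (X ⊗ Y))
    (fun X Y Z W e => cl_functor_biprod (tensorRight W) X Y Z e)
    (fun W X Y Z e => cl_functor_biprod (tensorLeft W) X Y Z e)

instance : Mul (K0 A) := ⟨fun x y => K0.mulHom A x y⟩

instance : One (K0 A) := ⟨cl (𝟙_ A)⟩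

variable {A}

theorem K0.one_def : (1 : K0 A) = cl (𝟙_ A) := rfl

theorem K0.mul_def (x y : K0 A) : x * y = K0.mulHom A x y := rfl

theorem K0.cl_mul_cl (X Y : A) : cl X * cl Y = cl (X ⊗ Y) := by
  rw [K0.mul_def, K0.mulHom, K0.lift₂_cl]

theorem K0.mul_comm' (x y : K0 A) : x * y = y * x := by
  refine DFunLike.congr_fun (DFunLike.congr_fun (?_ : K0.mulHom A = (K0.mulHom A).flip) x) y
  refine K0.hom_ext fun X => K0.hom_ext fun Y => ?_
  rw [AddMonoidHom.flip_apply, ← K0.mul_def, ← K0.mul_def, K0.cl_mul_cl, K0.cl_mul_cl]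
  exact cl_eq_of_iso (β_ X Y)

theorem K0.add_mul' (x y z : K0 A) : (x + y) * z = x * z + y * z := by
  simp [K0.mul_def]

theorem K0.mul_add' (x y z : K0 A) : x * (y + z) = x * y + x * z := by
  simp [K0.mul_def]

theorem K0.neg_mul' (x y : K0 A) : -x * y = -(x * y) := by
  simp [K0.mul_def]

theorem K0.mul_neg' (x y : K0 A) : x * -y = -(x * y) := by
  simp [K0.mul_def]

theorem K0.mul_assoc' (x y z : K0 A) : x * y * z = x * (y * z) := by
  induction x using K0.induction with
  | hadd a b ha hb => simp only [K0.add_mul', ha, hb]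
  | hneg a ha => simp only [K0.neg_mul', ha]
  | h0 X =>
    induction y using K0.induction with
    | hadd a b ha hb => simp only [K0.mul_add', K0.add_mul', ha, hb]
    | hneg a ha => simp only [K0.mul_neg', K0.neg_mul', ha]
    | h0 Y =>
      induction z using K0.induction with
      | hadd a b ha hb => simp only [K0.mul_add', ha, hb]
      | hneg a ha => simp only [K0.mul_neg', ha]
      | h0 Z =>
        rw [K0.cl_mul_cl, K0.cl_mul_cl, K0.cl_mul_cl, K0.cl_mul_cl]
        exact cl_eq_of_iso (α_ X Y Z)

theorem K0.one_mul' (x : K0 A) : 1 * x = x := by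
  induction x using K0.induction with
  | h0 X => rw [K0.one_def, K0.cl_mul_cl]; exact cl_eq_of_iso (λ_ X)
  | hadd a b ha hb => rw [K0.mul_add', ha, hb]
  | hneg a ha => rw [K0.mul_neg', ha]

/-- The Grothendieck ring of an additive tensor category. -/
instance : CommRing (K0 A) where
  __ := (inferInstance : AddCommGroup (K0 A))
  mul_assoc := K0.mul_assoc'
  one_mul := K0.one_mul'
  mul_one x := by rw [K0.mul_comm', K0.one_mul']
  left_distrib := K0.mul_add'
  right_distrib := K0.add_mul'
  zero_mul x := by simp [K0.mul_def]
  mul_zero x := by simp [K0.mul_def]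
  mul_comm := K0.mul_comm'

end GrothendieckRing

section Induction

/-- The block embedding `Σ_p × Σ_q → Σ_n` for `p + q = n`. -/
def youngEmb {p q n : ℕ} (h : p + q = n) :
    Equiv.Perm (Fin p) × Equiv.Perm (Fin q) →* Equiv.Perm (Fin n) :=
  (finSumFinEquiv.trans (finCongr h)).permCongrHom.toMonoidHom.comp
    (Equiv.Perm.sumCongrHom (Fin p) (Fin q))

/-- The position of a letter of the first block. -/
def blockL {p q n : ℕ} (h : p + q = n) (i : Fin p) : Fin n := ⟨i, by omega⟩

/-- The position of a letter of the second block. -/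
def blockR {p q n : ℕ} (h : p + q = n) (i : Fin q) : Fin n := ⟨p + i, by omega⟩

theorem youngEmb_blockL {p q n : ℕ} (h : p + q = n) (a : Equiv.Perm (Fin p))
    (b : Equiv.Perm (Fin q)) (i : Fin p) : youngEmb h (a, b) (blockL h i) = blockL h (a i) := by
  have e : ∀ i, blockL h i = (finSumFinEquiv.trans (finCongr h)) (Sum.inl i) := fun i => by
    ext; simp [blockL]
  rw [e, e]
  simp [youngEmb, Equiv.permCongrHom, Equiv.permCongr_apply]

theorem youngEmb_blockR {p q n : ℕ} (h : p + q = n) (a : Equiv.Perm (Fin p))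
    (b : Equiv.Perm (Fin q)) (i : Fin q) : youngEmb h (a, b) (blockR h i) = blockR h (b i) := by
  have e : ∀ i, blockR h i = (finSumFinEquiv.trans (finCongr h)) (Sum.inr i) := fun i => by
    ext; simp [blockR]
  rw [e, e]
  simp [youngEmb, Equiv.permCongrHom, Equiv.permCongr_apply]

theorem block_cases {p q n : ℕ} (h : p + q = n) (x : Fin n) :
    (∃ i, x = blockL h i) ∨ ∃ i, x = blockR h i := by
  by_cases hx : (x : ℕ) < p
  · exact Or.inl ⟨⟨x, hx⟩, rfl⟩
  · exact Or.inr ⟨⟨x - p, by omega⟩, by ext; simp [blockR]; omega⟩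

theorem youngEmb_assoc {p q r m l n : ℕ} (h₁ : p + q = m) (h₂ : m + r = n) (h₃ : q + r = l)
    (h₄ : p + l = n) (a : Equiv.Perm (Fin p)) (b : Equiv.Perm (Fin q)) (c : Equiv.Perm (Fin r)) :
    youngEmb h₂ (youngEmb h₁ (a, b), c) = youngEmb h₄ (a, youngEmb h₃ (b, c)) := by
  have eL : ∀ i, blockL h₂ (blockL h₁ i) = blockL h₄ i := fun i => rfl
  have eM : ∀ i, blockL h₂ (blockR h₁ i) = blockR h₄ (blockL h₃ i) := fun i => rfl
  have eR : ∀ i, blockR h₂ i = blockR h₄ (blockR h₃ i) := fun i => by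
    ext; simp [blockR]; omega
  ext1 x
  rcases block_cases h₂ x with ⟨y, rfl⟩ | ⟨z, rfl⟩
  · rcases block_cases h₁ y with ⟨y, rfl⟩ | ⟨z, rfl⟩
    · rw [youngEmb_blockL, youngEmb_blockL, eL, eL, youngEmb_blockL]
    · rw [youngEmb_blockL, youngEmb_blockR, eM, eM, youngEmb_blockR, youngEmb_blockL]
  · rw [youngEmb_blockR, eR, eR, youngEmb_blockR, youngEmb_blockR]

theorem youngEmb_zero {n : ℕ} (h : 0 + n = n) (a : Equiv.Perm (Fin 0)) (b : Equiv.Perm (Fin n)) :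
    youngEmb h (a, b) = b := by
  have e : ∀ i, blockR h i = i := fun i => by ext; simp [blockR]
  ext1 x
  conv_lhs => rw [← e x, youngEmb_blockR, e]

theorem exists_youngEmb_comm {p q n : ℕ} (h : p + q = n) (h' : q + p = n) :
    ∃ τ : Equiv.Perm (Fin n), ∀ a b, youngEmb h (a, b) * τ = τ * youngEmb h' (b, a) := by
  let e := finSumFinEquiv.trans (finCongr h)
  let e' := finSumFinEquiv.trans (finCongr h')
  have hL : ∀ i, e (Sum.inl i) = blockL h i := fun i => by ext; simp [e, blockL]
  have hR : ∀ i, e (Sum.inr i) = blockR h i := fun i => by ext; simp [e, blockR]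
  have hL' : ∀ i, e' (Sum.inl i) = blockL h' i := fun i => by ext; simp [e', blockL]
  have hR' : ∀ i, e' (Sum.inr i) = blockR h' i := fun i => by ext; simp [e', blockR]
  let τ : Equiv.Perm (Fin n) := (e'.symm.trans (Equiv.sumComm _ _)).trans e
  have tL : ∀ i, τ (blockL h' i) = blockR h i := fun i => by rw [← hL', ← hR]; simp [τ]
  have tR : ∀ i, τ (blockR h' i) = blockL h i := fun i => by rw [← hR', ← hL]; simp [τ]
  refine ⟨τ, fun a b => ?_⟩
  ext1 x
  rcases block_cases h' x with ⟨y, rfl⟩ | ⟨z, rfl⟩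
  · rw [Equiv.Perm.mul_apply, Equiv.Perm.mul_apply, tL, youngEmb_blockL, youngEmb_blockR, tL]
  · rw [Equiv.Perm.mul_apply, Equiv.Perm.mul_apply, tR, youngEmb_blockL, youngEmb_blockR, tR]

section Unbundled

variable {p q n : ℕ} (h : p + q = n) {V W : Type} [AddCommGroup V] [Module ℚ V]
  [AddCommGroup W] [Module ℚ W] (ρ : Representation ℚ (Equiv.Perm (Fin p)) V)
  (σ : Representation ℚ (Equiv.Perm (Fin q)) W)

/-- The representation `V ⊗ W` of `Σ_p × Σ_q`. -/
noncomputable def extTensor :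
    Representation ℚ (Equiv.Perm (Fin p) × Equiv.Perm (Fin q)) (V ⊗[ℚ] W) :=
  Representation.tprod (MonoidHom.comp ρ (MonoidHom.fst _ _)) (MonoidHom.comp σ (MonoidHom.snd _ _))

/-- The representation of `Σ_n` induced from the representation `V ⊗ W` of `Σ_p × Σ_q`. -/
noncomputable def indRep : Representation ℚ (Equiv.Perm (Fin n))
    (Representation.IndV (youngEmb h) (extTensor ρ σ)) :=
  Representation.ind (youngEmb h) (extTensor ρ σ)

/-- The universal bilinear map to the induced representation. -/
noncomputable def indMk :
    V →ₗ[ℚ] W →ₗ[ℚ] Representation.IndV (youngEmb h) (extTensor ρ σ) :=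
  (TensorProduct.mk ℚ V W).compr₂ (Representation.IndV.mk (youngEmb h) (extTensor ρ σ) 1)

theorem extTensor_tmul (a : Equiv.Perm (Fin p)) (b : Equiv.Perm (Fin q)) (v : V) (w : W) :
    extTensor ρ σ (a, b) (v ⊗ₜ w) = ρ a v ⊗ₜ σ b w := rfl

theorem indRep_mk (x : Equiv.Perm (Fin n)) (v : V ⊗[ℚ] W) :
    indRep h ρ σ x (Representation.IndV.mk (youngEmb h) (extTensor ρ σ) 1 v) =
      Representation.IndV.mk (youngEmb h) (extTensor ρ σ) x⁻¹ v := by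
  rw [indRep, Representation.ind_mk, one_mul]

theorem indRep_indMk (a : Equiv.Perm (Fin p)) (b : Equiv.Perm (Fin q)) (v : V) (w : W) :
    indRep h ρ σ (youngEmb h (a, b)) (indMk h ρ σ v w) = indMk h ρ σ (ρ a v) (σ b w) := by
  have := Representation.Coinvariants.mk_self_apply
    ((Representation.tprod (MonoidHom.comp (Representation.leftRegular ℚ _) (youngEmb h))
      (extTensor ρ σ)))
    (a, b) ((MonoidAlgebra.single (youngEmb h (a, b))⁻¹ 1) ⊗ₜ (v ⊗ₜ w))
  rw [Representation.tprod_apply, TensorProduct.map_tmul, extTensor_tmul] at this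
  refine (indRep_mk h ρ σ _ _).trans (this.symm.trans ?_)
  simp [indMk]

variable {T : Type} [AddCommGroup T] [Module ℚ T] (θ : Representation ℚ (Equiv.Perm (Fin n)) T)

theorem ind_hom_ext {f g : Representation.IndV (youngEmb h) (extTensor ρ σ) →ₗ[ℚ] T}
    (hf : ∀ x v, f (indRep h ρ σ x v) = θ x (f v)) (hg : ∀ x v, g (indRep h ρ σ x v) = θ x (g v))
    (hfg : ∀ v w, f (indMk h ρ σ v w) = g (indMk h ρ σ v w)) : f = g := by
  refine Representation.IndV.hom_ext _ _ fun x => TensorProduct.ext' fun v w => ?_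
  have e := indRep_mk h ρ σ x⁻¹ (v ⊗ₜ w)
  rw [inv_inv] at e
  change f (Representation.IndV.mk (youngEmb h) (extTensor ρ σ) x (v ⊗ₜ w)) =
    g (Representation.IndV.mk (youngEmb h) (extTensor ρ σ) x (v ⊗ₜ w))
  rw [← e, hf, hg]
  exact congrArg _ (hfg v w)

/-- The universal property of the induced representation. -/
theorem exists_ind_lift (β : V →ₗ[ℚ] W →ₗ[ℚ] T)
    (hβ : ∀ a b v w, β (ρ a v) (σ b w) = θ (youngEmb h (a, b)) (β v w)) :
    ∃ f : Representation.IndV (youngEmb h) (extTensor ρ σ) →ₗ[ℚ] T,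
      (∀ x v, f (indRep h ρ σ x v) = θ x (f v)) ∧ ∀ v w, f (indMk h ρ σ v w) = β v w := by
  let F : Rep.of (extTensor ρ σ) ⟶ Rep.res (youngEmb h) (Rep.of θ) :=
    Rep.ofHom ⟨TensorProduct.lift β, fun g => TensorProduct.ext' fun v w => hβ g.1 g.2 v w⟩
  let f := (Rep.indResHomEquiv (youngEmb h) (Rep.of (extTensor ρ σ)) (Rep.of θ)).symm F
  refine ⟨f.hom.toLinearMap, fun x v => Rep.hom_comm_apply f x v, fun v w => ?_⟩
  have e := (Rep.indResHomEquiv (youngEmb h) (Rep.of (extTensor ρ σ))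
    (Rep.of θ)).apply_symm_apply F
  have e2 := congrArg (fun G => G.hom.toLinearMap (v ⊗ₜ w)) e
  exact e2

end Unbundled
end Induction

section RepresentationRing

section FDRepHom

variable {G : Type} [Group G]

/-- A morphism of finite-dimensional representations, from an equivariant linear map. -/
def repHom {V W : FDRep ℚ G} (f : V →ₗ[ℚ] W) (hf : ∀ g v, f (V.ρ g v) = W.ρ g (f v)) : V ⟶ W :=
  ⟨FGModuleCat.ofHom f, fun g => by ext v; exact hf g v⟩

/-- The linear map underlying a morphism of representations. -/
def repLin {V W : FDRep ℚ G} (f : V ⟶ W) : V →ₗ[ℚ] W := f.hom.hom.hom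

theorem repLin_equivariant {V W : FDRep ℚ G} (f : V ⟶ W) (g : G) (v : V) :
    repLin f (V.ρ g v) = W.ρ g (repLin f v) := by
  have := congrArg (fun k => k.hom.hom v) (f.comm g)
  exact this

theorem repLin_comp {U V W : FDRep ℚ G} (f : U ⟶ V) (g : V ⟶ W) (u : U) :
    repLin (f ≫ g) u = repLin g (repLin f u) := rfl

theorem rep_ext {V W : FDRep ℚ G} {f g : V ⟶ W} (h : repLin f = repLin g) : f = g := by
  ext v
  exact DFunLike.congr_fun h v

theorem repLin_repHom {V W : FDRep ℚ G} (f : V →ₗ[ℚ] W)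
    (hf : ∀ g v, f (V.ρ g v) = W.ρ g (f v)) : repLin (repHom f hf) = f := rfl

theorem repLin_add {V W : FDRep ℚ G} (f g : V ⟶ W) : repLin (f + g) = repLin f + repLin g := rfl

/-- An isomorphism of representations from mutually inverse equivariant linear maps. -/
def repIso {V W : FDRep ℚ G} (f : V →ₗ[ℚ] W) (f' : W →ₗ[ℚ] V)
    (hf : ∀ g v, f (V.ρ g v) = W.ρ g (f v)) (hf' : ∀ g v, f' (W.ρ g v) = V.ρ g (f' v))
    (h : f' ∘ₗ f = LinearMap.id) (h' : f ∘ₗ f' = LinearMap.id) : V ≅ W where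
  hom := repHom f hf
  inv := repHom f' hf'
  hom_inv_id := rep_ext h
  inv_hom_id := rep_ext h'

instance : HasFiniteBiproducts (FDRep ℚ G) := HasFiniteBiproducts.of_hasFiniteProducts

end FDRepHom

/-- `R_n`: the Grothendieck group of the semisimple category of finite-dimensional
representations of `Σ_n` over `ℚ`. -/
def RepGroup (n : ℕ) : Type 1 := K0 (FDRep ℚ (Equiv.Perm (Fin n)))

instance (n : ℕ) : AddCommGroup (RepGroup n) :=
  inferInstanceAs (AddCommGroup (K0 (FDRep ℚ (Equiv.Perm (Fin n)))))

/-- `R = ⨁_n R_n`. -/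
def RepRing : Type 1 := DirectSum ℕ RepGroup

instance : AddCommGroup RepRing := inferInstanceAs (AddCommGroup (DirectSum ℕ RepGroup))

/-- The inclusion of `R_n` into `R`. -/
def RepRing.of (n : ℕ) : K0 (FDRep ℚ (Equiv.Perm (Fin n))) →+ RepRing :=
  DirectSum.of RepGroup n

/-- The homomorphism from `R` given by homomorphisms from the `R_n`. -/
def RepRing.lift {G : Type*} [AddCommGroup G]
    (f : ∀ n : ℕ, K0 (FDRep ℚ (Equiv.Perm (Fin n))) →+ G) : RepRing →+ G :=
  DirectSum.toAddMonoid (β := RepGroup) f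

theorem RepRing.lift_of {G : Type*} [AddCommGroup G]
    (f : ∀ n : ℕ, K0 (FDRep ℚ (Equiv.Perm (Fin n))) →+ G) (n : ℕ)
    (x : K0 (FDRep ℚ (Equiv.Perm (Fin n)))) : RepRing.lift f (RepRing.of n x) = f n x :=
  DirectSum.toAddMonoid_of (β := RepGroup) f n x

/-- The class in `R` of a representation of `Σ_n`. -/
def repCl {n : ℕ} (V : FDRep ℚ (Equiv.Perm (Fin n))) : RepRing :=
  RepRing.of n (cl V)

/-- The representation of `Σ_n` induced from the representation `V ⊗ W` of `Σ_p × Σ_q`, where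
`p + q = n`. -/
def indProd {p q n : ℕ} (h : p + q = n) (V : FDRep ℚ (Equiv.Perm (Fin p)))
    (W : FDRep ℚ (Equiv.Perm (Fin q))) : FDRep ℚ (Equiv.Perm (Fin n)) :=
  FDRep.of (indRep h V.ρ W.ρ)

section IndProd

variable {p q n : ℕ} (h : p + q = n)

theorem indProd_rho (V : FDRep ℚ (Equiv.Perm (Fin p))) (W : FDRep ℚ (Equiv.Perm (Fin q))) :
    (indProd h V W).ρ = indRep h V.ρ W.ρ := rfl

/-- The universal bilinear map. -/
def indι (V : FDRep ℚ (Equiv.Perm (Fin p))) (W : FDRep ℚ (Equiv.Perm (Fin q))) :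
    V →ₗ[ℚ] W →ₗ[ℚ] (indProd h V W) := indMk h V.ρ W.ρ

variable {V : FDRep ℚ (Equiv.Perm (Fin p))} {W : FDRep ℚ (Equiv.Perm (Fin q))}

theorem rho_indι (a : Equiv.Perm (Fin p)) (b : Equiv.Perm (Fin q)) (v : V) (w : W) :
    (indProd h V W).ρ (youngEmb h (a, b)) (indι h V W v w) =
      indι h V W (V.ρ a v) (W.ρ b w) := indRep_indMk h V.ρ W.ρ a b v w

theorem indProd_hom_ext {T : FDRep ℚ (Equiv.Perm (Fin n))} {f g : indProd h V W ⟶ T}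
    (hfg : ∀ v w, repLin f (indι h V W v w) = repLin g (indι h V W v w)) : f = g :=
  rep_ext (ind_hom_ext h V.ρ W.ρ T.ρ (repLin_equivariant f) (repLin_equivariant g) hfg)

theorem exists_indProd_lift {T : FDRep ℚ (Equiv.Perm (Fin n))} (β : V →ₗ[ℚ] W →ₗ[ℚ] T)
    (hβ : ∀ a b v w, β (V.ρ a v) (W.ρ b w) = T.ρ (youngEmb h (a, b)) (β v w)) :
    ∃ f : indProd h V W ⟶ T, ∀ v w, repLin f (indι h V W v w) = β v w := by
  obtain ⟨f, hf, hf'⟩ := exists_ind_lift h V.ρ W.ρ T.ρ β hβ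
  exact ⟨repHom f hf, hf'⟩

theorem exists_indMap {V' : FDRep ℚ (Equiv.Perm (Fin p))} (f : V ⟶ V')
    (W : FDRep ℚ (Equiv.Perm (Fin q))) : ∃ F : indProd h V W ⟶ indProd h V' W,
      ∀ v w, repLin F (indι h V W v w) = indι h V' W (repLin f v) w :=
  exists_indProd_lift h ((indι h V' W).comp (repLin f)) fun a b v w => by
    rw [LinearMap.comp_apply, LinearMap.comp_apply, rho_indι, repLin_equivariant]

/-- Induction as a functor in the first variable. -/
def indFunctorLeft (W : FDRep ℚ (Equiv.Perm (Fin q))) :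
    FDRep ℚ (Equiv.Perm (Fin p)) ⥤ FDRep ℚ (Equiv.Perm (Fin n)) where
  obj V := indProd h V W
  map f := (exists_indMap h f W).choose
  map_id V := indProd_hom_ext h fun v w => (exists_indMap h (𝟙 V) W).choose_spec v w
  map_comp {U V T} f g := indProd_hom_ext h fun v w => by
    rw [(exists_indMap h (f ≫ g) W).choose_spec, repLin_comp, repLin_comp,
      (exists_indMap h f W).choose_spec, (exists_indMap h g W).choose_spec]

instance (W : FDRep ℚ (Equiv.Perm (Fin q))) : (indFunctorLeft h W).Additive where
  map_add {U V f g} := indProd_hom_ext h fun v w => by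
    refine ((exists_indMap h (f + g) W).choose_spec v w).trans ?_
    rw [repLin_add, LinearMap.add_apply, map_add, LinearMap.add_apply]
    exact (congrArg₂ (· + ·) ((exists_indMap h f W).choose_spec v w)
      ((exists_indMap h g W).choose_spec v w)).symm

theorem cl_indProd_comm (h' : q + p = n) (V : FDRep ℚ (Equiv.Perm (Fin p)))
    (W : FDRep ℚ (Equiv.Perm (Fin q))) : cl (indProd h V W) = cl (indProd h' W V) := by
  obtain ⟨τ, hτ⟩ := exists_youngEmb_comm h h'
  obtain ⟨f, hf⟩ := exists_indProd_lift h (V := V) (W := W) (T := indProd h' W V)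
    ((indι h' W V).flip.compr₂ ((indProd h' W V).ρ τ)) (fun a b v w => by
      simp only [LinearMap.compr₂_apply, LinearMap.flip_apply]
      rw [← rho_indι, ← Module.End.mul_apply, ← Module.End.mul_apply, ← map_mul, ← map_mul, hτ])
  have hτ' : ∀ a b, youngEmb h' (b, a) * τ⁻¹ = τ⁻¹ * youngEmb h (a, b) := fun a b => by
    rw [mul_inv_eq_iff_eq_mul, mul_assoc, hτ, inv_mul_cancel_left]
  obtain ⟨g, hg⟩ := exists_indProd_lift h' (V := W) (W := V) (T := indProd h V W)
    ((indι h V W).flip.compr₂ ((indProd h V W).ρ τ⁻¹)) (fun a b v w => by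
      simp only [LinearMap.compr₂_apply, LinearMap.flip_apply]
      rw [← rho_indι, ← Module.End.mul_apply, ← Module.End.mul_apply, ← map_mul, ← map_mul, hτ'])
  refine cl_eq_of_iso ⟨f, g, indProd_hom_ext h fun v w => ?_, indProd_hom_ext h' fun v w => ?_⟩
  · rw [repLin_comp, hf, LinearMap.compr₂_apply, repLin_equivariant, LinearMap.flip_apply, hg,
      LinearMap.compr₂_apply, LinearMap.flip_apply, ← Module.End.mul_apply, ← map_mul,
      mul_inv_cancel, map_one]
    rfl
  · rw [repLin_comp, hg, LinearMap.compr₂_apply, repLin_equivariant, LinearMap.flip_apply, hf,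
      LinearMap.compr₂_apply, LinearMap.flip_apply, ← Module.End.mul_apply, ← map_mul,
      inv_mul_cancel, map_one]
    rfl

/-- The universal property of induction, with a further representation as parameter. -/
theorem exists_indProd_lift_param {r m n : ℕ} (h : p + q = m)
    (j : Equiv.Perm (Fin m) →* Equiv.Perm (Fin n)) (k : Equiv.Perm (Fin r) →* Equiv.Perm (Fin n))
    (hjk : ∀ x c, k c * j x = j x * k c) {P : FDRep ℚ (Equiv.Perm (Fin r))}
    {T : FDRep ℚ (Equiv.Perm (Fin n))} (γ : P →ₗ[ℚ] V →ₗ[ℚ] W →ₗ[ℚ] T)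
    (hγ : ∀ c a b w u v, γ (P.ρ c w) (V.ρ a u) (W.ρ b v) =
      T.ρ (j (youngEmb h (a, b)) * k c) (γ w u v)) :
    ∃ Γ : P →ₗ[ℚ] (indProd h V W) →ₗ[ℚ] T,
      (∀ c x w y, Γ (P.ρ c w) ((indProd h V W).ρ x y) = T.ρ (j x * k c) (Γ w y)) ∧
      ∀ w u v, Γ w (indι h V W u v) = γ w u v := by
  let θ : Representation ℚ (Equiv.Perm (Fin m)) T := MonoidHom.comp T.ρ j
  have hθ : ∀ x y, θ x y = T.ρ (j x) y := fun _ _ => rfl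
  have key := fun w : P => exists_ind_lift h V.ρ W.ρ θ (γ w) (fun a b u v => by
    have := hγ 1 a b w u v
    rw [map_one, map_one, mul_one] at this
    exact this)
  choose Γ hΓ hΓ' using key
  have hadd : ∀ w w', Γ (w + w') = Γ w + Γ w' := fun w w' =>
    ind_hom_ext h V.ρ W.ρ θ (hΓ _) (fun x y => by
      rw [LinearMap.add_apply, LinearMap.add_apply, hΓ, hΓ, map_add]) fun u v => by
      rw [LinearMap.add_apply, hΓ', hΓ', hΓ', map_add, LinearMap.add_apply, LinearMap.add_apply]
  have hsmul : ∀ (s : ℚ) w, Γ (s • w) = s • Γ w := fun s w =>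
    ind_hom_ext h V.ρ W.ρ θ (hΓ _) (fun x y => by
      rw [LinearMap.smul_apply, LinearMap.smul_apply, hΓ, map_smul]) fun u v => by
      rw [LinearMap.smul_apply, hΓ', hΓ', map_smul, LinearMap.smul_apply, LinearMap.smul_apply]
  refine ⟨⟨⟨Γ, hadd⟩, hsmul⟩, fun c x w y => ?_, hΓ'⟩
  have e : Γ (P.ρ c w) = (T.ρ (k c)).comp (Γ w) :=
    ind_hom_ext h V.ρ W.ρ θ (hΓ _) (fun x y => by
      rw [LinearMap.comp_apply, LinearMap.comp_apply, hΓ, hθ, hθ, ← Module.End.mul_apply,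
        ← Module.End.mul_apply, ← map_mul, ← map_mul, hjk]) fun u v => by
      have := hγ c 1 1 w u v
      rw [map_one, map_one, ← Prod.one_eq_mk, map_one, map_one, one_mul] at this
      rw [LinearMap.comp_apply, hΓ', hΓ']
      exact this
  refine (hΓ (P.ρ c w) x y).trans ?_
  rw [e, hθ, map_mul]
  rfl

theorem cl_indProd_assoc {r m l n : ℕ} (h₁ : p + q = m) (h₂ : m + r = n) (h₃ : q + r = l)
    (h₄ : p + l = n) (U : FDRep ℚ (Equiv.Perm (Fin p))) (V : FDRep ℚ (Equiv.Perm (Fin q)))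
    (W : FDRep ℚ (Equiv.Perm (Fin r))) :
    cl (indProd h₂ (indProd h₁ U V) W) = cl (indProd h₄ U (indProd h₃ V W)) := by
  have hsplit : ∀ {a b c : ℕ} (h : a + b = c) (x : Equiv.Perm (Fin a)) (y : Equiv.Perm (Fin b)),
      youngEmb h (x, 1) * youngEmb h (1, y) = youngEmb h (x, y) := fun h x y => by
    rw [← map_mul, Prod.mk_mul_mk, mul_one, one_mul]
  have hsplit' : ∀ {a b c : ℕ} (h : a + b = c) (x : Equiv.Perm (Fin a)) (y : Equiv.Perm (Fin b)),
      youngEmb h (1, y) * youngEmb h (x, 1) = youngEmb h (x, y) := fun h x y => by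
    rw [← map_mul, Prod.mk_mul_mk, mul_one, one_mul]
  let T := indProd h₄ U (indProd h₃ V W)
  let T' := indProd h₂ (indProd h₁ U V) W
  let γ : W →ₗ[ℚ] U →ₗ[ℚ] V →ₗ[ℚ] T :=
    { toFun := fun w => (indι h₄ U (indProd h₃ V W)).compl₂ ((indι h₃ V W).flip w)
      map_add' := fun w w' => LinearMap.ext₂ fun u v => by
        simp only [LinearMap.compl₂_apply, LinearMap.add_apply, map_add]
      map_smul' := fun s w => LinearMap.ext₂ fun u v => by
        simp only [LinearMap.compl₂_apply, LinearMap.smul_apply, map_smul, RingHom.id_apply] }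
  have hγ : ∀ w u v, γ w u v = indι h₄ U (indProd h₃ V W) u (indι h₃ V W v w) :=
    fun _ _ _ => rfl
  let γ' : U →ₗ[ℚ] V →ₗ[ℚ] W →ₗ[ℚ] T' :=
    { toFun := fun u => (indι h₂ (indProd h₁ U V) W).comp (indι h₁ U V u)
      map_add' := fun w w' => LinearMap.ext₂ fun u v => by
        simp only [LinearMap.comp_apply, LinearMap.add_apply, map_add]
      map_smul' := fun s w => LinearMap.ext₂ fun u v => by
        simp only [LinearMap.comp_apply, LinearMap.smul_apply, map_smul, RingHom.id_apply] }
  have hγ' : ∀ u v w, γ' u v w = indι h₂ (indProd h₁ U V) W (indι h₁ U V u v) w :=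
    fun _ _ _ => rfl
  obtain ⟨Γ, hΓ, hΓι⟩ := exists_indProd_lift_param h₁ (V := U) (W := V) (P := W) (T := T)
    ((youngEmb h₂).comp (MonoidHom.inl _ _)) ((youngEmb h₂).comp (MonoidHom.inr _ _))
    (fun x c => (hsplit' h₂ x c).trans (hsplit h₂ x c).symm) γ
    (fun c a b w u v => by
      rw [hγ, hγ, ← rho_indι, ← rho_indι, ← youngEmb_assoc h₁ h₂ h₃ h₄]
      exact congrArg (fun g => T.ρ g _) (hsplit h₂ _ c).symm)
  obtain ⟨Γ', hΓ', hΓι'⟩ := exists_indProd_lift_param h₃ (V := V) (W := W) (P := U) (T := T')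
    ((youngEmb h₄).comp (MonoidHom.inr _ _)) ((youngEmb h₄).comp (MonoidHom.inl _ _))
    (fun x c => (hsplit h₄ c x).trans (hsplit' h₄ c x).symm) γ'
    (fun c a b w u v => by
      rw [hγ', hγ', ← rho_indι, ← rho_indι, youngEmb_assoc h₁ h₂ h₃ h₄]
      exact congrArg (fun g => T'.ρ g _) (hsplit' h₄ c _).symm)
  obtain ⟨f, hf⟩ := exists_indProd_lift h₂ (V := indProd h₁ U V) (W := W) (T := T) Γ.flip
    (fun x c y w => (hΓ c x w y).trans (congrArg (fun g => T.ρ g _) (hsplit h₂ x c)))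
  obtain ⟨f', hf'⟩ := exists_indProd_lift h₄ (V := U) (W := indProd h₃ V W) (T := T') Γ'
    (fun c x u y => (hΓ' c x u y).trans (congrArg (fun g => T'.ρ g _) (hsplit' h₄ c x)))
  have hff : ∀ u v w, repLin f (indι h₂ (indProd h₁ U V) W (indι h₁ U V u v) w) =
      indι h₄ U (indProd h₃ V W) u (indι h₃ V W v w) := fun u v w =>
    (hf _ _).trans (hΓι w u v)
  have hff' : ∀ u v w, repLin f' (indι h₄ U (indProd h₃ V W) u (indι h₃ V W v w)) =
      indι h₂ (indProd h₁ U V) W (indι h₁ U V u v) w := fun u v w =>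
    (hf' _ _).trans (hΓι' u v w)
  have hT' : ∀ k : T' ⟶ T', (∀ u v w,
      repLin k (indι h₂ (indProd h₁ U V) W (indι h₁ U V u v) w) =
        indι h₂ (indProd h₁ U V) W (indι h₁ U V u v) w) → k = 𝟙 _ := by
    intro k hk
    refine indProd_hom_ext h₂ fun y w => ?_
    let θ : Representation ℚ (Equiv.Perm (Fin m)) T' :=
      MonoidHom.comp T'.ρ ((youngEmb h₂).comp (MonoidHom.inl _ _))
    have hθ : ∀ x y, indι h₂ (indProd h₁ U V) W ((indProd h₁ U V).ρ x y) w =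
        θ x (indι h₂ (indProd h₁ U V) W y w) := fun x y => by
      have := rho_indι h₂ (V := indProd h₁ U V) (W := W) x 1 y w
      rw [map_one] at this
      exact this.symm
    have e := ind_hom_ext h₁ U.ρ V.ρ θ
      (f := (repLin k).comp ((indι h₂ (indProd h₁ U V) W).flip w))
      (g := (indι h₂ (indProd h₁ U V) W).flip w)
      (fun x y => (congrArg (repLin k) (hθ x y)).trans (repLin_equivariant k _ _))
      (fun x y => hθ x y) (fun u v => hk u v w)
    exact DFunLike.congr_fun e y
  have hT : ∀ k : T ⟶ T, (∀ u v w,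
      repLin k (indι h₄ U (indProd h₃ V W) u (indι h₃ V W v w)) =
        indι h₄ U (indProd h₃ V W) u (indι h₃ V W v w)) → k = 𝟙 _ := by
    intro k hk
    refine indProd_hom_ext h₄ fun u y => ?_
    let θ : Representation ℚ (Equiv.Perm (Fin l)) T :=
      MonoidHom.comp T.ρ ((youngEmb h₄).comp (MonoidHom.inr _ _))
    have hθ : ∀ x y, indι h₄ U (indProd h₃ V W) u ((indProd h₃ V W).ρ x y) =
        θ x (indι h₄ U (indProd h₃ V W) u y) := fun x y => by
      have := rho_indι h₄ (V := U) (W := indProd h₃ V W) 1 x u y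
      rw [map_one] at this
      exact this.symm
    have e := ind_hom_ext h₃ V.ρ W.ρ θ
      (f := (repLin k).comp (indι h₄ U (indProd h₃ V W) u))
      (g := indι h₄ U (indProd h₃ V W) u)
      (fun x y => (congrArg (repLin k) (hθ x y)).trans (repLin_equivariant k _ _))
      (fun x y => hθ x y) (fun v w => hk u v w)
    exact DFunLike.congr_fun e y
  exact cl_eq_of_iso ⟨f, f', hT' _ fun u v w => by rw [repLin_comp, hff, hff'],
    hT _ fun u v w => by rw [repLin_comp, hff', hff]⟩

theorem cl_indProd_one (h : 0 + n = n) (V : FDRep ℚ (Equiv.Perm (Fin n))) :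
    cl (indProd h (FDRep.of (Representation.trivial ℚ (Equiv.Perm (Fin 0)) ℚ)) V) = cl V := by
  have hid : ∀ (a : Equiv.Perm (Fin 0)) (b : Equiv.Perm (Fin n)), youngEmb h (a, b) = b :=
    youngEmb_zero h
  let I := FDRep.of (Representation.trivial ℚ (Equiv.Perm (Fin 0)) ℚ)
  obtain ⟨f, hf⟩ := exists_indProd_lift h (V := I) (W := V) (T := V)
    (LinearMap.lsmul ℚ V) (fun a b v w => by
      rw [hid]
      exact (map_smul (V.ρ b) v w).symm)
  let g : V ⟶ indProd h I V := repHom (indι h I V (1 : ℚ)) fun b v => by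
    have := rho_indι h (V := I) (W := V) 1 b (1 : ℚ) v
    rw [hid] at this
    exact this.symm
  refine cl_eq_of_iso ⟨f, g, indProd_hom_ext h fun v w => ?_, rep_ext (LinearMap.ext fun w => ?_)⟩
  · rw [repLin_comp, hf]
    change indι h I V (1 : ℚ) ((v : ℚ) • w) = indι h I V v w
    rw [map_smul, ← LinearMap.smul_apply, ← map_smul]
    congr 2
    exact mul_one (v : ℚ)
  · rw [repLin_comp]
    refine (hf (1 : ℚ) w).trans ?_
    exact one_smul ℚ w

end IndProd


/-- The product of classes of representations, `[V] [W] = [Ind (V ⊗ W)]`. -/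
def repMulHom (p q : ℕ) : K0 (FDRep ℚ (Equiv.Perm (Fin p))) →+
    K0 (FDRep ℚ (Equiv.Perm (Fin q))) →+ RepRing :=
  K0.lift₂ (fun V W => repCl (indProd (rfl : p + q = p + q) V W))
    (fun X Y Z W e => by
      rw [repCl, repCl, repCl, ← map_add]
      exact congrArg (RepRing.of _) (cl_functor_biprod (indFunctorLeft rfl W) X Y Z e))
    (fun W X Y Z e => by
      rw [repCl, repCl, repCl, ← map_add]
      rw [cl_indProd_comm rfl (Nat.add_comm q p) W Z, cl_indProd_comm rfl (Nat.add_comm q p) W X,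
        cl_indProd_comm rfl (Nat.add_comm q p) W Y]
      exact congrArg (RepRing.of _) (cl_functor_biprod (indFunctorLeft (Nat.add_comm q p) W) X Y Z e))

/-- The product of `R`, extended biadditively from the classes of representations. -/
def RepRing.mulHom : RepRing →+ RepRing →+ RepRing :=
  RepRing.lift fun p => (RepRing.lift fun q => (repMulHom p q).flip).flip

instance : Mul RepRing := ⟨fun x y => RepRing.mulHom x y⟩

instance : One RepRing := ⟨repCl (FDRep.of (Representation.trivial ℚ (Equiv.Perm (Fin 0)) ℚ))⟩

theorem RepRing.one_def :
    (1 : RepRing) = repCl (FDRep.of (Representation.trivial ℚ (Equiv.Perm (Fin 0)) ℚ)) := rfl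

theorem RepRing.mul_def (x y : RepRing) : x * y = RepRing.mulHom x y := rfl

theorem repCl_mul_repCl {p q n : ℕ} (h : p + q = n) (V : FDRep ℚ (Equiv.Perm (Fin p)))
    (W : FDRep ℚ (Equiv.Perm (Fin q))) : repCl V * repCl W = repCl (indProd h V W) := by
  subst h
  rw [RepRing.mul_def, RepRing.mulHom, repCl, repCl]
  rw [RepRing.lift_of, AddMonoidHom.flip_apply, RepRing.lift_of, AddMonoidHom.flip_apply,
    repMulHom, K0.lift₂_cl]

theorem RepRing.induction {P : RepRing → Prop} (x : RepRing)
    (h0 : ∀ (n : ℕ) (V : FDRep ℚ (Equiv.Perm (Fin n))), P (repCl V))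
    (hadd : ∀ x y, P x → P y → P (x + y)) (hneg : ∀ x, P x → P (-x)) : P x := by
  induction x using DirectSum.induction_on with
  | zero =>
    have := hadd _ _ (h0 0 (FDRep.of (Representation.trivial ℚ _ ℚ)))
      (hneg _ (h0 0 (FDRep.of (Representation.trivial ℚ _ ℚ))))
    rwa [add_neg_cancel] at this
  | of n x =>
    refine K0.induction (p := fun x => P (RepRing.of n x)) x (h0 n)
      (fun x y hx hy => ?_) (fun x hx => ?_)
    · rw [map_add]; exact hadd _ _ hx hy
    · rw [map_neg]; exact hneg _ hx
  | add x y hx hy => exact hadd _ _ hx hy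

theorem RepRing.add_mul' (x y z : RepRing) : (x + y) * z = x * z + y * z := by
  simp [RepRing.mul_def]

theorem RepRing.mul_add' (x y z : RepRing) : x * (y + z) = x * y + x * z := by
  simp [RepRing.mul_def]

theorem RepRing.neg_mul' (x y : RepRing) : -x * y = -(x * y) := by
  simp [RepRing.mul_def]

theorem RepRing.mul_neg' (x y : RepRing) : x * -y = -(x * y) := by
  simp [RepRing.mul_def]

theorem RepRing.mul_comm' (x y : RepRing) : x * y = y * x := by
  induction x using RepRing.induction with
  | hadd a b ha hb => simp only [RepRing.add_mul', RepRing.mul_add', ha, hb]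
  | hneg a ha => simp only [RepRing.neg_mul', RepRing.mul_neg', ha]
  | h0 p V =>
    induction y using RepRing.induction with
    | hadd a b ha hb => simp only [RepRing.add_mul', RepRing.mul_add', ha, hb]
    | hneg a ha => simp only [RepRing.neg_mul', RepRing.mul_neg', ha]
    | h0 q W =>
      rw [repCl_mul_repCl rfl, repCl_mul_repCl (Nat.add_comm q p)]
      exact congrArg (RepRing.of _) (cl_indProd_comm _ _ V W)

theorem RepRing.mul_assoc' (x y z : RepRing) : x * y * z = x * (y * z) := by
  induction x using RepRing.induction with
  | hadd a b ha hb => simp only [RepRing.add_mul', ha, hb]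
  | hneg a ha => simp only [RepRing.neg_mul', ha]
  | h0 p U =>
    induction y using RepRing.induction with
    | hadd a b ha hb => simp only [RepRing.mul_add', RepRing.add_mul', ha, hb]
    | hneg a ha => simp only [RepRing.mul_neg', RepRing.neg_mul', ha]
    | h0 q V =>
      induction z using RepRing.induction with
      | hadd a b ha hb => simp only [RepRing.mul_add', ha, hb]
      | hneg a ha => simp only [RepRing.mul_neg', ha]
      | h0 r W =>
        rw [repCl_mul_repCl rfl, repCl_mul_repCl rfl, repCl_mul_repCl rfl,
          repCl_mul_repCl (Nat.add_assoc p q r).symm]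
        exact congrArg (RepRing.of _) (cl_indProd_assoc _ _ _ _ U V W)

theorem RepRing.one_mul' (x : RepRing) : 1 * x = x := by
  induction x using RepRing.induction with
  | hadd a b ha hb => rw [RepRing.mul_add', ha, hb]
  | hneg a ha => rw [RepRing.mul_neg', ha]
  | h0 n V =>
    rw [RepRing.one_def, repCl_mul_repCl (Nat.zero_add n)]
    exact congrArg (RepRing.of _) (cl_indProd_one _ V)

/-- The ring of representations of the symmetric groups. -/
instance : CommRing RepRing where
  __ := (inferInstance : AddCommGroup RepRing)
  mul_assoc := RepRing.mul_assoc'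
  one_mul := RepRing.one_mul'
  mul_one x := by rw [RepRing.mul_comm', RepRing.one_mul']
  left_distrib := RepRing.mul_add'
  right_distrib := RepRing.add_mul'
  zero_mul x := by simp [RepRing.mul_def]
  mul_zero x := by simp [RepRing.mul_def]
  mul_comm := RepRing.mul_comm'

end RepresentationRing

section Specht

variable {n : ℕ}

/-- The group algebra `ℚ Σ_n`. -/
abbrev PermAlg (n : ℕ) : Type := MonoidAlgebra ℚ (Equiv.Perm (Fin n))

/-- The row lengths of the Young diagram of a partition, in decreasing order. -/
def rowLengths (μ : n.Partition) : List ℕ := μ.parts.sort (· ≥ ·)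

theorem sum_rowLengths (μ : n.Partition) :
    ∑ i : Fin (rowLengths μ).length, (rowLengths μ).get i = n := by
  have h : (rowLengths μ).sum = n := by
    rw [← Multiset.sum_coe, rowLengths, Multiset.sort_eq, μ.parts_sum]
  conv_rhs => rw [← h]
  exact Fin.sum_univ_getElem (rowLengths μ)

/-- The tableau of shape `μ` whose boxes are numbered row by row: the box (row and column) that
carries a given number. -/
def tableau (μ : n.Partition) :
    Fin n ≃ Σ i : Fin (rowLengths μ).length, Fin ((rowLengths μ).get i) :=
  (finCongr (sum_rowLengths μ).symm).trans finSigmaFinEquiv.symm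

/-- The index of the row of the tableau that contains `x`. -/
def tableauRow (μ : n.Partition) (x : Fin n) : ℕ := (tableau μ x).1

/-- The index of the column of the tableau that contains `x`. -/
def tableauCol (μ : n.Partition) (x : Fin n) : ℕ := (tableau μ x).2

open Classical in
/-- The sum of the permutations that preserve the rows of the tableau. -/
def rowSymmetrizer (μ : n.Partition) : PermAlg n :=
  ∑ σ : Equiv.Perm (Fin n) with ∀ x, tableauRow μ (σ x) = tableauRow μ x,
    MonoidAlgebra.single σ (1 : ℚ)

open Classical in
/-- The signed sum of the permutations that preserve the columns of the tableau. -/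
def colAntisymmetrizer (μ : n.Partition) : PermAlg n :=
  ∑ σ : Equiv.Perm (Fin n) with ∀ x, tableauCol μ (σ x) = tableauCol μ x,
    MonoidAlgebra.single σ ((Equiv.Perm.sign σ : ℤ) : ℚ)

/-- The Young symmetrizer of a partition. -/
def youngSymmetrizer (μ : n.Partition) : PermAlg n := rowSymmetrizer μ * colAntisymmetrizer μ

/-- The left ideal of `ℚ Σ_n` generated by the Young symmetrizer. -/
def spechtIdeal (μ : n.Partition) : Ideal (PermAlg n) := Ideal.span {youngSymmetrizer μ}

/-- The action of `Σ_n` on a left ideal of `ℚ Σ_n` by multiplication. -/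
def idealRep (I : Ideal (PermAlg n)) : Representation ℚ (Equiv.Perm (Fin n)) I where
  toFun g :=
    { toFun := fun x => ⟨MonoidAlgebra.single g 1 * (x : PermAlg n), I.mul_mem_left _ x.2⟩
      map_add' := fun x y => Subtype.ext (mul_add _ _ _)
      map_smul' := fun s x => Subtype.ext (mul_smul_comm s _ _) }
  map_one' := LinearMap.ext fun x => Subtype.ext (one_mul (x : PermAlg n))
  map_mul' g g' := LinearMap.ext fun x => Subtype.ext (by
    change MonoidAlgebra.single (g * g') 1 * (x : PermAlg n) =
      MonoidAlgebra.single g 1 * (MonoidAlgebra.single g' 1 * (x : PermAlg n))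
    rw [← mul_assoc, MonoidAlgebra.single_mul_single, one_mul])

instance (I : Ideal (PermAlg n)) : Module.Finite ℚ I :=
  inferInstanceAs (Module.Finite ℚ (I.restrictScalars ℚ))

/-- The irreducible representation `V_μ` of `Σ_n` over `ℚ` that belongs to a partition `μ` of `n`
(`V_(n)` is the trivial representation). -/
def specht (μ : n.Partition) : FDRep ℚ (Equiv.Perm (Fin n)) := FDRep.of (idealRep (spechtIdeal μ))

theorem exists_schurIdempotent (μ : n.Partition) :
    ∃ e : PermAlg n, IsIdempotentElem e ∧ spechtIdeal μ = Ideal.span {e} :=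
  IsSemisimpleRing.ideal_eq_span_idempotent _

/-- An idempotent `e` of `ℚ Σ_n` with `V_μ = ℚ Σ_n e`. -/
def schurIdempotent (μ : n.Partition) : PermAlg n := (exists_schurIdempotent μ).choose

theorem schurIdempotent_mul_self (μ : n.Partition) :
    schurIdempotent μ * schurIdempotent μ = schurIdempotent μ :=
  (exists_schurIdempotent μ).choose_spec.1

theorem spechtIdeal_eq (μ : n.Partition) : spechtIdeal μ = Ideal.span {schurIdempotent μ} :=
  (exists_schurIdempotent μ).choose_spec.2

/-- The Littlewood–Richardson coefficient `c^π_{μ,η}`: the multiplicity of `V_π` in the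
representation of `Σ_n` induced from the representation `V_μ ⊗ V_η` of `Σ_p × Σ_q`. -/
def lrCoeff {p q n : ℕ} (h : p + q = n) (μ : p.Partition) (η : q.Partition) (π : n.Partition) : ℕ :=
  Module.finrank ℚ (specht π ⟶ indProd h (specht μ) (specht η))

end Specht

section SchurFunctor

variable {A : Type u} [Category.{v} A] [Preadditive A] [Linear ℚ A] [IsIdempotentComplete A]

/-- The action of the group algebra on an object with an action of `Σ_n`. -/
def permAlgAction {n : ℕ} {M : A} (ξ : Equiv.Perm (Fin n) →* End M) : PermAlg n →ₐ[ℚ] End M :=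
  MonoidAlgebra.lift ℚ (End M) (Equiv.Perm (Fin n)) ξ

theorem exists_schurImage {n : ℕ} {M : A} (ξ : Equiv.Perm (Fin n) →* End M) (μ : n.Partition) :
    ∃ (S : A) (i : S ⟶ M) (e : M ⟶ S),
      i ≫ e = 𝟙 S ∧ e ≫ i = permAlgAction ξ (schurIdempotent μ) :=
  IsIdempotentComplete.idempotents_split M (permAlgAction ξ (schurIdempotent μ)) (by
    have h := map_mul (permAlgAction ξ) (schurIdempotent μ) (schurIdempotent μ)
    rw [schurIdempotent_mul_self] at h
    exact h.symm)

/-- The image of the idempotent of a partition `μ` on an object with an action of `Σ_n`. -/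
def schurImage {n : ℕ} {M : A} (ξ : Equiv.Perm (Fin n) →* End M) (μ : n.Partition) : A :=
  (exists_schurImage ξ μ).choose

theorem schurImage_spec {n : ℕ} {M : A} (ξ : Equiv.Perm (Fin n) →* End M) (μ : n.Partition) :
    ∃ (i : schurImage ξ μ ⟶ M) (e : M ⟶ schurImage ξ μ),
      i ≫ e = 𝟙 _ ∧ e ≫ i = permAlgAction ξ (schurIdempotent μ) :=
  (exists_schurImage ξ μ).choose_spec

variable [MonoidalCategory A] [SymmetricCategory A]

/-- The Schur functor `S_μ` on objects. -/
def schurObj {n : ℕ} (μ : n.Partition) (X : A) : A := schurImage (tensorPowAction X n) μ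

end SchurFunctor

section LambdaSigma

/-- The multiplicative group `1 + t S[[t]]` of a commutative ring `S`. -/
def oneUnits (S : Type*) [CommRing S] : Subgroup (PowerSeries S)ˣ :=
  (Units.map (PowerSeries.constantCoeff (R := S)).toMonoidHom).ker

variable {A : Type u} [Category.{v} A] [Preadditive A] [Linear ℚ A] [HasFiniteBiproducts A]
  [IsIdempotentComplete A] [MonoidalCategory A] [MonoidalPreadditive A] [SymmetricCategory A]

/-- `λ_Σ(X) = ∑_μ [S_μ X] ⊗ [V_μ] t^{|μ|}`. -/
def lambdaSigma (X : A) : PowerSeries (K0 A ⊗[ℤ] RepRing) :=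
  PowerSeries.mk fun n => ∑ μ : n.Partition, cl (schurObj μ X) ⊗ₜ[ℤ] repCl (specht μ)

end LambdaSigma

end

end GLR

/-!
The Schur idempotents `e_μ` meet every simple module of `ℚΣ_n`: the ideals generated by the Young
symmetrizers are simple and pairwise non-isomorphic, and there are as many of them as conjugacy
classes. Since `ℚΣ_n` is moreover split, with `e_μ ℚΣ_n e_ν` equal to `ℚ` or `0`, the products
`e_μ ⊗ e_η` form such a system for `ℚ[Σ_p × Σ_q]`.

All three parts then rest on one computation in the group algebra. Let `e` be the image of
`e_μ ⊗ e_η` in `ℚΣ_n`, where `n = p + q`. The spaces `e ℚΣ_n e_π` and `e_π ℚΣ_n e` have dimension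
`c^π_{μη}`, and they are dual to each other under the coefficient at `1` of the product. Right
multiplication by dual bases of these spaces, for all `μ` and `η`, decomposes the restriction of
`ℚΣ_n e_π` to `Σ_p × Σ_q`, and this is a list of identities between elements of `ℚΣ_n`. Part 2 is
the same count for the induced representation `ℚΣ_n e`. For part 3, `(X ⊕ Y)^{⊗ n}` is generated
under `Σ_n` by the blocks `X^{⊗ p} ⊗ Y^{⊗ q}`; compressed to a block, an element of `ℚΣ_n` acts
through its coefficients on `Σ_p × Σ_q`, and between different blocks every element acts by zero.
Hence the identities of the dual bases turn into those of inclusions and projections of a direct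
sum.

For part 1, parts 2 and 3 give `λ_Σ(X ⊕ Y) = λ_Σ(X) λ_Σ(Y)`. The coefficient of `t` in `λ_Σ(X)` is
`cl(X) ⊗ cl(V_{(1)})`, so `cl(X)` is recovered from it by the dimension `R → ℤ`.
-/

namespace GLR

noncomputable section

section DualBasis

open Module

variable {ι R M N : Type*} [Finite ι] [DecidableEq ι] [CommRing R]
  [AddCommGroup M] [Module R M] [AddCommGroup N] [Module R N]
  (P : M →ₗ[R] N →ₗ[R] R) [P.IsPerfPair] (b : Basis ι R M)

/-- The basis of `N` dual to a basis of `M` under a perfect pairing of `M` and `N`. -/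
def perfPairDualBasis : Basis ι R N :=
  b.dualBasis.map P.flip.toPerfPair.symm

theorem apply_perfPairDualBasis (x : M) (i : ι) :
    P x (perfPairDualBasis P b i) = b.repr x i := by
  rw [perfPairDualBasis, Basis.map_apply, LinearMap.apply_toPerfPair_flip, Basis.dualBasis_apply]

theorem sum_apply_smul_perfPairDualBasis [Fintype ι] (y : N) :
    ∑ i, P (b i) y • perfPairDualBasis P b i = y := by
  conv_rhs => rw [← (perfPairDualBasis P b).sum_repr y]
  simp [perfPairDualBasis]

end DualBasis

section CompleteSystem

variable (k : Type*) {B C I : Type*} [CommRing k] [Ring B] [Algebra k B] [Ring C] [Algebra k C]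

/-- The Peirce component `e B f` of an algebra `B`, for idempotents `e` and `f`. -/
def corner (e f : B) : Submodule k B where
  carrier := {x | e * x = x ∧ x * f = x}
  add_mem' := fun ⟨h₁, h₂⟩ ⟨h₃, h₄⟩ => ⟨by rw [mul_add, h₁, h₃], by rw [add_mul, h₂, h₄]⟩
  zero_mem' := ⟨mul_zero _, zero_mul _⟩
  smul_mem' c x := fun ⟨h₁, h₂⟩ => ⟨by rw [mul_smul_comm, h₁], by rw [smul_mul_assoc, h₂]⟩

/-- A system of idempotents of `B` with one primitive idempotent for each simple module, for an
algebra `B` that is a product of matrix algebras over `k`. The condition `full` says that the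
two-sided ideal generated by the system is all of `B`. -/
structure IsCompleteSystem (f : I → B) : Prop where
  ne_zero : ∀ i, f i ≠ 0
  idem : ∀ i, f i * f i = f i
  scalar : ∀ i x, ∃ c : k, f i * x * f i = c • f i
  orth : ∀ i j x, i ≠ j → f i * x * f j = 0
  full : (1 : B) ∈ Submodule.span k {z | ∃ i x y, z = x * f i * y}

variable {k}

theorem mul_mul_mem_corner {e f : B} (he : e * e = e) (hf : f * f = f) (x : B) :
    e * x * f ∈ corner k e f :=
  ⟨by rw [← mul_assoc, ← mul_assoc, he], by rw [mul_assoc, hf]⟩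

namespace IsCompleteSystem

variable {f : I → B} (hf : IsCompleteSystem k f)

include hf

theorem exists_eq_smul {i : I} {x : B} (hx : x ∈ corner k (f i) (f i)) :
    ∃ c : k, x = c • f i := by
  obtain ⟨c, hc⟩ := hf.scalar i x
  exact ⟨c, by rw [← hc, hx.1, hx.2]⟩

theorem eq_zero_of_mem_corner {i j : I} (hij : i ≠ j) {x : B} (hx : x ∈ corner k (f i) (f j)) :
    x = 0 := by
  rw [← hx.2, ← hx.1, hf.orth i j x hij]

theorem eq_self_of_commute_mul_left (φ : B →ₐ[k] C) (T : C →ₗ[k] C)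
    (hT : ∀ y x, T (φ y * x) = φ y * T x) {x : C}
    (hx : ∀ i y, T (φ (f i * y) * x) = φ (f i * y) * x) : T x = x := by
  suffices ∀ z ∈ Submodule.span k {z | ∃ i x y, z = x * f i * y}, T (φ z * x) = φ z * x by
    simpa using this 1 hf.full
  intro z hz
  induction hz using Submodule.span_induction with
  | mem z hz =>
    obtain ⟨i, a, y, rfl⟩ := hz
    rw [mul_assoc, map_mul φ, mul_assoc, hT, hx]
  | zero => simp
  | add a b _ _ ha hb => simp only [map_add, add_mul, ha, hb]
  | smul c a _ ha => simp only [map_smul, smul_mul_assoc, ha]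

end IsCompleteSystem

end CompleteSystem

section UnitCoeff

variable {k G : Type*} [CommRing k] [Group G]

/-- The linear form on a group algebra that takes the coefficient at the unit of the group. -/
def unitCoeff : MonoidAlgebra k G →ₗ[k] k where
  toFun x := x.coeff 1
  map_add' _ _ := rfl
  map_smul' _ _ := rfl

theorem unitCoeff_single (g : G) (r : k) [Decidable (g = 1)] :
    unitCoeff (MonoidAlgebra.single g r) = if g = 1 then r else 0 := by
  classical
  exact (Finsupp.single_apply (a := g) (a' := 1) (b := r)).trans (by congr)

theorem unitCoeff_mul_single_inv (x : MonoidAlgebra k G) (g : G) :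
    unitCoeff (x * MonoidAlgebra.single g⁻¹ 1) = x.coeff g := by
  change (x * MonoidAlgebra.single g⁻¹ 1).coeff 1 = _
  rw [MonoidAlgebra.coeff_mul_single_apply]
  simp

theorem unitCoeff_mul_comm (x y : MonoidAlgebra k G) : unitCoeff (x * y) = unitCoeff (y * x) := by
  classical
  induction x using MonoidAlgebra.induction_linear with
  | zero => simp
  | add a b ha hb => simp [add_mul, mul_add, ha, hb]
  | single g r =>
    induction y using MonoidAlgebra.induction_linear with
    | zero => simp
    | add a b ha hb => simp [add_mul, mul_add, ha, hb]
    | single h s =>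
      rw [MonoidAlgebra.single_mul_single, MonoidAlgebra.single_mul_single, unitCoeff_single,
        unitCoeff_single, mul_comm r s]
      simp only [mul_eq_one_iff_eq_inv, eq_comm (a := g), inv_eq_iff_eq_inv]

theorem eq_zero_of_unitCoeff_mul (x : MonoidAlgebra k G) (h : ∀ y, unitCoeff (x * y) = 0) :
    x = 0 := by
  ext g
  rw [← unitCoeff_mul_single_inv, h]
  rfl

/-- The pairing of `e k[G] f` and `f k[G] e` given by the coefficient of the product at the unit of
the group. -/
def cornerPairing (e f : MonoidAlgebra k G) : corner k e f →ₗ[k] corner k f e →ₗ[k] k :=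
  ((LinearMap.mul k (MonoidAlgebra k G)).compr₂ unitCoeff).compl₁₂
    (corner k e f).subtype (corner k f e).subtype

theorem cornerPairing_apply (e f : MonoidAlgebra k G) (x : corner k e f) (y : corner k f e) :
    cornerPairing e f x y = unitCoeff ((x : MonoidAlgebra k G) * (y : MonoidAlgebra k G)) := rfl

theorem flip_cornerPairing (e f : MonoidAlgebra k G) :
    (cornerPairing e f).flip = cornerPairing f e :=
  LinearMap.ext₂ fun _ _ => unitCoeff_mul_comm _ _

theorem cornerPairing_injective {e f : MonoidAlgebra k G} (he : e * e = e) (hf : f * f = f) :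
    Function.Injective (cornerPairing e f) := by
  refine (injective_iff_map_eq_zero _).2 fun x hx =>
    Subtype.ext (eq_zero_of_unitCoeff_mul _ fun y => ?_)
  have h := LinearMap.congr_fun hx ⟨f * y * e, mul_mul_mem_corner hf he y⟩
  rw [cornerPairing_apply, LinearMap.zero_apply] at h
  rw [← x.2.1, mul_assoc, unitCoeff_mul_comm, ← x.2.2]
  simpa only [mul_assoc] using h

end UnitCoeff

section Restriction

variable {k G H I : Type*} [CommRing k] [Group G] [Group H]

/-- The homomorphism of group algebras given by a homomorphism of groups. -/
abbrev algMap (j : H →* G) :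
    MonoidAlgebra k H →ₐ[k] MonoidAlgebra k G :=
  MonoidAlgebra.mapDomainAlgHom k k j

theorem algMap_single (j : H →* G) (h : H) (r : k) :
    algMap j (MonoidAlgebra.single h r) = MonoidAlgebra.single (j h) r :=
  MonoidAlgebra.mapDomain_single

theorem algMap_id (x : MonoidAlgebra k G) : algMap (MonoidHom.id G) x = x :=
  DFunLike.congr_fun (MonoidAlgebra.mapDomainAlgHom_id ..) x

variable (j : H →* G) (hj : Function.Injective j)

/-- The part of an element of a group algebra that is supported on a subgroup. -/
def restrictCoeff : MonoidAlgebra k G →ₗ[k] MonoidAlgebra k H where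
  toFun := MonoidAlgebra.comapDomain j hj
  map_add' := MonoidAlgebra.comapDomain_add j hj
  map_smul' c x := by ext; simp [MonoidAlgebra.coeff_comapDomain]

theorem restrictCoeff_coeff (x : MonoidAlgebra k G) (h : H) :
    (restrictCoeff j hj x).coeff h = x.coeff (j h) := rfl

theorem restrictCoeff_id (x : MonoidAlgebra k G) :
    restrictCoeff (MonoidHom.id G) Function.injective_id x = x := by
  ext g; rfl

theorem restrictCoeff_single (h : H) (r : k) :
    restrictCoeff j hj (MonoidAlgebra.single (j h) r) = MonoidAlgebra.single h r :=
  MonoidAlgebra.comapDomain_single_map j hj h r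

theorem restrictCoeff_single_of_notMem {g : G} (hg : g ∉ Set.range j) (r : k) :
    restrictCoeff j hj (MonoidAlgebra.single g r) = 0 :=
  MonoidAlgebra.comapDomain_single_of_not_mem_range hg hj

theorem unitCoeff_restrictCoeff (x : MonoidAlgebra k G) :
    unitCoeff (restrictCoeff j hj x) = unitCoeff x :=
  (restrictCoeff_coeff j hj x 1).trans (by rw [map_one]; rfl)

theorem restrictCoeff_algMap_mul (y : MonoidAlgebra k H) (x : MonoidAlgebra k G) :
    restrictCoeff j hj (algMap j y * x) = y * restrictCoeff j hj x := by
  induction y using MonoidAlgebra.induction_linear with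
  | zero => simp
  | add a b ha hb => simp only [map_add, add_mul, ha, hb]
  | single h r =>
    ext g
    rw [algMap_single, restrictCoeff_coeff, MonoidAlgebra.coeff_single_mul_apply,
      MonoidAlgebra.coeff_single_mul_apply, restrictCoeff_coeff, map_mul j, map_inv j]

theorem restrictCoeff_mul_algMap (x : MonoidAlgebra k G) (y : MonoidAlgebra k H) :
    restrictCoeff j hj (x * algMap j y) = restrictCoeff j hj x * y := by
  induction y using MonoidAlgebra.induction_linear with
  | zero => simp
  | add a b ha hb => simp only [map_add, mul_add, ha, hb]
  | single h r =>
    ext g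
    rw [algMap_single, restrictCoeff_coeff, MonoidAlgebra.coeff_mul_single_apply,
      MonoidAlgebra.coeff_mul_single_apply, restrictCoeff_coeff, map_mul j, map_inv j]

theorem restrictCoeff_mul_mem_corner {a b : MonoidAlgebra k H} {e x y : MonoidAlgebra k G}
    (hx : x ∈ corner k (algMap j a) e) (hy : y ∈ corner k e (algMap j b)) :
    restrictCoeff j hj (x * y) ∈ corner k a b :=
  ⟨by rw [← restrictCoeff_algMap_mul, ← mul_assoc, hx.1],
    by rw [← restrictCoeff_mul_algMap, mul_assoc, hy.2]⟩

/-- Elements of `k[G]` that decompose the restriction of `k[G] e` to the subgroup `H` into modules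
`k[H] (f i)`, with a copy of `k[H] (f i)` for each element of `κ i`: the inclusion of the summand
with index `s` is right multiplication by `v s`, and the projection is right multiplication by `w s`
followed by `restrictCoeff`. -/
structure IsRestrictionFamily {κ : I → Type*} [Fintype (Σ i, κ i)] (f : I → MonoidAlgebra k H)
    (e : MonoidAlgebra k G) (v w : (Σ i, κ i) → MonoidAlgebra k G) : Prop where
  left_mem : ∀ s, v s ∈ corner k (algMap j (f s.1)) e
  right_mem : ∀ s, w s ∈ corner k e (algMap j (f s.1))
  restrict_mul_self : ∀ s, restrictCoeff j hj (v s * w s) = f s.1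
  restrict_mul_of_ne : ∀ s t, s ≠ t → restrictCoeff j hj (v s * w t) = 0
  sum_mul : ∀ x, x * e = x → ∑ s, algMap j (restrictCoeff j hj (x * w s)) * v s = x

end Restriction

section RestrictionFamily

variable {k G H I : Type*} [Field k] [Group G] [Group H]
  (j : H →* G) (hj : Function.Injective j)

theorem isPerfPair_cornerPairing [Finite G] {e f : MonoidAlgebra k G} (he : e * e = e)
    (hf : f * f = f) : (cornerPairing e f).IsPerfPair :=
  .of_injective (cornerPairing_injective he hf)
    (flip_cornerPairing e f ▸ cornerPairing_injective hf he)

theorem finrank_corner_comm [Finite G] {e f : MonoidAlgebra k G} (he : e * e = e)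
    (hf : f * f = f) : Module.finrank k (corner k e f) = Module.finrank k (corner k f e) :=
  have := isPerfPair_cornerPairing he hf
  Module.finrank_of_isPerfPair (cornerPairing e f)

theorem IsCompleteSystem.unitCoeff_ne_zero {f : I → MonoidAlgebra k G}
    (hf : IsCompleteSystem k f) (i : I) : unitCoeff (f i) ≠ 0 := by
  intro h0
  refine hf.ne_zero i (eq_zero_of_unitCoeff_mul _ fun y => ?_)
  obtain ⟨c, hc⟩ := hf.scalar i y
  rw [← hf.idem i, mul_assoc, unitCoeff_mul_comm, hc, map_smul, h0, smul_zero]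

namespace IsCompleteSystem

variable {f : I → MonoidAlgebra k H} (hf : IsCompleteSystem k f)

include hf

theorem restrictCoeff_mul_eq_smul {i : I} {e x y : MonoidAlgebra k G}
    (hx : x ∈ corner k (algMap j (f i)) e) (hy : y ∈ corner k e (algMap j (f i))) :
    restrictCoeff j hj (x * y) = (unitCoeff (y * x) / unitCoeff (f i)) • f i := by
  obtain ⟨c, hc⟩ := hf.exists_eq_smul (restrictCoeff_mul_mem_corner j hj hx hy)
  have h := congrArg unitCoeff hc
  rw [unitCoeff_restrictCoeff, map_smul, smul_eq_mul, unitCoeff_mul_comm] at h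
  rw [hc, h, mul_div_cancel_right₀ _ (hf.unitCoeff_ne_zero i)]

theorem restrictCoeff_mul_eq_zero {i i' : I} (hi : i ≠ i') {e x y : MonoidAlgebra k G}
    (hx : x ∈ corner k (algMap j (f i)) e) (hy : y ∈ corner k e (algMap j (f i'))) :
    restrictCoeff j hj (x * y) = 0 :=
  hf.eq_zero_of_mem_corner hi (restrictCoeff_mul_mem_corner j hj hx hy)

end IsCompleteSystem

section DualFamily

variable {κ : I → Type*} [∀ i, Finite (κ i)] [∀ i, DecidableEq (κ i)] (f : I → MonoidAlgebra k H)
  {e : MonoidAlgebra k G} [∀ i, (cornerPairing e (algMap j (f i))).IsPerfPair]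
  (b : ∀ i, Module.Basis (κ i) k (corner k e (algMap j (f i))))

/-- The bases of the spaces `(f i) k[G] e` that are dual to bases `b i` of the spaces
`e k[G] (f i)`, scaled by `unitCoeff (f i)` in order to make `restrictCoeff (dualFamily s * b s)`
equal to `f i` itself. -/
def dualFamily (s : Σ i, κ i) : MonoidAlgebra k G :=
  unitCoeff (f s.1) •
    (perfPairDualBasis (cornerPairing e (algMap j (f s.1))) (b s.1) s.2 : MonoidAlgebra k G)

theorem dualFamily_mem_corner (s : Σ i, κ i) :
    dualFamily j f b s ∈ corner k (algMap j (f s.1)) e :=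
  (corner k _ _).smul_mem _ (Subtype.property _)

theorem unitCoeff_mul_dualFamily (i : I) (a a' : κ i) :
    unitCoeff ((b i a : MonoidAlgebra k G) * dualFamily j f b ⟨i, a'⟩) =
      if a = a' then unitCoeff (f i) else 0 := by
  rw [dualFamily, mul_smul_comm, map_smul, ← cornerPairing_apply, apply_perfPairDualBasis,
    Module.Basis.repr_self, Finsupp.single_apply, smul_eq_mul, mul_ite, mul_one, mul_zero]

theorem sum_unitCoeff_smul_dualFamily [∀ i, Fintype (κ i)] {i : I} {x : MonoidAlgebra k G}
    (hx : x ∈ corner k (algMap j (f i)) e) :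
    ∑ a, unitCoeff ((b i a : MonoidAlgebra k G) * x) • dualFamily j f b ⟨i, a⟩ =
      unitCoeff (f i) • x := by
  have h := sum_apply_smul_perfPairDualBasis (cornerPairing e (algMap j (f i))) (b i) ⟨x, hx⟩
  conv_rhs => rw [show x = _ from (congrArg Subtype.val h).symm, AddSubmonoidClass.coe_finsetSum,
    Finset.smul_sum]
  refine Finset.sum_congr rfl fun a _ => ?_
  rw [dualFamily, smul_comm, Submodule.coe_smul, cornerPairing_apply]

variable {f} (hf : IsCompleteSystem k f)

include hf

theorem restrictCoeff_dualFamily_mul_self (s : Σ i, κ i) :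
    restrictCoeff j hj (dualFamily j f b s * (b s.1 s.2 : MonoidAlgebra k G)) = f s.1 := by
  rw [hf.restrictCoeff_mul_eq_smul j hj (dualFamily_mem_corner j f b s) (b s.1 s.2).2,
    unitCoeff_mul_dualFamily, if_pos rfl, div_self (hf.unitCoeff_ne_zero _), one_smul]

theorem restrictCoeff_dualFamily_mul_of_ne {s t : Σ i, κ i} (hst : s ≠ t) :
    restrictCoeff j hj (dualFamily j f b s * (b t.1 t.2 : MonoidAlgebra k G)) = 0 := by
  obtain ⟨i, a⟩ := s
  obtain ⟨i', a'⟩ := t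
  obtain rfl | hi := eq_or_ne i i'
  · rw [hf.restrictCoeff_mul_eq_smul j hj (dualFamily_mem_corner j f b ⟨i, a⟩) (b i a').2,
      unitCoeff_mul_dualFamily, if_neg (by rintro rfl; exact hst rfl), zero_div, zero_smul]
  · exact hf.restrictCoeff_mul_eq_zero j hj hi (dualFamily_mem_corner j f b ⟨i, a⟩) (b i' a').2

variable [Fintype I] [∀ i, Fintype (κ i)]

theorem sum_restrictCoeff_mul_dualFamily_of_mem_corner {i : I} {x : MonoidAlgebra k G}
    (hx : x ∈ corner k (algMap j (f i)) e) :
    ∑ s : Σ i, κ i, algMap j (restrictCoeff j hj (x * (b s.1 s.2 : MonoidAlgebra k G))) *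
      dualFamily j f b s = x := by
  rw [Fintype.sum_sigma, Finset.sum_eq_single i _ fun h => absurd (Finset.mem_univ i) h]
  · refine Eq.trans ?_ ((inv_smul_eq_iff₀ (hf.unitCoeff_ne_zero i)).2
      (sum_unitCoeff_smul_dualFamily j f b hx))
    rw [Finset.smul_sum]
    refine Finset.sum_congr rfl fun a _ => ?_
    rw [hf.restrictCoeff_mul_eq_smul j hj hx (b i a).2, map_smul, smul_mul_assoc,
      (dualFamily_mem_corner j f b ⟨i, a⟩).1, smul_smul, div_eq_inv_mul]
  · refine fun i' _ hi => Finset.sum_eq_zero fun a _ => ?_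
    rw [hf.restrictCoeff_mul_eq_zero j hj hi.symm hx (b i' a).2, map_zero, zero_mul]

theorem sum_restrictCoeff_mul_dualFamily {x : MonoidAlgebra k G} (hx : x * e = x) :
    ∑ s : Σ i, κ i, algMap j (restrictCoeff j hj (x * (b s.1 s.2 : MonoidAlgebra k G))) *
      dualFamily j f b s = x := by
  let T : MonoidAlgebra k G →ₗ[k] MonoidAlgebra k G :=
    ∑ s : Σ i, κ i, LinearMap.mulRight k (dualFamily j f b s) ∘ₗ (algMap j).toLinearMap ∘ₗ
      restrictCoeff j hj ∘ₗ LinearMap.mulRight k (b s.1 s.2 : MonoidAlgebra k G)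
  have T_apply x : T x = ∑ s : Σ i, κ i,
      algMap j (restrictCoeff j hj (x * (b s.1 s.2 : MonoidAlgebra k G))) *
        dualFamily j f b s := by
    simp [T]
  rw [← T_apply]
  refine hf.eq_self_of_commute_mul_left (algMap j) T (fun y x => ?_) fun i y => ?_
  · simp only [T_apply, Finset.mul_sum, mul_assoc, restrictCoeff_algMap_mul, map_mul]
  · rw [T_apply]
    refine sum_restrictCoeff_mul_dualFamily_of_mem_corner j hj b hf (i := i) ⟨?_, ?_⟩
    · rw [← mul_assoc, ← map_mul, ← mul_assoc, hf.idem]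
    · rw [mul_assoc, hx]

omit [∀ i, DecidableEq (κ i)] [∀ i, (cornerPairing e (algMap j (f i))).IsPerfPair] in
theorem IsCompleteSystem.exists_isRestrictionFamily [Finite G] (he : e * e = e) :
    ∃ v, IsRestrictionFamily j hj f e v fun s => (b s.1 s.2 : MonoidAlgebra k G) := by
  classical
  have (i : I) : (cornerPairing e (algMap j (f i))).IsPerfPair :=
    isPerfPair_cornerPairing he (by rw [← map_mul, hf.idem])
  exact ⟨dualFamily j f b, dualFamily_mem_corner j f b, fun s => (b s.1 s.2).2,
    restrictCoeff_dualFamily_mul_self j hj b hf,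
    fun _ _ => restrictCoeff_dualFamily_mul_of_ne j hj b hf,
    fun _ => sum_restrictCoeff_mul_dualFamily j hj b hf⟩

end DualFamily

theorem IsCompleteSystem.exists_decomposition [Finite G] [Fintype I] {κ : I → Type*}
    [∀ i, Fintype (κ i)] {f : I → MonoidAlgebra k G} (hf : IsCompleteSystem k f)
    {e : MonoidAlgebra k G} (he : e * e = e)
    (b : ∀ i, Module.Basis (κ i) k (corner k e (f i))) :
    ∃ v : (Σ i, κ i) → MonoidAlgebra k G,
      (∀ s, v s ∈ corner k (f s.1) e) ∧ (∀ s, v s * (b s.1 s.2 : MonoidAlgebra k G) = f s.1) ∧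
      (∀ s t, s ≠ t → v s * (b t.1 t.2 : MonoidAlgebra k G) = 0) ∧
      ∑ s, (b s.1 s.2 : MonoidAlgebra k G) * v s = e := by
  obtain ⟨v, hv⟩ := hf.exists_isRestrictionFamily (MonoidHom.id G) Function.injective_id
    (fun i => (b i).map (LinearEquiv.ofEq _ _ (by rw [algMap_id]))) he
  refine ⟨v, fun s => ?_, fun s => ?_, fun s t hst => ?_, ?_⟩
  · simpa only [algMap_id] using hv.left_mem s
  · simpa [restrictCoeff_id] using hv.restrict_mul_self s
  · simpa [restrictCoeff_id] using hv.restrict_mul_of_ne s t hst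
  · simpa [algMap_id, restrictCoeff_id, ← mul_assoc, (b _ _).2.1] using hv.sum_mul e he

end RestrictionFamily

section Outer

variable {k G H : Type*} [CommRing k] [Group G] [Group H]

/-- The element `x ⊗ y` of the group algebra of a product of groups. -/
def outer : MonoidAlgebra k G →ₗ[k] MonoidAlgebra k H →ₗ[k] MonoidAlgebra k (G × H) :=
  (LinearMap.mul k (MonoidAlgebra k (G × H))).compl₁₂ (algMap (MonoidHom.inl G H)).toLinearMap
    (algMap (MonoidHom.inr G H)).toLinearMap

theorem outer_apply (x : MonoidAlgebra k G) (y : MonoidAlgebra k H) :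
    outer x y = algMap (MonoidHom.inl G H) x * algMap (MonoidHom.inr G H) y := rfl

theorem outer_single (g : G) (h : H) (r s : k) :
    outer (MonoidAlgebra.single g r) (MonoidAlgebra.single h s) =
      MonoidAlgebra.single (g, h) (r * s) := by
  rw [outer_apply, algMap_single, algMap_single, MonoidAlgebra.single_mul_single]
  simp

theorem commute_algMap_inl_algMap_inr (x : MonoidAlgebra k G) (y : MonoidAlgebra k H) :
    Commute (algMap (MonoidHom.inl G H) x) (algMap (MonoidHom.inr G H) y) := by
  induction x using MonoidAlgebra.induction_linear with
  | zero => rw [map_zero]; exact Commute.zero_left _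
  | add a b ha hb => rw [map_add]; exact ha.add_left hb
  | single g r =>
    induction y using MonoidAlgebra.induction_linear with
    | zero => rw [map_zero]; exact Commute.zero_right _
    | add a b ha hb => rw [map_add]; exact ha.add_right hb
    | single h s =>
      rw [algMap_single, algMap_single]
      exact MonoidAlgebra.single_commute_single (MonoidHom.commute_inl_inr g h) (mul_comm r s)

theorem outer_mul_outer (x x' : MonoidAlgebra k G) (y y' : MonoidAlgebra k H) :
    outer x y * outer x' y' = outer (x * x') (y * y') := by
  simp only [outer_apply, map_mul]
  exact (commute_algMap_inl_algMap_inr x' y).symm.mul_mul_mul_comm _ _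

theorem one_outer_one : outer (1 : MonoidAlgebra k G) (1 : MonoidAlgebra k H) = 1 := by
  rw [MonoidAlgebra.one_def, MonoidAlgebra.one_def, outer_single, mul_one]
  rfl

theorem coeff_outer (x : MonoidAlgebra k G) (y : MonoidAlgebra k H) (g : G) (h : H) :
    (outer x y).coeff (g, h) = x.coeff g * y.coeff h := by
  classical
  induction x using MonoidAlgebra.induction_linear with
  | zero => simp
  | add a b ha hb => simp [add_mul, ha, hb]
  | single g' r =>
    induction y using MonoidAlgebra.induction_linear with
    | zero => simp
    | add a b ha hb => simp [mul_add, ha, hb]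
    | single h' s =>
      rw [outer_single]
      by_cases hg : g' = g <;> by_cases hh : h' = h <;> simp [hg, hh]

theorem outer_ne_zero [NoZeroDivisors k] {x : MonoidAlgebra k G} {y : MonoidAlgebra k H}
    (hx : x ≠ 0) (hy : y ≠ 0) : outer x y ≠ 0 := by
  contrapose! hx
  obtain ⟨h, hh⟩ : ∃ h, y.coeff h ≠ 0 := by
    contrapose! hy
    ext h
    exact hy h
  ext g
  refine (mul_eq_zero.1 ?_).resolve_right hh
  rw [← coeff_outer, hx]
  rfl

theorem map₂_outer_top :
    Submodule.map₂ (outer (k := k) (G := G) (H := H)) ⊤ ⊤ = ⊤ := by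
  refine eq_top_iff.2 fun z _ => ?_
  induction z using MonoidAlgebra.induction_linear with
  | zero => exact zero_mem _
  | add a b ha hb => exact add_mem (ha trivial) (hb trivial)
  | single g r =>
    rw [← one_mul r, ← Prod.mk.eta (p := g), ← outer_single]
    exact Submodule.apply_mem_map₂ _ trivial trivial

theorem IsCompleteSystem.prod [NoZeroDivisors k] {I J : Type*} {f : I → MonoidAlgebra k G}
    {f' : J → MonoidAlgebra k H} (hf : IsCompleteSystem k f) (hf' : IsCompleteSystem k f') :
    IsCompleteSystem k fun i : I × J => outer (f i.1) (f' i.2) where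
  ne_zero i := outer_ne_zero (hf.ne_zero i.1) (hf'.ne_zero i.2)
  idem i := by rw [outer_mul_outer, hf.idem, hf'.idem]
  scalar i z := by
    let e := outer (f i.1) (f' i.2)
    suffices ⊤ ≤ (Submodule.span k {e}).comap (LinearMap.mulLeftRight k (e, e)) by
      simpa [Submodule.mem_span_singleton, eq_comm, e] using this (Submodule.mem_top (x := z))
    rw [← map₂_outer_top, Submodule.map₂_le]
    intro x _ y _
    obtain ⟨c, hc⟩ := hf.scalar i.1 x
    obtain ⟨d, hd⟩ := hf'.scalar i.2 y
    refine Submodule.mem_span_singleton.2 ⟨c * d, ?_⟩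
    simp [e, outer_mul_outer, hc, hd, mul_smul, smul_comm c]
  orth i i' z hi := by
    suffices ⊤ ≤ LinearMap.ker (LinearMap.mulLeftRight k
        (outer (f i.1) (f' i.2), outer (f i'.1) (f' i'.2))) by
      simpa using this (Submodule.mem_top (x := z))
    rw [← map₂_outer_top, Submodule.map₂_le]
    intro x _ y _
    rw [LinearMap.mem_ker, LinearMap.mulLeftRight_apply, outer_mul_outer, outer_mul_outer]
    by_cases h : i.1 = i'.1
    · rw [hf'.orth _ _ _ fun h' => hi (Prod.ext h h'), map_zero]
    · rw [hf.orth _ _ _ h, LinearMap.map_zero₂]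
  full := by
    rw [← one_outer_one]
    have h := Submodule.apply_mem_map₂ outer hf.full hf'.full
    rw [Submodule.map₂_span_span] at h
    refine Submodule.span_mono ?_ h
    rintro _ ⟨_, ⟨i, x, y, rfl⟩, _, ⟨i', x', y', rfl⟩, rfl⟩
    exact ⟨(i, i'), outer x x', outer y y', by rw [outer_mul_outer, outer_mul_outer]⟩

end Outer

section ColumnCounting

/- `r` and `r'` are the rows of the letters in two fillings of Young diagrams and `c` is the column
in the second filling. The hypotheses say that letters in one row of the first filling lie in
different columns of the second, and that the columns of the second have no gaps. -/

variable {α γ : Type*} [Fintype α] {r r' : α → ℕ} {c : α → γ}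

theorem card_row_lt_col_le [DecidableEq γ] (hinj : ∀ x y, r x = r y → c x = c y → x = y)
    (hdown : ∀ y, ∀ k < r' y, ∃ z, r' z = k ∧ c z = c y) (k : ℕ) (m : γ) :
    (Finset.univ.filter fun x => r x < k ∧ c x = m).card ≤
      (Finset.univ.filter fun x => r' x < k ∧ c x = m).card := by
  by_cases h : ∃ y, c y = m ∧ k ≤ r' y
  · obtain ⟨y, rfl, hk⟩ := h
    calc (Finset.univ.filter fun x => r x < k ∧ c x = c y).card
      _ ≤ (Finset.range k).card := by
        refine Finset.card_le_card_of_injOn r (fun x hx => ?_) fun x hx z hz hxz => ?_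
        · simpa using (Finset.mem_filter.1 hx).2.1
        · exact hinj x z hxz ((Finset.mem_filter.1 hx).2.2.trans (Finset.mem_filter.1 hz).2.2.symm)
      _ ≤ (Finset.univ.filter fun x => r' x < k ∧ c x = c y).card := by
        refine Finset.card_le_card_of_surjOn r' fun i hi => ?_
        have hik : i < k := by simpa using hi
        obtain ⟨z, hz, hz'⟩ := hdown y i (hik.trans_le hk)
        exact ⟨z, by simp [hz, hz', hik], hz⟩
  · push Not at h
    refine Finset.card_le_card fun x hx => ?_
    simp only [Finset.mem_filter, Finset.mem_univ, true_and] at hx ⊢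
    exact ⟨h x hx.2, hx.2⟩

theorem card_row_lt_eq_sum [DecidableEq γ] (r : α → ℕ) (c : α → γ) (k : ℕ) :
    (Finset.univ.filter fun x => r x < k).card =
      ∑ m ∈ Finset.univ.image c, (Finset.univ.filter fun x => r x < k ∧ c x = m).card := by
  rw [Finset.card_eq_sum_card_fiberwise (f := c) (t := Finset.univ.image c) fun x _ => by simp]
  simp only [Finset.filter_filter]

theorem card_row_lt_le (hinj : ∀ x y, r x = r y → c x = c y → x = y)
    (hdown : ∀ y, ∀ k < r' y, ∃ z, r' z = k ∧ c z = c y) (k : ℕ) :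
    (Finset.univ.filter fun x => r x < k).card ≤ (Finset.univ.filter fun x => r' x < k).card := by
  classical
  rw [card_row_lt_eq_sum r c, card_row_lt_eq_sum r' c]
  exact Finset.sum_le_sum fun m _ => card_row_lt_col_le hinj hdown k m

theorem card_row_lt_col_eq [DecidableEq γ] (hinj : ∀ x y, r x = r y → c x = c y → x = y)
    (hdown : ∀ y, ∀ k < r' y, ∃ z, r' z = k ∧ c z = c y) {k : ℕ}
    (heq : (Finset.univ.filter fun x => r x < k).card =
      (Finset.univ.filter fun x => r' x < k).card) (x : α) :
    (Finset.univ.filter fun y => r y < k ∧ c y = c x).card =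
      (Finset.univ.filter fun y => r' y < k ∧ c y = c x).card := by
  rw [card_row_lt_eq_sum r c, card_row_lt_eq_sum r' c] at heq
  exact (Finset.sum_eq_sum_iff_of_le fun m _ => card_row_lt_col_le hinj hdown k m).1 heq (c x)
    (by simp)

theorem exists_row_eq_col_eq (hinj : ∀ x y, r x = r y → c x = c y → x = y)
    (hdown : ∀ y, ∀ k < r' y, ∃ z, r' z = k ∧ c z = c y)
    (heq : ∀ k, (Finset.univ.filter fun x => r x < k).card =
      (Finset.univ.filter fun x => r' x < k).card) (x : α) :
    ∃ z, r' z = r x ∧ c z = c x := by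
  classical
  have hlt : (Finset.univ.filter fun y => r y < r x ∧ c y = c x).card <
      (Finset.univ.filter fun y => r y < r x + 1 ∧ c y = c x).card := by
    refine Finset.card_lt_card ⟨fun y hy => ?_, fun h => ?_⟩
    · simp only [Finset.mem_filter, Finset.mem_univ, true_and] at hy ⊢
      exact ⟨by omega, hy.2⟩
    · have := @h x (by simp)
      simp at this
  rw [card_row_lt_col_eq hinj hdown (heq _), card_row_lt_col_eq hinj hdown (heq _)] at hlt
  obtain ⟨z, hz, hz'⟩ := Finset.exists_mem_notMem_of_card_lt_card hlt
  simp only [Finset.mem_filter, Finset.mem_univ, true_and, not_and] at hz hz'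
  refine ⟨z, ?_, hz.2⟩
  by_contra h
  exact hz' (by omega) hz.2

end ColumnCounting

section Tableau

variable {n : ℕ} (μ : n.Partition)

theorem tableau_ext {x y : Fin n} (hr : tableauRow μ x = tableauRow μ y)
    (hc : tableauCol μ x = tableauCol μ y) : x = y := by
  refine (tableau μ).injective ?_
  unfold tableauRow tableauCol at *
  generalize tableau μ x = a at *
  generalize tableau μ y = b at *
  obtain ⟨a, a'⟩ := a
  obtain ⟨b, b'⟩ := b
  obtain rfl : a = b := Fin.ext hr
  obtain rfl : a' = b' := Fin.ext hc
  rfl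

theorem exists_tableauRow_eq_of_lt (y : Fin n) (k : ℕ) (hk : k < tableauRow μ y) :
    ∃ z, tableauRow μ z = k ∧ tableauCol μ z = tableauCol μ y := by
  have hk' : k < (rowLengths μ).length := hk.trans (tableau μ y).1.2
  have hs : (rowLengths μ).Pairwise (· ≥ ·) := Multiset.pairwise_sort _ _
  have hle : (rowLengths μ).get (tableau μ y).1 ≤ (rowLengths μ).get ⟨k, hk'⟩ :=
    List.pairwise_iff_get.1 hs ⟨k, hk'⟩ (tableau μ y).1 hk
  refine ⟨(tableau μ).symm ⟨⟨k, hk'⟩, ⟨(tableau μ y).2, (tableau μ y).2.2.trans_le hle⟩⟩, ?_, ?_⟩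
  · rw [tableauRow, Equiv.apply_symm_apply]
  · rw [tableauCol, Equiv.apply_symm_apply]
    rfl

theorem card_tableauRow_eq (k : ℕ) :
    (Finset.univ.filter fun x => tableauRow μ x = k).card = (rowLengths μ).getD k 0 := by
  by_cases hk : k < (rowLengths μ).length
  · rw [List.getD_eq_getElem _ _ hk]
    let f : Fin ((rowLengths μ).get ⟨k, hk⟩) → Fin n := fun j => (tableau μ).symm ⟨⟨k, hk⟩, j⟩
    have hf : Function.Injective f := fun i j hij => by
      have := (tableau μ).symm.injective hij
      simpa using this
    have h : (Finset.univ.filter fun x => tableauRow μ x = k) = Finset.univ.map ⟨f, hf⟩ := by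
      ext x
      simp only [Finset.mem_filter, Finset.mem_univ, true_and, Finset.mem_map,
        Function.Embedding.coeFn_mk, f, Equiv.symm_apply_eq]
      constructor
      · intro hx
        unfold tableauRow at hx
        generalize tableau μ x = a at *
        obtain ⟨a, a'⟩ := a
        obtain rfl : a = ⟨k, hk⟩ := Fin.ext hx
        exact ⟨a', rfl⟩
      · rintro ⟨j, hj⟩
        rw [tableauRow, ← hj]
    rw [h, Finset.card_map, Finset.card_univ, Fintype.card_fin]
    rfl
  · rw [List.getD_eq_default _ _ (not_lt.1 hk), Finset.card_eq_zero,
      Finset.filter_eq_empty_iff]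
    intro x _ hx
    exact hk (hx ▸ (tableau μ x).1.2)

theorem card_tableauRow_lt_succ (k : ℕ) :
    (Finset.univ.filter fun x => tableauRow μ x < k + 1).card =
      (Finset.univ.filter fun x => tableauRow μ x < k).card + (rowLengths μ).getD k 0 := by
  rw [← card_tableauRow_eq, ← Finset.card_union_of_disjoint]
  · congr 1
    ext x
    simp only [Finset.mem_filter, Finset.mem_union, Finset.mem_univ, true_and]
    omega
  · rw [Finset.disjoint_filter]
    intro x _ hx
    omega

theorem getD_rowLengths_pos_iff (k : ℕ) :
    0 < (rowLengths μ).getD k 0 ↔ k < (rowLengths μ).length := by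
  refine ⟨fun h => ?_, fun h => ?_⟩
  · by_contra hk
    rw [List.getD_eq_default _ _ (not_lt.1 hk)] at h
    exact h.false
  · rw [List.getD_eq_getElem _ _ h]
    exact μ.parts_pos ((Multiset.mem_sort (r := (· ≥ ·))).1 (List.getElem_mem h))

theorem rowLengths_injective : Function.Injective (rowLengths (n := n)) := fun μ ν h =>
  Nat.Partition.ext (by
    rw [← Multiset.sort_eq μ.parts (· ≥ ·), ← Multiset.sort_eq ν.parts (· ≥ ·)]
    exact congrArg _ h)

theorem partition_ext_of_card_tableauRow_lt {μ ν : n.Partition}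
    (h : ∀ k, (Finset.univ.filter fun x => tableauRow μ x < k).card =
      (Finset.univ.filter fun x => tableauRow ν x < k).card) : μ = ν := by
  have getD_eq k : (rowLengths μ).getD k 0 = (rowLengths ν).getD k 0 := by
    have hμ := card_tableauRow_lt_succ μ k
    rw [h, h, card_tableauRow_lt_succ ν] at hμ
    omega
  have length_eq : (rowLengths μ).length = (rowLengths ν).length :=
    eq_of_forall_lt_iff fun k => by
      rw [← getD_rowLengths_pos_iff, ← getD_rowLengths_pos_iff, getD_eq]
  refine rowLengths_injective (List.ext_getElem length_eq fun k hμ hν => ?_)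
  rw [← List.getD_eq_getElem _ 0 hμ, getD_eq, List.getD_eq_getElem _ 0 hν]

end Tableau

section YoungSymmetrizer

variable {n : ℕ}

theorem rowSymmetrizer_mul (μ : n.Partition) (p : Equiv.Perm (Fin n))
    (hp : ∀ x, tableauRow μ (p x) = tableauRow μ x) :
    rowSymmetrizer μ * MonoidAlgebra.single p 1 = rowSymmetrizer μ := by
  classical
  rw [rowSymmetrizer, Finset.sum_mul]
  refine Finset.sum_bij (fun σ _ => σ * p) (fun σ hσ => ?_) (fun σ _ τ _ h => mul_right_cancel h)
    (fun σ hσ => ⟨σ * p⁻¹, ?_, by simp⟩) (fun σ _ => by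
      rw [MonoidAlgebra.single_mul_single, one_mul])
  · simp only [Finset.mem_filter, Finset.mem_univ, true_and, Equiv.Perm.mul_apply] at hσ ⊢
    intro x
    rw [hσ, hp]
  · simp only [Finset.mem_filter, Finset.mem_univ, true_and, Equiv.Perm.mul_apply] at hσ ⊢
    intro x
    rw [hσ, ← hp, Equiv.Perm.coe_inv, Equiv.apply_symm_apply]

theorem mul_colAntisymmetrizer (μ : n.Partition) (q : Equiv.Perm (Fin n))
    (hq : ∀ x, tableauCol μ (q x) = tableauCol μ x) :
    MonoidAlgebra.single q 1 * colAntisymmetrizer μ =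
      ((Equiv.Perm.sign q : ℤ) : ℚ) • colAntisymmetrizer μ := by
  classical
  rw [colAntisymmetrizer, Finset.mul_sum, Finset.smul_sum]
  have hs : ((Equiv.Perm.sign q : ℤ) : ℚ) * ((Equiv.Perm.sign q : ℤ) : ℚ) = 1 := by
    exact_mod_cast Int.units_coe_mul_self (Equiv.Perm.sign q)
  refine Finset.sum_bij (fun σ _ => q * σ) (fun σ hσ => ?_) (fun σ _ τ _ h => mul_left_cancel h)
    (fun σ hσ => ⟨q⁻¹ * σ, ?_, by simp⟩) (fun σ _ => ?_)
  · simp only [Finset.mem_filter, Finset.mem_univ, true_and, Equiv.Perm.mul_apply] at hσ ⊢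
    intro x
    rw [hq, hσ]
  · simp only [Finset.mem_filter, Finset.mem_univ, true_and, Equiv.Perm.mul_apply] at hσ ⊢
    intro x
    rw [← hσ x, ← hq, Equiv.Perm.coe_inv, Equiv.apply_symm_apply]
  · rw [MonoidAlgebra.single_mul_single, one_mul, MonoidAlgebra.smul_single', map_mul,
      Units.val_mul, Int.cast_mul, ← mul_assoc, hs, one_mul]

/-- A transposition of `x` and `y` can be moved from the row symmetrizer, which absorbs it, to the
column antisymmetrizer, which changes its sign. -/
theorem rowSymmetrizer_mul_single_mul_colAntisymmetrizer_eq_zero (μ ν : n.Partition)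
    (g : Equiv.Perm (Fin n)) {x y : Fin n} (hxy : x ≠ y) (hr : tableauRow μ x = tableauRow μ y)
    (hc : tableauCol ν (g⁻¹ x) = tableauCol ν (g⁻¹ y)) :
    rowSymmetrizer μ * MonoidAlgebra.single g 1 * colAntisymmetrizer ν = 0 := by
  have row := rowSymmetrizer_mul μ (Equiv.swap x y) fun z => by
    rw [Equiv.swap_apply_def]
    split_ifs with h h <;> simp [h, hr]
  have col := mul_colAntisymmetrizer ν (Equiv.swap (g⁻¹ x) (g⁻¹ y)) fun z => by
    rw [Equiv.swap_apply_def]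
    split_ifs with h h <;> simp only [h, hc]
  rw [Equiv.Perm.sign_swap (g⁻¹.injective.ne hxy), Units.val_neg, Units.val_one, Int.cast_neg,
    Int.cast_one, neg_one_smul] at col
  have swap : MonoidAlgebra.single (Equiv.swap x y) (1 : ℚ) * MonoidAlgebra.single g 1 =
      MonoidAlgebra.single g 1 * MonoidAlgebra.single (Equiv.swap (g⁻¹ x) (g⁻¹ y)) 1 := by
    rw [MonoidAlgebra.single_mul_single, MonoidAlgebra.single_mul_single,
      Equiv.mul_swap_eq_swap_mul, Equiv.Perm.coe_inv, Equiv.apply_symm_apply,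
      Equiv.apply_symm_apply]
  have : IsAddTorsionFree (PermAlg n) := .of_module_rat _
  refine self_eq_neg.1 ?_
  calc rowSymmetrizer μ * MonoidAlgebra.single g 1 * colAntisymmetrizer ν
    _ = rowSymmetrizer μ * (MonoidAlgebra.single (Equiv.swap x y) 1 * MonoidAlgebra.single g 1) *
        colAntisymmetrizer ν := by rw [← mul_assoc, row]
    _ = rowSymmetrizer μ * MonoidAlgebra.single g 1 *
        (MonoidAlgebra.single (Equiv.swap (g⁻¹ x) (g⁻¹ y)) 1 * colAntisymmetrizer ν) := by
      rw [swap, mul_assoc, mul_assoc, mul_assoc]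
    _ = _ := by rw [col, mul_neg]

theorem card_tableauRow_lt_le (μ ν : n.Partition) (g : Equiv.Perm (Fin n))
    (h : rowSymmetrizer μ * MonoidAlgebra.single g 1 * colAntisymmetrizer ν ≠ 0) (k : ℕ) :
    (Finset.univ.filter fun x => tableauRow μ x < k).card ≤
      (Finset.univ.filter fun x => tableauRow ν x < k).card :=
  calc (Finset.univ.filter fun x => tableauRow μ x < k).card
    _ ≤ (Finset.univ.filter fun x => tableauRow ν (g⁻¹ x) < k).card := by
      refine card_row_lt_le (c := fun x => tableauCol ν (g⁻¹ x)) (fun x y hr hc => ?_)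
        (fun y k hk => ?_) k
      · by_contra hxy
        exact h (rowSymmetrizer_mul_single_mul_colAntisymmetrizer_eq_zero μ ν g hxy hr hc)
      · obtain ⟨z, hz, hz'⟩ := exists_tableauRow_eq_of_lt ν (g⁻¹ y) k hk
        exact ⟨g z, by simpa using hz, by simpa using hz'⟩
    _ = (Finset.univ.filter fun x => tableauRow ν x < k).card :=
      Finset.card_equiv g⁻¹ fun x => by simp

theorem exists_perm_tableauRow_eq_tableauCol_eq (μ : n.Partition) (g : Equiv.Perm (Fin n))
    (hinj : ∀ x y, tableauRow μ x = tableauRow μ y →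
      tableauCol μ (g⁻¹ x) = tableauCol μ (g⁻¹ y) → x = y) :
    ∃ p : Equiv.Perm (Fin n), (∀ x, tableauRow μ (p x) = tableauRow μ x) ∧
      ∀ x, tableauCol μ ((p * g) x) = tableauCol μ x := by
  have cell := exists_row_eq_col_eq (r' := fun x => tableauRow μ (g⁻¹ x)) hinj
    (fun y k hk => by
      obtain ⟨z, hz, hz'⟩ := exists_tableauRow_eq_of_lt μ (g⁻¹ y) k hk
      exact ⟨g z, by simpa using hz, by simpa using hz'⟩)
    (fun k => Finset.card_equiv g fun x => by simp)
  choose z hrow hcol using cell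
  have inj : Function.Injective fun x => g⁻¹ (z x) := fun x y hxy => by
    refine hinj x y ?_ ?_
    · rw [← hrow x, ← hrow y]; exact congrArg _ hxy
    · rw [← hcol x, ← hcol y]; exact congrArg _ hxy
  refine ⟨Equiv.ofBijective _ (Finite.injective_iff_bijective.1 inj), hrow, fun x => ?_⟩
  exact (hcol (g x)).trans (by rw [Equiv.Perm.coe_inv, Equiv.symm_apply_apply])

theorem rowSymmetrizer_mul_single_mul_colAntisymmetrizer_mem (μ : n.Partition)
    (g : Equiv.Perm (Fin n)) :
    rowSymmetrizer μ * MonoidAlgebra.single g 1 * colAntisymmetrizer μ ∈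
      Submodule.span ℚ {youngSymmetrizer μ} := by
  by_cases h : rowSymmetrizer μ * MonoidAlgebra.single g 1 * colAntisymmetrizer μ = 0
  · exact h ▸ zero_mem _
  obtain ⟨p, hrow, hcol⟩ := exists_perm_tableauRow_eq_tableauCol_eq μ g fun x y hr hc => by
    by_contra hxy
    exact h (rowSymmetrizer_mul_single_mul_colAntisymmetrizer_eq_zero μ μ g hxy hr hc)
  refine Submodule.mem_span_singleton.2 ⟨((Equiv.Perm.sign (p * g) : ℤ) : ℚ), ?_⟩
  rw [youngSymmetrizer, ← mul_smul_comm, ← mul_colAntisymmetrizer μ (p * g) hcol,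
    ← one_mul (1 : ℚ), ← MonoidAlgebra.single_mul_single, one_mul, ← mul_assoc, ← mul_assoc,
    rowSymmetrizer_mul μ p hrow]

theorem mul_mul_mem_of_mul_single_mul_mem {k G : Type*} [CommRing k] [Group G]
    {a b : MonoidAlgebra k G} {N : Submodule k (MonoidAlgebra k G)}
    (h : ∀ g, a * MonoidAlgebra.single g 1 * b ∈ N) (x : MonoidAlgebra k G) : a * x * b ∈ N := by
  induction x using MonoidAlgebra.induction_linear with
  | zero => simp
  | add x y hx hy => rw [mul_add, add_mul]; exact add_mem hx hy
  | single g r =>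
    rw [← mul_one r, ← MonoidAlgebra.smul_single', mul_smul_comm, smul_mul_assoc]
    exact N.smul_mem r (h g)

theorem exists_rowSymmetrizer_mul_mul_colAntisymmetrizer (μ : n.Partition) (x : PermAlg n) :
    ∃ s : ℚ, rowSymmetrizer μ * x * colAntisymmetrizer μ = s • youngSymmetrizer μ := by
  obtain ⟨s, hs⟩ := Submodule.mem_span_singleton.1 (mul_mul_mem_of_mul_single_mul_mem
    (rowSymmetrizer_mul_single_mul_colAntisymmetrizer_mem μ) x)
  exact ⟨s, hs.symm⟩

theorem rowSymmetrizer_mul_mul_colAntisymmetrizer_eq_zero_or {μ ν : n.Partition} (h : μ ≠ ν) :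
    (∀ x, rowSymmetrizer μ * x * colAntisymmetrizer ν = 0) ∨
      ∀ x, rowSymmetrizer ν * x * colAntisymmetrizer μ = 0 := by
  have zero_or_le (μ ν : n.Partition) : (∀ x, rowSymmetrizer μ * x * colAntisymmetrizer ν = 0) ∨
      ∀ k, (Finset.univ.filter fun x => tableauRow μ x < k).card ≤
        (Finset.univ.filter fun x => tableauRow ν x < k).card := by
    refine or_iff_not_imp_right.2 fun hle => mul_mul_mem_of_mul_single_mul_mem (N := ⊥) fun g => ?_
    by_contra hg
    exact hle (card_tableauRow_lt_le μ ν g hg)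
  refine (zero_or_le μ ν).imp_right fun hμν => (zero_or_le ν μ).resolve_right fun hνμ => h ?_
  exact partition_ext_of_card_tableauRow_lt fun k => (hμν k).antisymm (hνμ k)

theorem eq_one_of_mul_eq_one (μ : n.Partition) {σ τ : Equiv.Perm (Fin n)}
    (hσ : ∀ x, tableauRow μ (σ x) = tableauRow μ x) (hτ : ∀ x, tableauCol μ (τ x) = tableauCol μ x)
    (h : σ * τ = 1) : σ = 1 := by
  refine Equiv.ext fun x => tableau_ext μ (hσ x) ?_
  rw [← hτ (σ x), eq_inv_of_mul_eq_one_right h, Equiv.Perm.coe_inv, Equiv.symm_apply_apply,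
    Equiv.Perm.one_apply]

theorem unitCoeff_youngSymmetrizer (μ : n.Partition) : unitCoeff (youngSymmetrizer μ) = 1 := by
  classical
  rw [youngSymmetrizer, rowSymmetrizer, colAntisymmetrizer, Finset.sum_mul_sum, map_sum,
    Finset.sum_eq_single_of_mem 1 (by simp) fun σ hσ hσ1 => ?_, map_sum,
    Finset.sum_eq_single_of_mem 1 (by simp) fun τ _ hτ1 => ?_]
  · simp [unitCoeff_single, MonoidAlgebra.single_mul_single]
  · rw [MonoidAlgebra.single_mul_single, one_mul, unitCoeff_single, if_neg hτ1]
  · rw [map_sum]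
    refine Finset.sum_eq_zero fun τ hτ => ?_
    rw [MonoidAlgebra.single_mul_single, unitCoeff_single, if_neg]
    exact fun h => hσ1
      (eq_one_of_mul_eq_one μ (Finset.mem_filter.1 hσ).2 (Finset.mem_filter.1 hτ).2 h)

theorem youngSymmetrizer_ne_zero (μ : n.Partition) : youngSymmetrizer μ ≠ 0 := fun h => by
  simpa [h] using unitCoeff_youngSymmetrizer μ

end YoungSymmetrizer

section TraceFunctionals

variable (k B : Type*) [Field k] [Ring B] [Algebra k B]

/-- The linear functionals `τ` on an algebra with `τ (x * y) = τ (y * x)`. On a group algebra these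
are the class functions, and they count the primitive central idempotents. -/
def traceFunctionals : Submodule k (Module.Dual k B) where
  carrier := {τ | ∀ x y, τ (x * y) = τ (y * x)}
  add_mem' hσ hτ x y := by rw [LinearMap.add_apply, LinearMap.add_apply, hσ, hτ]
  zero_mem' _ _ := rfl
  smul_mem' c τ hτ x y := by rw [LinearMap.smul_apply, LinearMap.smul_apply, hτ]

variable {B}

/-- The values of a trace functional at a family of elements. -/
def evalTraceFunctionals {I : Type*} (e : I → B) : traceFunctionals k B →ₗ[k] I → k :=
  LinearMap.pi fun i => Module.Dual.eval k B (e i) ∘ₗ (traceFunctionals k B).subtype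

theorem evalTraceFunctionals_conjClasses_injective (G : Type*) [Group G] :
    Function.Injective (evalTraceFunctionals k fun c : ConjClasses G =>
      MonoidAlgebra.single (Quotient.out c) (1 : k)) := by
  refine (injective_iff_map_eq_zero _).2 fun τ hτ => Subtype.ext (LinearMap.ext fun x => ?_)
  induction x using MonoidAlgebra.induction_linear with
  | zero => simp
  | add x y hx hy => rw [map_add, hx, hy, map_add]
  | single g r =>
    have mk_out : ConjClasses.mk (Quotient.out (ConjClasses.mk g)) = ConjClasses.mk g :=
      Quotient.out_eq _
    obtain ⟨h, hg⟩ := isConj_iff.1 (ConjClasses.mk_eq_mk_iff_isConj.1 mk_out)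
    have cyclic := τ.2 (MonoidAlgebra.single (h * Quotient.out (ConjClasses.mk g)) 1)
      (MonoidAlgebra.single h⁻¹ 1)
    rw [MonoidAlgebra.single_mul_single, MonoidAlgebra.single_mul_single, hg,
      inv_mul_cancel_left, mul_one] at cyclic
    have zero : τ.1 (MonoidAlgebra.single (Quotient.out (ConjClasses.mk g)) 1) = 0 :=
      congrFun hτ (ConjClasses.mk g)
    rw [← mul_one r, ← MonoidAlgebra.smul_single', map_smul, cyclic, zero, smul_zero,
      ZeroMemClass.coe_zero, LinearMap.zero_apply]

theorem finrank_traceFunctionals_monoidAlgebra_le (G : Type*) [Group G] [Finite G] :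
    Module.finrank k (traceFunctionals k (MonoidAlgebra k G)) ≤ Nat.card (ConjClasses G) := by
  have := Fintype.ofFinite (ConjClasses G)
  rw [Nat.card_eq_fintype_card, ← Module.finrank_fintype_fun_eq_card k]
  exact LinearMap.finrank_le_finrank_of_injective (evalTraceFunctionals_conjClasses_injective k G)

theorem card_conjClasses_perm_le (α : Type*) [Fintype α] :
    Nat.card (ConjClasses (Equiv.Perm α)) ≤ Fintype.card (Fintype.card α).Partition := by
  classical
  rw [← Nat.card_eq_fintype_card]
  refine Nat.card_le_card_of_injective (Quotient.lift Equiv.Perm.partition fun _ _ =>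
    Equiv.Perm.partition_eq_of_isConj.1) ?_
  rintro ⟨σ⟩ ⟨τ⟩ h
  exact Quotient.sound (Equiv.Perm.partition_eq_of_isConj.2 h)

theorem finrank_traceFunctionals_permAlg_le (n : ℕ) :
    Module.finrank ℚ (traceFunctionals ℚ (PermAlg n)) ≤ Fintype.card n.Partition := by
  have h := card_conjClasses_perm_le (Fin n)
  rw [Fintype.card_fin] at h
  exact (finrank_traceFunctionals_monoidAlgebra_le ℚ _).trans h

variable {k}

/-- The trace functional `x ↦ tr (z ↦ x * z * e)`; for an idempotent `e` it is the character of the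
left module generated by `e`. -/
def sandwichTrace (e : B) : traceFunctionals k B :=
  ⟨LinearMap.trace k B ∘ₗ LinearMap.mulRight k (LinearMap.mulRight k e) ∘ₗ
    (Algebra.lmul k B).toLinearMap, fun x y => by
      change LinearMap.trace k B (Algebra.lmul k B (x * y) * LinearMap.mulRight k e) =
        LinearMap.trace k B (Algebra.lmul k B (y * x) * LinearMap.mulRight k e)
      have comm : Commute (Algebra.lmul k B x) (LinearMap.mulRight k e) :=
        LinearMap.commute_mulLeft_right x e
      rw [map_mul (Algebra.lmul k B), map_mul (Algebra.lmul k B), mul_assoc,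
        LinearMap.trace_mul_comm, mul_assoc, mul_assoc, comm.eq]⟩

theorem sandwichTrace_apply (e x : B) : (sandwichTrace e : traceFunctionals k B).1 x =
    LinearMap.trace k B (LinearMap.mulLeft k x * LinearMap.mulRight k e) :=
  rfl

theorem sandwichTrace_eq_zero {e x : B} (h : ∀ z, x * z * e = 0) :
    (sandwichTrace e : traceFunctionals k B).1 x = 0 := by
  have zero : LinearMap.mulLeft k x * LinearMap.mulRight k e = 0 := LinearMap.ext fun z => by
    simpa [mul_assoc] using h z
  rw [sandwichTrace_apply, zero, map_zero]

theorem sandwichTrace_self [Module.Finite k B] {e : B} (he : e * e = e) :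
    (sandwichTrace e : traceFunctionals k B).1 e = Module.finrank k (corner k e e) := by
  have apply_eq (z : B) : (LinearMap.mulLeft k e * LinearMap.mulRight k e) z = e * z * e :=
    (mul_assoc e z e).symm
  have proj : LinearMap.IsProj (corner k e e) (LinearMap.mulLeft k e * LinearMap.mulRight k e) :=
    ⟨fun z => apply_eq z ▸ mul_mul_mem_corner he he z, fun z hz => by rw [apply_eq, hz.1, hz.2]⟩
  rw [sandwichTrace_apply, proj.trace]

theorem finrank_corner_self_ne_zero [Module.Finite k B] {e : B} (he : e * e = e) (h0 : e ≠ 0) :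
    Module.finrank k (corner k e e) ≠ 0 := by
  rw [← Nat.pos_iff_ne_zero, Module.finrank_pos_iff]
  exact ⟨⟨e, he, he⟩, 0, fun h => h0 (congrArg Subtype.val h)⟩

theorem evalTraceFunctionals_surjective [CharZero k] [Module.Finite k B] {I : Type*} [Finite I]
    {e : I → B} (ne_zero : ∀ i, e i ≠ 0) (idem : ∀ i, e i * e i = e i)
    (orth : ∀ i j x, i ≠ j → e i * x * e j = 0) :
    Function.Surjective (evalTraceFunctionals k e) := by
  classical
  have := Fintype.ofFinite I
  intro c
  refine ⟨∑ i, (c i / Module.finrank k (corner k (e i) (e i))) • sandwichTrace (e i),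
    funext fun j => ?_⟩
  have off_diag (i) (hij : i ≠ j) : evalTraceFunctionals k e (sandwichTrace (e i)) j = 0 :=
    sandwichTrace_eq_zero fun z => orth j i z hij.symm
  have diag : evalTraceFunctionals k e (sandwichTrace (e j)) j =
      Module.finrank k (corner k (e j) (e j)) := sandwichTrace_self (idem j)
  have cast_ne_zero : (Module.finrank k (corner k (e j) (e j)) : k) ≠ 0 :=
    Nat.cast_ne_zero.2 (finrank_corner_self_ne_zero (idem j) (ne_zero j))
  rw [map_sum, Finset.sum_apply, Fintype.sum_eq_single j fun i hij => by
    rw [map_smul, Pi.smul_apply, off_diag i hij, smul_zero], map_smul, Pi.smul_apply, diag,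
    smul_eq_mul, div_mul_cancel₀ _ cast_ne_zero]

theorem evalTraceFunctionals_injective [CharZero k] [Module.Finite k B] {I : Type*} [Fintype I]
    (hI : Module.finrank k (traceFunctionals k B) ≤ Fintype.card I)
    {e : I → B} (ne_zero : ∀ i, e i ≠ 0) (idem : ∀ i, e i * e i = e i)
    (orth : ∀ i j x, i ≠ j → e i * x * e j = 0) :
    Function.Injective (evalTraceFunctionals k e) := by
  have surj := evalTraceFunctionals_surjective (k := k) ne_zero idem orth
  have finrank_eq : Module.finrank k (traceFunctionals k B) = Module.finrank k (I → k) :=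
    le_antisymm (by rwa [Module.finrank_fintype_fun_eq_card])
      (LinearMap.finrank_le_finrank_of_surjective surj)
  exact (LinearMap.injective_iff_surjective_of_finrank_eq_finrank (K := k)
    (V := traceFunctionals k B) (V₂ := I → k) finrank_eq).2 surj

/-- The character of a representation of an algebra. -/
def representationTrace {M : Type*} [AddCommGroup M] [Module k M] (ρ : B →ₐ[k] Module.End k M) :
    traceFunctionals k B :=
  ⟨LinearMap.trace k M ∘ₗ ρ.toLinearMap, fun x y => by
    simp only [LinearMap.comp_apply, AlgHom.toLinearMap_apply, map_mul]
    rw [LinearMap.trace_mul_comm]⟩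

/-- If `J` is proper, the character of `B ⧸ J` is a trace functional that vanishes on `J` but not
at `1`. -/
theorem eq_top_of_forall_traceFunctionals [CharZero k] [Module.Finite k B] (J : Ideal B)
    [J.IsTwoSided] (h : ∀ τ : traceFunctionals k B, (∀ x ∈ J, τ.1 x = 0) → τ = 0) : J = ⊤ := by
  let τ : traceFunctionals k B :=
    representationTrace ((Algebra.lmul k (B ⧸ J)).comp (Ideal.Quotient.mkₐ k J))
  have apply_eq (x : B) : τ.1 x =
      LinearMap.trace k (B ⧸ J) (Algebra.lmul k (B ⧸ J) (Ideal.Quotient.mk J x)) := rfl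
  have zero : τ = 0 := h τ fun x hx => by
    rw [apply_eq, Ideal.Quotient.eq_zero_iff_mem.2 hx, map_zero, map_zero]
  have finite : Module.Finite k (B ⧸ J) :=
    Module.Finite.of_surjective (Ideal.Quotient.mkₐ k J).toLinearMap
      (Ideal.Quotient.mkₐ_surjective k J)
  have finrank_eq : ((0 : ℕ) : k) = Module.finrank k (B ⧸ J) := by
    rw [← LinearMap.trace_one, ← map_one (Algebra.lmul k (B ⧸ J)),
      ← map_one (Ideal.Quotient.mk J), ← apply_eq, zero, Nat.cast_zero]
    rfl
  have subsingleton := Module.finrank_zero_iff.1 (Nat.cast_injective finrank_eq).symm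
  exact Ideal.Quotient.subsingleton_iff.1 subsingleton

theorem one_mem_span_of_finrank_traceFunctionals_le [CharZero k] [Module.Finite k B] {I : Type*}
    [Fintype I] (hI : Module.finrank k (traceFunctionals k B) ≤ Fintype.card I)
    {e : I → B} (ne_zero : ∀ i, e i ≠ 0) (idem : ∀ i, e i * e i = e i)
    (orth : ∀ i j x, i ≠ j → e i * x * e j = 0) :
    (1 : B) ∈ Submodule.span k {z | ∃ i x y, z = x * e i * y} := by
  let S : Set B := {z | ∃ i x y, z = x * e i * y}
  have mul_mem_left (b : B) : Submodule.span k S ≤ (Submodule.span k S).comap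
      (LinearMap.mulLeft k b) := Submodule.span_le.2 <| by
    rintro _ ⟨i, x, y, rfl⟩
    exact Submodule.subset_span ⟨i, b * x, y, by simp [mul_assoc]⟩
  have mul_mem_right (b : B) : Submodule.span k S ≤ (Submodule.span k S).comap
      (LinearMap.mulRight k b) := Submodule.span_le.2 <| by
    rintro _ ⟨i, x, y, rfl⟩
    exact Submodule.subset_span ⟨i, x, y * b, by simp [mul_assoc]⟩
  let J : Ideal B := { Submodule.span k S with smul_mem' := fun b _ hz => mul_mem_left b hz }
  have : J.IsTwoSided := ⟨fun b hz => mul_mem_right b hz⟩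
  refine (Ideal.eq_top_iff_one J).1 (eq_top_of_forall_traceFunctionals (k := k) J fun τ hτ =>
    evalTraceFunctionals_injective hI ne_zero idem orth ?_)
  rw [map_zero]
  exact funext fun i => hτ _ (Submodule.subset_span ⟨i, 1, 1, by simp⟩)

end TraceFunctionals

section SchurIdempotents

variable {n : ℕ}

theorem exists_mul_youngSymmetrizer_eq (μ : n.Partition) :
    ∃ y, y * youngSymmetrizer μ = schurIdempotent μ := by
  refine Ideal.mem_span_singleton'.1 (?_ : schurIdempotent μ ∈ spechtIdeal μ)
  rw [spechtIdeal_eq]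
  exact Ideal.mem_span_singleton_self _

theorem schurIdempotent_ne_zero (μ : n.Partition) : schurIdempotent μ ≠ 0 := fun h0 => by
  have h : youngSymmetrizer μ ∈ spechtIdeal μ := Ideal.mem_span_singleton_self _
  rw [spechtIdeal_eq, h0, Ideal.span_singleton_eq_bot.2 rfl] at h
  exact youngSymmetrizer_ne_zero μ h

theorem schurIdempotent_mul_mul_eq_zero_of_rowSymmetrizer {μ ν : n.Partition}
    (h : ∀ x, rowSymmetrizer μ * x * colAntisymmetrizer ν = 0) (x : PermAlg n) :
    schurIdempotent μ * x * schurIdempotent ν = 0 := by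
  obtain ⟨y, hy⟩ := exists_mul_youngSymmetrizer_eq μ
  obtain ⟨z, hz⟩ := exists_mul_youngSymmetrizer_eq ν
  calc schurIdempotent μ * x * schurIdempotent ν
    _ = y * (rowSymmetrizer μ * (colAntisymmetrizer μ * x * z * rowSymmetrizer ν) *
        colAntisymmetrizer ν) := by
      rw [← hy, ← hz, youngSymmetrizer, youngSymmetrizer]
      simp only [mul_assoc]
    _ = 0 := by rw [h, mul_zero]

theorem schurIdempotent_mul_mul_eq_zero {μ ν : n.Partition} (hμν : μ ≠ ν) (x : PermAlg n) :
    schurIdempotent μ * x * schurIdempotent ν = 0 := by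
  rcases rowSymmetrizer_mul_mul_colAntisymmetrizer_eq_zero_or hμν with h | h
  · exact schurIdempotent_mul_mul_eq_zero_of_rowSymmetrizer h x
  have νμ_eq_bot : corner ℚ (schurIdempotent ν) (schurIdempotent μ) = ⊥ :=
    (Submodule.eq_bot_iff _).2 fun z hz => by
      have := schurIdempotent_mul_mul_eq_zero_of_rowSymmetrizer h z
      rwa [hz.1, hz.2] at this
  have hμ := schurIdempotent_mul_self μ
  have hν := schurIdempotent_mul_self ν
  have μν_eq_bot : corner ℚ (schurIdempotent μ) (schurIdempotent ν) = ⊥ := by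
    rw [← Submodule.finrank_eq_zero, finrank_corner_comm hμ hν, νμ_eq_bot, finrank_bot]
  exact (Submodule.mem_bot ℚ).1 (μν_eq_bot ▸ mul_mul_mem_corner hμ hν x)

theorem exists_schurIdempotent_mul_mul_self (μ : n.Partition) (x : PermAlg n) :
    ∃ c : ℚ, schurIdempotent μ * x * schurIdempotent μ = c • schurIdempotent μ := by
  obtain ⟨y, hy⟩ := exists_mul_youngSymmetrizer_eq μ
  obtain ⟨c, hc⟩ := exists_rowSymmetrizer_mul_mul_colAntisymmetrizer μ
    (colAntisymmetrizer μ * x * y * rowSymmetrizer μ)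
  refine ⟨c, ?_⟩
  calc schurIdempotent μ * x * schurIdempotent μ
    _ = y * (rowSymmetrizer μ * (colAntisymmetrizer μ * x * y * rowSymmetrizer μ) *
        colAntisymmetrizer μ) := by
      rw [← hy, youngSymmetrizer]
      simp only [mul_assoc]
    _ = c • schurIdempotent μ := by rw [hc, mul_smul_comm, hy]

/-- There are as many Schur idempotents as conjugacy classes, so no irreducible is missing. -/
theorem isCompleteSystem_schurIdempotent (n : ℕ) :
    IsCompleteSystem ℚ (schurIdempotent : n.Partition → PermAlg n) where
  ne_zero := schurIdempotent_ne_zero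
  idem := schurIdempotent_mul_self
  scalar := exists_schurIdempotent_mul_mul_self
  orth _ _ x h := schurIdempotent_mul_mul_eq_zero h x
  full := one_mem_span_of_finrank_traceFunctionals_le (finrank_traceFunctionals_permAlg_le n)
    schurIdempotent_ne_zero schurIdempotent_mul_self fun _ _ x h =>
      schurIdempotent_mul_mul_eq_zero h x

end SchurIdempotents

section Biproducts

variable {C : Type u} [Category.{v} C] [Preadditive C] [HasFiniteBiproducts C]

open Classical in
/-- An object with the inclusions and projections of a direct sum is the direct sum. -/
def isoBiproductOf {J : Type} [Fintype J] {S : C} (F : J → C) (i : ∀ j, F j ⟶ S)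
    (p : ∀ j, S ⟶ F j) (h₁ : ∀ j, i j ≫ p j = 𝟙 _) (h₂ : ∀ j k, j ≠ k → i j ≫ p k = 0)
    (h₃ : ∑ j, p j ≫ i j = 𝟙 S) : S ≅ ⨁ F :=
  biproduct.uniqueUpToIso F (b :=
    { pt := S
      π := p
      ι := i
      ι_π := fun j k => by
        split_ifs with h
        · subst h
          exact h₁ j
        · exact h₂ j k h }) (isBilimitOfTotal _ h₃)

end Biproducts

section IdempotentGenerators

variable {B : Type*} [Ring B]

/-- The idempotent `e` generates the left ideal `I`, so that right multiplication by `e` is a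
projection onto `I`. -/
structure IsIdempotentGenerator (I : Ideal B) (e : B) : Prop where
  idem : e * e = e
  eq_span : I = Ideal.span {e}

namespace IsIdempotentGenerator

variable {I : Ideal B} {e : B} (hI : IsIdempotentGenerator I e)

include hI

theorem mem_iff {y : B} : y ∈ I ↔ y * e = y := by
  rw [hI.eq_span, Ideal.mem_span_singleton']
  constructor
  · rintro ⟨a, rfl⟩
    rw [mul_assoc, hI.idem]
  · exact fun h => ⟨y, h⟩

/-- The generator as an element of the ideal. -/
def gen : I := ⟨e, hI.mem_iff.2 hI.idem⟩

end IsIdempotentGenerator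

theorem isIdempotentGenerator_span {e : B} (he : e * e = e) :
    IsIdempotentGenerator (Ideal.span {e}) e :=
  ⟨he, rfl⟩

theorem isIdempotentGenerator_spechtIdeal {n : ℕ} (μ : n.Partition) :
    IsIdempotentGenerator (spechtIdeal μ) (schurIdempotent μ) :=
  ⟨schurIdempotent_mul_self μ, spechtIdeal_eq μ⟩

end IdempotentGenerators

section IdealRepresentations

variable {n : ℕ}

/-- A left ideal as an object of the category of representations. -/
abbrev idealObj (I : Ideal (PermAlg n)) : FDRep ℚ (Equiv.Perm (Fin n)) := FDRep.of (idealRep I)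

/-- The action of the group algebra on a representation. -/
abbrev algAct (V : FDRep ℚ (Equiv.Perm (Fin n))) : PermAlg n →ₐ[ℚ] Module.End ℚ V :=
  MonoidAlgebra.lift ℚ (Module.End ℚ V) (Equiv.Perm (Fin n)) V.ρ

theorem algAct_single (V : FDRep ℚ (Equiv.Perm (Fin n))) (g : Equiv.Perm (Fin n)) (r : ℚ) (v : V) :
    algAct V (MonoidAlgebra.single g r) v = r • V.ρ g v := by
  rw [algAct, MonoidAlgebra.lift_single, LinearMap.smul_apply]

theorem repLin_algAct {V W : FDRep ℚ (Equiv.Perm (Fin n))} (f : V ⟶ W) (x : PermAlg n) (v : V) :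
    repLin f (algAct V x v) = algAct W x (repLin f v) := by
  induction x using MonoidAlgebra.induction_linear with
  | zero => simp
  | add a b ha hb => simp only [map_add, LinearMap.add_apply, ha, hb]
  | single g r => rw [algAct_single, algAct_single, map_smul, repLin_equivariant]

theorem algAct_idealObj (I : Ideal (PermAlg n)) (x : PermAlg n) (y : I) :
    ((algAct (idealObj I) x y : I) : PermAlg n) = x * y := by
  induction x using MonoidAlgebra.induction_linear with
  | zero => rw [map_zero, zero_mul]; rfl
  | add a b ha hb =>
    rw [map_add, add_mul, ← ha, ← hb]
    rfl
  | single g r =>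
    refine (congrArg Subtype.val (algAct_single (idealObj I) g r y)).trans ?_
    change r • (MonoidAlgebra.single g 1 * (y : PermAlg n)) = _
    rw [← smul_mul_assoc, MonoidAlgebra.smul_single', mul_one]

theorem idealHom_ext {I J : Ideal (PermAlg n)} {f g : idealObj I ⟶ idealObj J}
    (h : ∀ y : I, ((repLin f y : J) : PermAlg n) = ((repLin g y : J) : PermAlg n)) : f = g :=
  rep_ext (LinearMap.ext fun y => Subtype.ext (h y))

/-- The morphism from a left ideal to a representation that sends `y` to `y • t`. -/
def orbitHom (I : Ideal (PermAlg n)) {V : FDRep ℚ (Equiv.Perm (Fin n))} (t : V) :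
    idealObj I ⟶ V :=
  repHom (V := idealObj I)
    ({ toFun := fun y => algAct V (y : PermAlg n) t
       map_add' := fun y z => by
         rw [Submodule.coe_add, map_add]
         rfl
       map_smul' := fun c y => LinearMap.congr_fun
         ((algAct V).toLinearMap.map_smul c (y : PermAlg n)) t } : I →ₗ[ℚ] V) fun g y => by
      change algAct V (MonoidAlgebra.single g 1 * ((y : I) : PermAlg n)) t =
        V.ρ g (algAct V ((y : I) : PermAlg n) t)
      rw [map_mul, Module.End.mul_apply, algAct_single, one_smul]

theorem repLin_orbitHom (I : Ideal (PermAlg n)) {V : FDRep ℚ (Equiv.Perm (Fin n))} (t : V)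
    (y : I) : repLin (orbitHom I t) y = algAct V (y : PermAlg n) t :=
  rfl

section Generators

variable {I J K : Ideal (PermAlg n)} {e f g : PermAlg n} (hI : IsIdempotentGenerator I e)
  (hJ : IsIdempotentGenerator J f) (hK : IsIdempotentGenerator K g)

theorem algAct_gen (y : I) : algAct (idealObj I) (y : PermAlg n) hI.gen = y :=
  Subtype.ext ((algAct_idealObj I _ hI.gen).trans (hI.mem_iff.1 y.2))

theorem repLin_eq_algAct_gen {V : FDRep ℚ (Equiv.Perm (Fin n))} (F : idealObj I ⟶ V) (y : I) :
    repLin F y = algAct V (y : PermAlg n) (repLin F hI.gen) := by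
  rw [← repLin_algAct]
  exact congrArg (repLin F) (algAct_gen hI y).symm

/-- Right multiplication by an element of `e ℚ[Σ_n] f`, as a morphism of representations. -/
def cornerHom (x : corner ℚ e f) : idealObj I ⟶ idealObj J :=
  repHom (V := idealObj I) (W := idealObj J)
    ({ toFun := fun y => ⟨(y : PermAlg n) * x, hJ.mem_iff.2 (by rw [mul_assoc, x.2.2])⟩
       map_add' := fun _ _ => Subtype.ext (add_mul _ _ _)
       map_smul' := fun _ _ => Subtype.ext (smul_mul_assoc _ _ _) } : I →ₗ[ℚ] J)
    fun g y => Subtype.ext (mul_assoc (MonoidAlgebra.single g 1) ((y : I) : PermAlg n) x)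

/-- Morphisms between left ideals generated by idempotents are right multiplications. -/
def idealHomEquiv : (idealObj I ⟶ idealObj J) ≃ₗ[ℚ] corner ℚ e f where
  toFun F := ⟨(repLin F hI.gen : J),
    (algAct_idealObj J e _).symm.trans
      (congrArg Subtype.val (repLin_eq_algAct_gen hI F hI.gen).symm),
    hJ.mem_iff.1 (repLin F hI.gen : J).2⟩
  map_add' _ _ := rfl
  map_smul' _ _ := rfl
  invFun := cornerHom hJ
  left_inv F := idealHom_ext fun y =>
    (algAct_idealObj J y _).symm.trans (congrArg Subtype.val (repLin_eq_algAct_gen hI F y).symm)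
  right_inv x := Subtype.ext x.2.1

theorem cornerHom_comp_cornerHom (x : corner ℚ e f) (y : corner ℚ f g) (z : corner ℚ e g)
    (h : (x : PermAlg n) * y = z) :
    (cornerHom hJ x : idealObj I ⟶ _) ≫ cornerHom hK y = cornerHom hK z :=
  idealHom_ext fun a => (mul_assoc (a : PermAlg n) x y).trans (congrArg _ h)

theorem cornerHom_eq_id (x : corner ℚ e e) (h : (x : PermAlg n) = e) :
    cornerHom hI x = 𝟙 (idealObj I) :=
  idealHom_ext fun a => (congrArg _ h).trans (hI.mem_iff.1 a.2)

theorem cornerHom_comp_cornerHom_eq_zero (x : corner ℚ e f) (y : corner ℚ f g)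
    (h : (x : PermAlg n) * y = 0) : (cornerHom hJ x : idealObj I ⟶ _) ≫ cornerHom hK y = 0 :=
  idealHom_ext fun a => (mul_assoc (a : PermAlg n) x y).trans ((congrArg _ h).trans (mul_zero _))

include hI in
theorem sum_cornerHom {S : Type} (T : Finset S) (x : S → corner ℚ e f) :
    ∑ s ∈ T, (cornerHom hJ (x s) : idealObj I ⟶ idealObj J) = cornerHom hJ (∑ s ∈ T, x s) :=
  (map_sum (idealHomEquiv hI hJ).symm x T).symm

end Generators

theorem nonempty_idealObj_iso_biproduct {S : Type} [Fintype S] {I : Ideal (PermAlg n)}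
    {J : S → Ideal (PermAlg n)} {e : PermAlg n} {f v w : S → PermAlg n}
    (hI : IsIdempotentGenerator I e) (hJ : ∀ s, IsIdempotentGenerator (J s) (f s))
    (hv : ∀ s, v s ∈ corner ℚ (f s) e) (hw : ∀ s, w s ∈ corner ℚ e (f s))
    (mul_self : ∀ s, v s * w s = f s) (mul_of_ne : ∀ s t, s ≠ t → v s * w t = 0)
    (sum_mul : ∑ s, w s * v s = e) :
    Nonempty (idealObj I ≅ ⨁ fun s => idealObj (J s)) := by
  let incl (s : S) : idealObj (J s) ⟶ idealObj I := cornerHom hI ⟨v s, hv s⟩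
  let proj (s : S) : idealObj I ⟶ idealObj (J s) := cornerHom (hJ s) ⟨w s, hw s⟩
  refine ⟨isoBiproductOf (fun s => idealObj (J s)) incl proj (fun s => ?_) (fun s t hst => ?_) ?_⟩
  · exact (cornerHom_comp_cornerHom hI (hJ s) _ _ ⟨f s, (hJ s).idem, (hJ s).idem⟩
      (mul_self s)).trans (cornerHom_eq_id (hJ s) _ rfl)
  · exact cornerHom_comp_cornerHom_eq_zero hI (hJ t) _ _ (mul_of_ne s t hst)
  · let x (s : S) : corner ℚ e e := ⟨w s * v s,
      by rw [← mul_assoc, (hw s).1], by rw [mul_assoc, (hv s).2]⟩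
    have sum_x : ((∑ s, x s : corner ℚ e e) : PermAlg n) = e := by
      rw [Submodule.coe_sum]
      exact sum_mul
    calc ∑ s, proj s ≫ incl s
      _ = ∑ s, cornerHom hI (x s) :=
        Finset.sum_congr rfl fun s _ => cornerHom_comp_cornerHom (hJ s) hI _ _ (x s) rfl
      _ = cornerHom hI (∑ s, x s) := sum_cornerHom hI hI Finset.univ x
      _ = 𝟙 _ := cornerHom_eq_id hI _ sum_x

theorem nonempty_idealObj_iso_biproduct_specht {I : Ideal (PermAlg n)} {e : PermAlg n}
    (hI : IsIdempotentGenerator I e) {d : n.Partition → ℕ}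
    (hd : ∀ π, Module.finrank ℚ (corner ℚ e (schurIdempotent π)) = d π) :
    Nonempty (idealObj I ≅ ⨁ fun π : n.Partition => ⨁ fun _ : Fin (d π) => specht π) := by
  let b (π : n.Partition) := Module.finBasisOfFinrankEq ℚ _ (hd π)
  obtain ⟨v, hv, mul_self, mul_of_ne, sum_mul⟩ :=
    (isCompleteSystem_schurIdempotent n).exists_decomposition hI.idem b
  obtain ⟨j⟩ := nonempty_idealObj_iso_biproduct (S := Σ π, Fin (d π)) hI
    (fun s => isIdempotentGenerator_spechtIdeal s.1) hv (fun s => (b s.1 s.2).2)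
    mul_self mul_of_ne sum_mul
  exact ⟨j ≪≫ (biproductBiproductIso _ fun π _ => specht π).symm⟩

end IdealRepresentations

section Induction

variable {p q n : ℕ} (h : p + q = n)

theorem youngEmb_injective : Function.Injective (youngEmb h) := by
  rintro ⟨a, b⟩ ⟨a', b'⟩ hab
  refine Prod.ext (Equiv.ext fun i => ?_) (Equiv.ext fun i => ?_)
  · have left := DFunLike.congr_fun hab (blockL h i)
    rw [youngEmb_blockL, youngEmb_blockL] at left
    have val_eq := congrArg Fin.val left
    exact Fin.ext val_eq
  · have right := DFunLike.congr_fun hab (blockR h i)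
    rw [youngEmb_blockR, youngEmb_blockR] at right
    have val_eq := congrArg Fin.val right
    exact Fin.ext (Nat.add_left_cancel val_eq)

theorem algAct_indι (V : FDRep ℚ (Equiv.Perm (Fin p))) (W : FDRep ℚ (Equiv.Perm (Fin q)))
    (x : PermAlg p) (y : PermAlg q) (v : V) (w : W) :
    algAct (indProd h V W) (algMap (youngEmb h) (outer x y)) (indι h V W v w) =
      indι h V W (algAct V x v) (algAct W y w) := by
  induction x using MonoidAlgebra.induction_linear with
  | zero => simp
  | add a b ha hb => simp only [map_add, LinearMap.add_apply, ha, hb]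
  | single g r =>
    induction y using MonoidAlgebra.induction_linear with
    | zero => simp
    | add a b ha hb => simp only [map_add, LinearMap.add_apply, ha, hb]
    | single g' s =>
      rw [outer_single, algMap_single, algAct_single, algAct_single, algAct_single, rho_indι,
        map_smul, map_smul, LinearMap.smul_apply, smul_smul, mul_comm]

variable (μ : p.Partition) (η : q.Partition)

/-- The idempotent that generates the representation induced from `V_μ ⊗ V_η`. -/
def indIdempotent : PermAlg n :=
  algMap (youngEmb h) (outer (schurIdempotent μ) (schurIdempotent η))

theorem indIdempotent_mul_self :
    indIdempotent h μ η * indIdempotent h μ η = indIdempotent h μ η := by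
  rw [indIdempotent, ← map_mul, outer_mul_outer, schurIdempotent_mul_self, schurIdempotent_mul_self]

/-- The left ideal generated by `indIdempotent`. -/
abbrev indIdeal : Ideal (PermAlg n) := Ideal.span {indIdempotent h μ η}

theorem isIdempotentGenerator_indIdeal :
    IsIdempotentGenerator (indIdeal h μ η) (indIdempotent h μ η) :=
  isIdempotentGenerator_span (indIdempotent_mul_self h μ η)

theorem algMap_outer_mem_indIdeal {v : PermAlg p} (hv : v ∈ spechtIdeal μ) {w : PermAlg q}
    (hw : w ∈ spechtIdeal η) : algMap (youngEmb h) (outer v w) ∈ indIdeal h μ η := by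
  rw [(isIdempotentGenerator_indIdeal h μ η).mem_iff, indIdempotent, ← map_mul, outer_mul_outer,
    (isIdempotentGenerator_spechtIdeal μ).mem_iff.1 hv,
    (isIdempotentGenerator_spechtIdeal η).mem_iff.1 hw]

/-- The outer product as a bilinear map into `indIdeal`; it induces the isomorphism of
`nonempty_indProd_iso`. -/
def outerIndIdeal : spechtIdeal μ →ₗ[ℚ] spechtIdeal η →ₗ[ℚ] indIdeal h μ η :=
  LinearMap.mk₂ ℚ (fun v w => ⟨algMap (youngEmb h) (outer (v : PermAlg p) (w : PermAlg q)),
      algMap_outer_mem_indIdeal h μ η v.2 w.2⟩)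
    (fun v v' w => Subtype.ext <| (congrArg (algMap (youngEmb h))
      (LinearMap.map_add₂ outer (v : PermAlg p) v' (w : PermAlg q))).trans (map_add _ _ _))
    (fun c v w => Subtype.ext <| (congrArg (algMap (youngEmb h))
      (LinearMap.map_smul₂ outer c (v : PermAlg p) (w : PermAlg q))).trans (map_smul _ _ _))
    (fun v w w' => Subtype.ext <| (congrArg (algMap (youngEmb h))
      (map_add (outer (v : PermAlg p)) (w : PermAlg q) w')).trans (map_add _ _ _))
    (fun c v w => Subtype.ext <| (congrArg (algMap (youngEmb h))
      (map_smul (outer (v : PermAlg p)) c (w : PermAlg q))).trans (map_smul _ _ _))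

theorem coe_outerIndIdeal (v : spechtIdeal μ) (w : spechtIdeal η) :
    (outerIndIdeal h μ η v w : PermAlg n) =
      algMap (youngEmb h) (outer (v : PermAlg p) (w : PermAlg q)) :=
  rfl

theorem outerIndIdeal_equivariant (a : Equiv.Perm (Fin p)) (b : Equiv.Perm (Fin q))
    (v : spechtIdeal μ) (w : spechtIdeal η) :
    outerIndIdeal h μ η (idealRep _ a v) (idealRep _ b w) =
      idealRep _ (youngEmb h (a, b)) (outerIndIdeal h μ η v w) := by
  refine Subtype.ext ?_
  change algMap (youngEmb h) (outer (MonoidAlgebra.single a 1 * (v : PermAlg p))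
    (MonoidAlgebra.single b 1 * (w : PermAlg q))) =
    MonoidAlgebra.single (youngEmb h (a, b)) 1 *
      algMap (youngEmb h) (outer (v : PermAlg p) (w : PermAlg q))
  rw [← outer_mul_outer, map_mul, outer_single, algMap_single, one_mul]

/-- The inverse of the map induced by the outer product sends `y` to `y • (e_μ ⊗ e_η)`. -/
theorem nonempty_indProd_iso :
    Nonempty (indProd h (specht μ) (specht η) ≅ idealObj (indIdeal h μ η)) := by
  obtain ⟨F, hF⟩ := exists_indProd_lift h (V := specht μ) (W := specht η)
    (T := idealObj (indIdeal h μ η)) (outerIndIdeal h μ η) (outerIndIdeal_equivariant h μ η)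
  let t : indProd h (specht μ) (specht η) := indι h (specht μ) (specht η)
    (isIdempotentGenerator_spechtIdeal μ).gen (isIdempotentGenerator_spechtIdeal η).gen
  have outer_smul_t (v : spechtIdeal μ) (w : spechtIdeal η) :
      algAct (indProd h (specht μ) (specht η))
        (algMap (youngEmb h) (outer (v : PermAlg p) (w : PermAlg q))) t =
        indι h (specht μ) (specht η) v w := by
    refine (algAct_indι h (specht μ) (specht η) _ _ _ _).trans ?_
    exact congrArg₂ (fun v w => indι h (specht μ) (specht η) v w)
      (algAct_gen (isIdempotentGenerator_spechtIdeal μ) v)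
      (algAct_gen (isIdempotentGenerator_spechtIdeal η) w)
  refine ⟨⟨F, orbitHom _ t, indProd_hom_ext h fun v w => ?_, idealHom_ext fun y => ?_⟩⟩
  · rw [repLin_comp, hF]
    exact outer_smul_t v w
  · rw [repLin_comp, repLin_orbitHom, repLin_algAct]
    refine (algAct_idealObj _ _ _).trans ?_
    rw [show repLin F t = outerIndIdeal h μ η _ _ from hF _ _, coe_outerIndIdeal]
    exact (isIdempotentGenerator_indIdeal h μ η).mem_iff.1 y.2

theorem lrCoeff_eq (π : n.Partition) :
    lrCoeff h μ η π = Module.finrank ℚ (corner ℚ (schurIdempotent π) (indIdempotent h μ η)) := by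
  obtain ⟨i⟩ := nonempty_indProd_iso h μ η
  refine ((Linear.homCongr ℚ (Iso.refl (specht π)) i).finrank_eq).trans ?_
  exact (idealHomEquiv (I := spechtIdeal π) (isIdempotentGenerator_spechtIdeal π)
    (isIdempotentGenerator_indIdeal h μ η)).finrank_eq

theorem finrank_corner_indIdempotent (π : n.Partition) :
    Module.finrank ℚ (corner ℚ (indIdempotent h μ η) (schurIdempotent π)) = lrCoeff h μ η π := by
  rw [lrCoeff_eq, finrank_corner_comm (schurIdempotent_mul_self π) (indIdempotent_mul_self h μ η)]

theorem nonempty_indProd_specht_iso :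
    Nonempty (indProd h (specht μ) (specht η) ≅
      ⨁ fun π : n.Partition => ⨁ fun _ : Fin (lrCoeff h μ η π) => specht π) := by
  obtain ⟨i⟩ := nonempty_indProd_iso h μ η
  obtain ⟨j⟩ := nonempty_idealObj_iso_biproduct_specht (isIdempotentGenerator_indIdeal h μ η)
    (finrank_corner_indIdempotent h μ η)
  exact ⟨i ≪≫ j⟩

end Induction

section TensorFamilies

variable {A : Type u} [Category.{v} A] [MonoidalCategory A]

/-- The tensor product of a family of morphisms. -/
def tensorFam {X Z : A} : ∀ {n : ℕ}, (Fin n → (X ⟶ Z)) → (tensorPow X n ⟶ tensorPow Z n)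
  | 0, _ => 𝟙 _
  | _ + 1, f => f 0 ⊗ₘ tensorFam fun i => f i.succ

theorem tensorFam_succ {X Z : A} {n : ℕ} (f : Fin (n + 1) → (X ⟶ Z)) :
    tensorFam f = f 0 ⊗ₘ tensorFam fun i => f i.succ := rfl

theorem tensorFam_comp {X Y Z : A} {n : ℕ} (f : Fin n → (X ⟶ Y)) (g : Fin n → (Y ⟶ Z)) :
    tensorFam f ≫ tensorFam g = tensorFam fun i => f i ≫ g i := by
  induction n with
  | zero => exact Category.comp_id _
  | succ n ih =>
    rw [tensorFam_succ, tensorFam_succ, tensorFam_succ, ← ih]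
    exact tensorHom_comp_tensorHom _ _ _ _

theorem tensorFam_id (X : A) (n : ℕ) : (tensorFam fun _ : Fin n => 𝟙 X) = 𝟙 (tensorPow X n) := by
  induction n with
  | zero => rfl
  | succ n ih =>
    rw [tensorFam_succ, ih]
    exact id_tensorHom_id _ _

/-- The isomorphism `Z^{⊗ p} ⊗ Z^{⊗ q} ≅ Z^{⊗ n}` for `p + q = n`. -/
def concatIso (Z : A) : ∀ {p q n : ℕ}, p + q = n → (tensorPow Z p ⊗ tensorPow Z q ≅ tensorPow Z n)
  | 0, _, _, h => λ_ _ ≪≫ eqToIso (congrArg (tensorPow Z) ((Nat.zero_add _).symm.trans h))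
  | p + 1, q, 0, h => absurd h (by omega)
  | p + 1, q, n + 1, h => α_ _ _ _ ≪≫ whiskerLeftIso Z (concatIso Z (show p + q = n by omega))

theorem concatIso_zero (Z : A) (q : ℕ) : concatIso Z (Nat.zero_add q) = λ_ _ := by
  rw [concatIso, eqToIso_refl]
  exact Iso.trans_refl _

theorem tensorHom_associator_whiskerLeft {X Z P Q N P' Q' N' : A} (f : X ⟶ Z) (a : P ⟶ P')
    (b : Q ⟶ Q') (m : N ⟶ N') (k : P ⊗ Q ⟶ N) (k' : P' ⊗ Q' ⟶ N')
    (h : (a ⊗ₘ b) ≫ k' = k ≫ m) :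
    ((f ⊗ₘ a) ⊗ₘ b) ≫ ((α_ Z P' Q').hom ≫ Z ◁ k') = ((α_ X P Q).hom ≫ X ◁ k) ≫ (f ⊗ₘ m) := by
  rw [associator_naturality_assoc, Category.assoc, ← id_tensorHom, ← id_tensorHom,
    tensorHom_comp_tensorHom, tensorHom_comp_tensorHom, h, Category.id_comp, Category.comp_id]

theorem blockR_zero_add {q : ℕ} (h : 0 + q = q) (i : Fin q) : blockR h i = i :=
  Fin.ext (Nat.zero_add i)

theorem blockR_succ_add {p q n : ℕ} (h : p + q = n) (h' : p + 1 + q = n + 1) (i : Fin q) :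
    blockR h' i = (blockR h i).succ :=
  Fin.ext (Nat.succ_add p i)

theorem tensorFam_concatIso {X Z : A} {p q n : ℕ} (h : p + q = n) (f : Fin n → (X ⟶ Z)) :
    (tensorFam (fun i => f (blockL h i)) ⊗ₘ tensorFam fun i => f (blockR h i)) ≫
      (concatIso Z h).hom = (concatIso X h).hom ≫ tensorFam f := by
  induction p generalizing n with
  | zero =>
    obtain rfl : q = n := by omega
    simp only [blockR_zero_add]
    rw [concatIso_zero, concatIso_zero]
    exact (congrArg (· ≫ _) (id_tensorHom _ _)).trans (leftUnitor_naturality (tensorFam f))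
  | succ p ih =>
    obtain ⟨n, rfl⟩ : ∃ m, n = m + 1 := ⟨n - 1, by omega⟩
    have h' : p + q = n := by omega
    simp only [blockR_succ_add h' h]
    exact tensorHom_associator_whiskerLeft (f 0) _ _ _ _ _ (ih h' fun i => f i.succ)

variable [SymmetricCategory A]

theorem tensorPowAction_mul (X : A) {n : ℕ} (σ τ : Equiv.Perm (Fin n)) :
    tensorPowAction X n (σ * τ) = tensorPowAction X n τ ≫ tensorPowAction X n σ :=
  map_mul _ _ _

theorem towerAct_permLift {M : ℕ → Type*} [∀ n, Monoid (M n)] (L : ∀ n, M n →* M (n + 1))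
    (t : ∀ n, M (n + 2)) (n : ℕ) (τ : Equiv.Perm (Fin n)) :
    towerAct L t (n + 1) (permLift n τ) = L n (towerAct L t n τ) := by
  have cycle_mul := towerAct_cycle_mul_lift L t n 0 τ
  rwa [towerCycle_zero, towerCycle_zero, one_mul, one_mul] at cycle_mul

theorem tensorPowAction_permLift (X : A) {n : ℕ} (τ : Equiv.Perm (Fin n)) :
    tensorPowAction X (n + 1) (permLift n τ) = X ◁ tensorPowAction X n τ :=
  towerAct_permLift (M := fun n => End (tensorPow X n))
    (fun n => whiskerLeftEnd X (tensorPow X n)) (fun n => swapFirst X (tensorPow X n)) n τ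

theorem tensorPowAction_swap (X : A) (n : ℕ) :
    tensorPowAction X (n + 2) (Equiv.swap 0 1) = swapFirst X (tensorPow X n) :=
  towerHom_swap (M := fun n => End (tensorPow X n)) (fun n => whiskerLeftEnd X (tensorPow X n))
    (fun n => swapFirst X (tensorPow X n)) (fun n => swapFirst_sq X (tensorPow X n))
    (fun _ f => swapFirst_natural X f) (fun n => swapFirst_braid X (tensorPow X n)) (n + 2) 0

theorem perm_induction {P : ∀ n, Equiv.Perm (Fin n) → Prop} (one : ∀ n, P n 1)
    (mul : ∀ n σ τ, P n σ → P n τ → P n (σ * τ)) (swap : ∀ n, P (n + 2) (Equiv.swap 0 1))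
    (lift : ∀ n σ, P n σ → P (n + 1) (permLift n σ)) (n : ℕ) (σ : Equiv.Perm (Fin n)) :
    P n σ := by
  have adjacent (n i) : P n (towerSwap permLift (fun _ => Equiv.swap 0 1) n i) := by
    induction n generalizing i with
    | zero => exact one 0
    | succ n ih =>
      cases i with
      | zero =>
        cases n with
        | zero => exact one 1
        | succ n => exact swap n
      | succ i =>
        rw [towerSwap_succ]
        exact lift _ _ (ih i)
  have mem_closure : σ ∈ Submonoid.closure
      (Set.range (towerSwap permLift (fun _ => Equiv.swap 0 1) n)) :=
    permSwap_closure n ▸ Submonoid.mem_top σ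
  induction mem_closure using Submonoid.closure_induction with
  | mem x hx =>
    obtain ⟨i, rfl⟩ := hx
    exact adjacent n i
  | one => exact one n
  | mul x y _ _ hx hy => exact mul n x y hx hy

theorem swapFirst_comp {X Z P Q : A} (f g : X ⟶ Z) (k : P ⟶ Q) :
    swapFirst X P ≫ (f ⊗ₘ (g ⊗ₘ k)) = (g ⊗ₘ (f ⊗ₘ k)) ≫ swapFirst Z Q := by
  have braid : (β_ X X).hom ▷ P ≫ ((f ⊗ₘ g) ⊗ₘ k) = ((g ⊗ₘ f) ⊗ₘ k) ≫ (β_ Z Z).hom ▷ Q := by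
    rw [← tensorHom_id, ← tensorHom_id, tensorHom_comp_tensorHom, tensorHom_comp_tensorHom,
      BraidedCategory.braiding_naturality, Category.id_comp, Category.comp_id]
  rw [swapFirst, swapFirst, Category.assoc, Category.assoc, ← associator_naturality,
    reassoc_of% braid, associator_inv_naturality_assoc]

theorem tensorPowAction_comp_tensorFam {X Z : A} {n : ℕ} (σ : Equiv.Perm (Fin n))
    (f : Fin n → (X ⟶ Z)) :
    tensorPowAction X n σ ≫ tensorFam f =
      (tensorFam fun i => f (σ i)) ≫ tensorPowAction Z n σ := by
  induction n, σ using perm_induction with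
  | one n =>
    rw [map_one, map_one]
    exact (Category.id_comp _).trans (Category.comp_id _).symm
  | mul n σ τ hσ hτ =>
    rw [tensorPowAction_mul, tensorPowAction_mul, Category.assoc, hσ, ← Category.assoc, hτ,
      Category.assoc]
    rfl
  | swap n =>
    rw [tensorPowAction_swap, tensorPowAction_swap, tensorFam_succ, tensorFam_succ, tensorFam_succ,
      tensorFam_succ]
    refine (swapFirst_comp _ _ _).trans ?_
    have swap_succ_succ (i : Fin n) :
        Equiv.swap (0 : Fin (n + 2)) 1 i.succ.succ = i.succ.succ :=
      Equiv.swap_apply_of_ne_of_ne (Fin.succ_ne_zero _) fun h =>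
        Fin.succ_ne_zero i (Fin.succ_injective _ h)
    simp only [swap_succ_succ, Equiv.swap_apply_left]
    rw [show Equiv.swap (0 : Fin (n + 2)) 1 (Fin.succ 0) = 0 from Equiv.swap_apply_right _ _]
    rfl
  | lift n σ hσ =>
    rw [tensorPowAction_permLift, tensorPowAction_permLift, tensorFam_succ, tensorFam_succ]
    simp only [permLift_zero, permLift_succ]
    rw [← id_tensorHom, ← id_tensorHom]
    refine (tensorHom_comp_tensorHom _ _ _ _).trans ((?_ : _ = _).trans
      (tensorHom_comp_tensorHom _ _ _ _).symm)
    rw [Category.id_comp, Category.comp_id, hσ]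

theorem swapFirst_associator_whiskerLeft (Z : A) {P Q N : A} (k : P ⊗ Q ⟶ N) :
    (swapFirst Z P ⊗ₘ 𝟙 Q) ≫ ((α_ Z (Z ⊗ P) Q).hom ≫ Z ◁ ((α_ Z P Q).hom ≫ Z ◁ k)) =
      ((α_ Z (Z ⊗ P) Q).hom ≫ Z ◁ ((α_ Z P Q).hom ≫ Z ◁ k)) ≫ swapFirst Z N := by
  rw [MonoidalCategory.whiskerLeft_comp, Category.assoc, Category.assoc, swapFirst_natural,
    tensorHom_id]
  simp only [← Category.assoc]
  congr 1
  simp [swapFirst]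

theorem youngEmb_permLift {p q n : ℕ} (h : p + q = n) (h' : p + 1 + q = n + 1)
    (a : Equiv.Perm (Fin p)) (b : Equiv.Perm (Fin q)) :
    youngEmb h' (permLift p a, b) = permLift n (youngEmb h (a, b)) := by
  have blockL_succ (i) : blockL h' (Fin.succ i) = (blockL h i).succ := rfl
  ext1 x
  rcases block_cases h' x with ⟨y, rfl⟩ | ⟨z, rfl⟩
  · rw [youngEmb_blockL]
    induction y using Fin.cases with
    | zero => rfl
    | succ y => rw [permLift_succ, blockL_succ, blockL_succ, permLift_succ, youngEmb_blockL]
  · rw [youngEmb_blockR, blockR_succ_add h h', blockR_succ_add h h', permLift_succ, youngEmb_blockR]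

theorem youngEmb_swap {p q n : ℕ} (h : p + 2 + q = n + 2) :
    youngEmb h (Equiv.swap 0 1, 1) = Equiv.swap 0 1 := by
  have blockL_injective : Function.Injective (blockL h) := fun x y hxy => by
    have val_eq := congrArg Fin.val hxy
    exact Fin.ext val_eq
  ext1 x
  rcases block_cases h x with ⟨y, rfl⟩ | ⟨z, rfl⟩
  · rw [youngEmb_blockL, ← blockL_injective.swap_apply]
    rfl
  · rw [youngEmb_blockR, Equiv.Perm.one_apply, Equiv.swap_apply_of_ne_of_ne]
    · intro eq_zero
      have := congrArg Fin.val eq_zero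
      simp [blockR] at this
    · intro eq_one
      have := congrArg Fin.val eq_one
      simp [blockR] at this
      omega

theorem id_tensorHom_concatIso (Z : A) {p q n : ℕ} (h : p + q = n) (b : Equiv.Perm (Fin q)) :
    (𝟙 (tensorPow Z p) ⊗ₘ tensorPowAction Z q b) ≫ (concatIso Z h).hom =
      (concatIso Z h).hom ≫ tensorPowAction Z n (youngEmb h (1, b)) := by
  induction p generalizing n with
  | zero =>
    obtain rfl : q = n := by omega
    rw [youngEmb_zero, concatIso_zero]
    exact (congrArg (· ≫ _) (id_tensorHom _ _)).trans
      (leftUnitor_naturality (tensorPowAction Z q b))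
  | succ p ih =>
    obtain ⟨n, rfl⟩ : ∃ m, n = m + 1 := ⟨n - 1, by omega⟩
    have h' : p + q = n := by omega
    have step := tensorHom_associator_whiskerLeft (𝟙 Z) _ _ _ _ _ (ih h')
    rw [id_tensorHom_id, id_tensorHom Z (tensorPowAction Z n (youngEmb h' (1, b)))] at step
    rw [← map_one (permLift p), youngEmb_permLift h' h, tensorPowAction_permLift]
    exact step

theorem tensorHom_id_concatIso (Z : A) {p q n : ℕ} (h : p + q = n) (a : Equiv.Perm (Fin p)) :
    (tensorPowAction Z p a ⊗ₘ 𝟙 (tensorPow Z q)) ≫ (concatIso Z h).hom =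
      (concatIso Z h).hom ≫ tensorPowAction Z n (youngEmb h (a, 1)) := by
  induction p, a using perm_induction generalizing n with
  | one p =>
    rw [← Prod.one_eq_mk, map_one, map_one, map_one]
    exact (congrArg (· ≫ _) (id_tensorHom_id _ _)).trans
      ((Category.id_comp _).trans (Category.comp_id _).symm)
  | mul p σ τ hσ hτ =>
    have prod_eq : ((σ * τ, 1) : Equiv.Perm (Fin p) × Equiv.Perm (Fin q)) = (σ, 1) * (τ, 1) := by
      rw [Prod.mk_mul_mk, one_mul]
    rw [prod_eq, map_mul (youngEmb h), tensorPowAction_mul, tensorPowAction_mul,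
      ← Category.comp_id (𝟙 (tensorPow Z q)), ← tensorHom_comp_tensorHom, Category.assoc, hσ,
      reassoc_of% (hτ h)]
  | swap p =>
    obtain ⟨n, rfl⟩ : ∃ m, n = m + 2 := ⟨n - 2, by omega⟩
    rw [youngEmb_swap, tensorPowAction_swap, tensorPowAction_swap]
    exact swapFirst_associator_whiskerLeft Z (concatIso Z (show p + q = n by omega)).hom
  | lift p σ hσ =>
    obtain ⟨n, rfl⟩ : ∃ m, n = m + 1 := ⟨n - 1, by omega⟩
    have h' : p + q = n := by omega
    have step := tensorHom_associator_whiskerLeft (𝟙 Z) _ _ _ _ _ (hσ h')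
    rw [id_tensorHom, id_tensorHom] at step
    rw [youngEmb_permLift h' h, tensorPowAction_permLift, tensorPowAction_permLift]
    exact step

theorem tensorHom_concatIso (Z : A) {p q n : ℕ} (h : p + q = n) (a : Equiv.Perm (Fin p))
    (b : Equiv.Perm (Fin q)) :
    (tensorPowAction Z p a ⊗ₘ tensorPowAction Z q b) ≫ (concatIso Z h).hom =
      (concatIso Z h).hom ≫ tensorPowAction Z n (youngEmb h (a, b)) := by
  have prod_eq : ((a, b) : Equiv.Perm (Fin p) × Equiv.Perm (Fin q)) = (1, b) * (a, 1) := by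
    rw [Prod.mk_mul_mk, one_mul, mul_one]
  have tensor_eq : tensorPowAction Z p a ⊗ₘ tensorPowAction Z q b =
      (tensorPowAction Z p a ⊗ₘ 𝟙 _) ≫ (𝟙 _ ⊗ₘ tensorPowAction Z q b) := by
    rw [tensorHom_comp_tensorHom, Category.comp_id, Category.id_comp]
  rw [prod_eq, map_mul (youngEmb h), tensorPowAction_mul, tensor_eq, Category.assoc,
    id_tensorHom_concatIso, ← Category.assoc, tensorHom_id_concatIso, Category.assoc]

end TensorFamilies

section Blocks

variable {p q n : ℕ} (h : p + q = n)

theorem mem_range_youngEmb (g : Equiv.Perm (Fin n)) (hg : ∀ i, (g i : ℕ) < p ↔ (i : ℕ) < p) :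
    g ∈ Set.range (youngEmb h) := by
  let e : Fin p ⊕ Fin q ≃ Fin n := finSumFinEquiv.trans (finCongr h)
  have e_inl (i) : e (Sum.inl i) = blockL h i := by ext; simp [e, blockL]
  have e_inr (i) : e (Sum.inr i) = blockR h i := by ext; simp [e, blockR]
  let τ : Equiv.Perm (Fin p ⊕ Fin q) := e.symm.permCongr g
  have e_τ (x) : e (τ x) = g (e x) := by simp [τ, Equiv.permCongr_apply]
  have τ_mem : τ ∈ (Equiv.Perm.sumCongrHom (Fin p) (Fin q)).range := by
    refine Equiv.Perm.mem_sumCongrHom_range_of_perm_mapsTo_inl ?_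
    rintro _ ⟨i, rfl⟩
    have lt_p : (g (blockL h i) : ℕ) < p := (hg _).2 i.2
    rw [← e_inl, ← e_τ] at lt_p
    rcases τ_inl : τ (Sum.inl i) with j | j
    · exact ⟨j, rfl⟩
    · rw [τ_inl, e_inr] at lt_p
      simp [blockR] at lt_p
  obtain ⟨ab, hab⟩ := τ_mem
  refine ⟨ab, Equiv.ext fun x => ?_⟩
  change e (Equiv.Perm.sumCongrHom _ _ ab (e.symm x)) = g x
  rw [hab, e_τ, Equiv.apply_symm_apply]

/-- The word whose first `p` letters are `true` and whose other letters are `false`. -/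
def blockWord (p n : ℕ) (i : Fin n) : Bool := decide ((i : ℕ) < p)

theorem exists_blockWord (w : Fin n → Bool) :
    ∃ (p q : ℕ) (_ : p + q = n) (g : Equiv.Perm (Fin n)), ∀ i, w i = blockWord p n (g i) := by
  classical
  let p := (Finset.univ.filter fun i => w i = true).card
  have p_le : p ≤ n := (Finset.card_le_univ _).trans (Fintype.card_fin n).le
  have card_eq : Fintype.card {i // w i = true} = Fintype.card {i : Fin n // (i : ℕ) < p} := by
    rw [Fintype.card_subtype, Fintype.card_subtype, Fin.card_filter_val_lt, min_eq_right p_le]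
  let e := Fintype.equivOfCardEq card_eq
  refine ⟨p, n - p, by omega, e.extendSubtype, fun i => ?_⟩
  by_cases hi : w i = true
  · rw [hi, blockWord]
    exact (decide_eq_true (e.extendSubtype_mem i hi)).symm
  · rw [Bool.eq_false_of_not_eq_true hi, blockWord]
    exact (decide_eq_false (e.extendSubtype_not_mem i hi)).symm

theorem eq_of_blockWord {p' : ℕ} (hp : p ≤ n) (hp' : p' ≤ n) (g : Equiv.Perm (Fin n))
    (hg : ∀ i, blockWord p n i = blockWord p' n (g i)) : p = p' := by
  have lt_iff (i : Fin n) : (i : ℕ) < p ↔ (g i : ℕ) < p' := by simpa [blockWord] using hg i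
  have card_eq : Fintype.card {i : Fin n // (i : ℕ) < p} =
      Fintype.card {i : Fin n // (i : ℕ) < p'} :=
    Fintype.card_congr (g.subtypeEquiv lt_iff)
  rwa [Fintype.card_subtype, Fintype.card_subtype, Fin.card_filter_val_lt, Fin.card_filter_val_lt,
    min_eq_right hp, min_eq_right hp'] at card_eq

end Blocks

section TensorFamilies

variable {A : Type u} [Category.{v} A] [Preadditive A] [MonoidalCategory A] [MonoidalPreadditive A]

theorem tensorFam_eq_zero {X Z : A} {n : ℕ} {f : Fin n → (X ⟶ Z)} {i : Fin n} (hi : f i = 0) :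
    tensorFam f = 0 := by
  induction n with
  | zero => exact i.elim0
  | succ n ih =>
    rw [tensorFam_succ]
    induction i using Fin.cases with
    | zero =>
      rw [hi]
      exact MonoidalPreadditive.zero_tensor _
    | succ i =>
      rw [ih hi]
      exact MonoidalPreadditive.tensor_zero _

theorem sum_tensorFam {X Z : A} (f : Bool → (X ⟶ Z)) (n : ℕ) :
    ∑ w : Fin n → Bool, tensorFam (fun i => f (w i)) = tensorFam fun _ : Fin n => ∑ b, f b := by
  induction n with
  | zero =>
    rw [Fintype.sum_unique]
    rfl
  | succ n ih =>
    rw [tensorFam_succ, ← ih, ← (Fin.consEquiv fun _ => Bool).sum_comp, Fintype.sum_prod_type]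
    refine Eq.trans ?_ (sum_tensor _ _ _).symm
    refine Finset.sum_congr rfl fun b _ => Eq.trans ?_ (tensor_sum _ _ _).symm
    rfl

end TensorFamilies

section PowersOfSums

variable {A : Type u} [Category.{v} A] [Preadditive A] [HasFiniteBiproducts A] (X Y : A)

/-- The idempotent of `X ⊕ Y` with image `X`, for the letter `true`, or `Y`, for `false`. -/
def summand : Bool → (X ⊞ Y ⟶ X ⊞ Y)
  | true => biprod.fst ≫ biprod.inl
  | false => biprod.snd ≫ biprod.inr

theorem summand_comp_of_ne {b c : Bool} (h : b ≠ c) : summand X Y b ≫ summand X Y c = 0 := by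
  cases b <;> cases c <;> simp_all [summand]

theorem sum_summand : ∑ b, summand X Y b = 𝟙 (X ⊞ Y) := by
  rw [Fintype.sum_bool]
  exact biprod.total

variable [MonoidalCategory A] {p q n : ℕ} (h : p + q = n)

/-- The inclusion of `X^{⊗ p} ⊗ Y^{⊗ q}` into `(X ⊕ Y)^{⊗ n}`. -/
def blockIncl : tensorPow X p ⊗ tensorPow Y q ⟶ tensorPow (X ⊞ Y) n :=
  (tensorFam (fun _ => biprod.inl) ⊗ₘ tensorFam fun _ => biprod.inr) ≫ (concatIso (X ⊞ Y) h).hom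

/-- The projection of `(X ⊕ Y)^{⊗ n}` to `X^{⊗ p} ⊗ Y^{⊗ q}`. -/
def blockProj : tensorPow (X ⊞ Y) n ⟶ tensorPow X p ⊗ tensorPow Y q :=
  (concatIso (X ⊞ Y) h).inv ≫ (tensorFam (fun _ => biprod.fst) ⊗ₘ tensorFam fun _ => biprod.snd)

theorem blockIncl_blockProj : blockIncl X Y h ≫ blockProj X Y h = 𝟙 _ := by
  rw [blockIncl, blockProj, Category.assoc, Iso.hom_inv_id_assoc, tensorHom_comp_tensorHom,
    tensorFam_comp, tensorFam_comp]
  simp only [biprod.inl_fst, biprod.inr_snd, tensorFam_id, id_tensorHom_id]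

/-- The idempotent of `(X ⊕ Y)^{⊗ n}` whose image is the tensor product of the letters of `w`. -/
def wordIdem (w : Fin n → Bool) : tensorPow (X ⊞ Y) n ⟶ tensorPow (X ⊞ Y) n :=
  tensorFam fun i => summand X Y (w i)

theorem blockProj_blockIncl :
    blockProj X Y h ≫ blockIncl X Y h = wordIdem X Y (blockWord p n) := by
  rw [blockIncl, blockProj, Category.assoc, reassoc_of% (tensorHom_comp_tensorHom
    (tensorFam (n := p) fun _ => (biprod.fst : X ⊞ Y ⟶ X))
    (tensorFam (n := q) fun _ => (biprod.snd : X ⊞ Y ⟶ Y))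
    (tensorFam (n := p) fun _ => biprod.inl) (tensorFam (n := q) fun _ => biprod.inr)),
    tensorFam_comp, tensorFam_comp, Iso.inv_comp_eq, wordIdem, ← tensorFam_concatIso h]
  have blockWord_blockL (i) : blockWord p n (blockL h i) = true := by simp [blockWord, blockL]
  have blockWord_blockR (i) : blockWord p n (blockR h i) = false := by simp [blockWord, blockR]
  simp only [blockWord_blockL, blockWord_blockR]
  rfl

theorem wordIdem_comp_of_ne [MonoidalPreadditive A] {w w' : Fin n → Bool} (hw : w ≠ w') :
    wordIdem X Y w ≫ wordIdem X Y w' = 0 := by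
  obtain ⟨i, hi⟩ := Function.ne_iff.1 hw
  rw [wordIdem, wordIdem, tensorFam_comp]
  exact tensorFam_eq_zero (summand_comp_of_ne X Y hi)

theorem sum_wordIdem [MonoidalPreadditive A] :
    ∑ w : Fin n → Bool, wordIdem X Y w = 𝟙 (tensorPow (X ⊞ Y) n) := by
  simp only [wordIdem]
  rw [sum_tensorFam, sum_summand, tensorFam_id]

variable [SymmetricCategory A]

theorem action_wordIdem (g : Equiv.Perm (Fin n)) (w : Fin n → Bool) :
    tensorPowAction (X ⊞ Y) n g ≫ wordIdem X Y w =
      wordIdem X Y (w ∘ g) ≫ tensorPowAction (X ⊞ Y) n g :=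
  tensorPowAction_comp_tensorFam g fun i => summand X Y (w i)

theorem action_blockIncl (a : Equiv.Perm (Fin p)) (b : Equiv.Perm (Fin q)) :
    (tensorPowAction X p a ⊗ₘ tensorPowAction Y q b) ≫ blockIncl X Y h =
      blockIncl X Y h ≫ tensorPowAction (X ⊞ Y) n (youngEmb h (a, b)) := by
  rw [blockIncl, Category.assoc, ← tensorHom_concatIso, ← Category.assoc, ← Category.assoc,
    tensorHom_comp_tensorHom, tensorHom_comp_tensorHom, tensorPowAction_comp_tensorFam,
    tensorPowAction_comp_tensorFam]

theorem action_blockProj (a : Equiv.Perm (Fin p)) (b : Equiv.Perm (Fin q)) :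
    tensorPowAction (X ⊞ Y) n (youngEmb h (a, b)) ≫ blockProj X Y h =
      blockProj X Y h ≫ (tensorPowAction X p a ⊗ₘ tensorPowAction Y q b) := by
  have action_concatIso_inv :
      tensorPowAction (X ⊞ Y) n (youngEmb h (a, b)) ≫ (concatIso (X ⊞ Y) h).inv =
        (concatIso (X ⊞ Y) h).inv ≫
          (tensorPowAction (X ⊞ Y) p a ⊗ₘ tensorPowAction (X ⊞ Y) q b) := by
    rw [Iso.comp_inv_eq, Category.assoc, tensorHom_concatIso, Iso.inv_hom_id_assoc]
  rw [blockProj, reassoc_of% action_concatIso_inv, Category.assoc, tensorHom_comp_tensorHom,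
    tensorHom_comp_tensorHom, tensorPowAction_comp_tensorFam, tensorPowAction_comp_tensorFam]

variable [MonoidalPreadditive A]

theorem blockIncl_action_blockProj_eq_zero {p' q' : ℕ} (h' : p' + q' = n)
    (g : Equiv.Perm (Fin n)) (hg : blockWord p n ≠ blockWord p' n ∘ g) :
    blockIncl X Y h ≫ tensorPowAction (X ⊞ Y) n g ≫ blockProj X Y h' = 0 := by
  rw [← Category.id_comp (blockIncl X Y h), ← Category.comp_id (blockProj X Y h'),
    ← blockIncl_blockProj X Y h, ← blockIncl_blockProj X Y h', Category.assoc, Category.assoc,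
    reassoc_of% (blockProj_blockIncl X Y h), reassoc_of% (blockProj_blockIncl X Y h'),
    reassoc_of% (action_wordIdem X Y g (blockWord p' n)),
    reassoc_of% (wordIdem_comp_of_ne X Y hg), zero_comp, comp_zero]

theorem blockIncl_action_blockProj_of_ne {p' q' : ℕ} (h' : p' + q' = n) (hp : p ≠ p')
    (g : Equiv.Perm (Fin n)) :
    blockIncl X Y h ≫ tensorPowAction (X ⊞ Y) n g ≫ blockProj X Y h' = 0 :=
  blockIncl_action_blockProj_eq_zero X Y h h' g fun hg =>
    hp (eq_of_blockWord (Nat.le.intro h) (Nat.le.intro h') g (congrFun hg))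

theorem blockIncl_action_blockProj_of_notMem (g : Equiv.Perm (Fin n))
    (hg : g ∉ Set.range (youngEmb h)) :
    blockIncl X Y h ≫ tensorPowAction (X ⊞ Y) n g ≫ blockProj X Y h = 0 :=
  blockIncl_action_blockProj_eq_zero X Y h h g fun word_eq => hg (mem_range_youngEmb h g fun i => by
    have letter_eq := congrFun word_eq i
    simp only [blockWord, Function.comp_apply, decide_eq_decide] at letter_eq
    exact letter_eq.symm)

theorem eq_zero_of_blockProj {S : A} (f : S ⟶ tensorPow (X ⊞ Y) n)
    (hf : ∀ (p q : ℕ) (h : p + q = n) (g : Equiv.Perm (Fin n)),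
      f ≫ tensorPowAction (X ⊞ Y) n g ≫ blockProj X Y h = 0) : f = 0 := by
  rw [← Category.comp_id f, ← sum_wordIdem, Preadditive.comp_sum]
  refine Finset.sum_eq_zero fun w _ => ?_
  obtain ⟨p, q, h, g, hg⟩ := exists_blockWord w
  obtain rfl : w = blockWord p n ∘ g := funext hg
  have action_inv : tensorPowAction (X ⊞ Y) n g ≫ tensorPowAction (X ⊞ Y) n g⁻¹ = 𝟙 _ := by
    rw [← tensorPowAction_mul, inv_mul_cancel, map_one]
    rfl
  rw [← Category.comp_id (wordIdem X Y _), ← action_inv, ← Category.assoc (wordIdem X Y _),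
    ← action_wordIdem, ← blockProj_blockIncl X Y h, Category.assoc, Category.assoc,
    reassoc_of% (hf p q h g), zero_comp]

end PowersOfSums

section LittlewoodRichardson

theorem exists_lrFamily {p q n : ℕ} (h : p + q = n) (π : n.Partition) :
    ∃ v w : (Σ i : p.Partition × q.Partition, Fin (lrCoeff h i.1 i.2 π)) → PermAlg n,
      IsRestrictionFamily (youngEmb h) (youngEmb_injective h)
        (fun i => outer (schurIdempotent i.1) (schurIdempotent i.2)) (schurIdempotent π) v w := by
  let b (i : p.Partition × q.Partition) :=
    Module.finBasisOfFinrankEq ℚ _ (lrCoeff_eq h i.1 i.2 π).symm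
  obtain ⟨v, hv⟩ := ((isCompleteSystem_schurIdempotent p).prod
    (isCompleteSystem_schurIdempotent q)).exists_isRestrictionFamily (youngEmb h)
      (youngEmb_injective h) b (schurIdempotent_mul_self π)
  exact ⟨v, _, hv⟩

end LittlewoodRichardson

open Finset.HasAntidiagonal

theorem antidiagonal_fst_add_snd {n : ℕ} (d : antidiagonal n) : d.1.1 + d.1.2 = n :=
  mem_antidiagonal.mp d.2

section GroupAlgebraActions

theorem algHom_comp_eq_comp_algHom {A : Type u} [Category.{v} A] [Preadditive A] {k G : Type*}
    [CommRing k] [Linear k A] [Monoid G] {M N : A} (Φ : MonoidAlgebra k G →ₐ[k] End M)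
    (Ψ : MonoidAlgebra k G →ₐ[k] End N) (f : M ⟶ N)
    (hf : ∀ g, Φ (MonoidAlgebra.single g 1) ≫ f = f ≫ Ψ (MonoidAlgebra.single g 1))
    (x : MonoidAlgebra k G) : Φ x ≫ f = f ≫ Ψ x := by
  have linear_maps_eq : (Linear.rightComp k M f).comp Φ.toLinearMap =
      (Linear.leftComp k N f).comp Ψ.toLinearMap :=
    MonoidAlgebra.lhom_ext' fun g => LinearMap.ext_ring (hf g)
  exact LinearMap.congr_fun linear_maps_eq x

variable {A : Type u} [Category.{v} A] [Preadditive A] [Linear ℚ A] [MonoidalCategory A]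
  [SymmetricCategory A]

/-- The action of the group algebra of `Σ_n` on `X^{⊗ n}`. Multiplication in `End` is composition in
the order of functions, so that `x * y` acts by `y` followed by `x`. -/
abbrev powAct (X : A) (n : ℕ) : PermAlg n →ₐ[ℚ] End (tensorPow X n) :=
  permAlgAction (tensorPowAction X n)

theorem powAct_single (X : A) {n : ℕ} (g : Equiv.Perm (Fin n)) (r : ℚ) :
    powAct X n (MonoidAlgebra.single g r) = r • tensorPowAction X n g :=
  MonoidAlgebra.lift_single _ _ _

theorem powAct_mul (X : A) {n : ℕ} (x y : PermAlg n) :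
    powAct X n (x * y) = powAct X n y ≫ powAct X n x := map_mul _ _ _

theorem powAct_comp_tensorFam {X Z : A} {n : ℕ} (x : PermAlg n) (f : X ⟶ Z) :
    powAct X n x ≫ (tensorFam fun _ => f) = (tensorFam fun _ => f) ≫ powAct Z n x :=
  algHom_comp_eq_comp_algHom _ _ _ (fun g => by
    rw [powAct_single, powAct_single, one_smul, one_smul, tensorPowAction_comp_tensorFam]) x

variable (X Y : A) {p q n : ℕ}

/-- The action of the group algebra of `Σ_p × Σ_q` on `X^{⊗ p} ⊗ Y^{⊗ q}`. -/
def blockAct (p q : ℕ) : MonoidAlgebra ℚ (Equiv.Perm (Fin p) × Equiv.Perm (Fin q)) →ₐ[ℚ]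
    End (tensorPow X p ⊗ tensorPow Y q) :=
  MonoidAlgebra.lift ℚ (End (tensorPow X p ⊗ tensorPow Y q)) _
    { toFun := fun g => tensorPowAction X p g.1 ⊗ₘ tensorPowAction Y q g.2
      map_one' := by
        rw [Prod.fst_one, Prod.snd_one, map_one, map_one]
        exact id_tensorHom_id _ _
      map_mul' := fun g g' => by
        rw [Prod.fst_mul, Prod.snd_mul, tensorPowAction_mul, tensorPowAction_mul,
          ← tensorHom_comp_tensorHom]
        rfl }

theorem blockAct_single (a : Equiv.Perm (Fin p)) (b : Equiv.Perm (Fin q)) (r : ℚ) :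
    blockAct X Y p q (MonoidAlgebra.single (a, b) r) =
      r • (tensorPowAction X p a ⊗ₘ tensorPowAction Y q b) :=
  MonoidAlgebra.lift_single _ _ _

theorem blockAct_outer [MonoidalPreadditive A] [MonoidalLinear ℚ A] (x : PermAlg p)
    (y : PermAlg q) : blockAct X Y p q (outer x y) = powAct X p x ⊗ₘ powAct Y q y := by
  induction x using MonoidAlgebra.induction_linear with
  | zero =>
    rw [LinearMap.map_zero₂, map_zero, map_zero]
    exact (MonoidalPreadditive.zero_tensor _).symm
  | add a b ha hb =>
    rw [LinearMap.map_add₂, map_add, map_add, ha, hb]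
    exact (MonoidalPreadditive.add_tensor _ _ _).symm
  | single g r =>
    induction y using MonoidAlgebra.induction_linear with
    | zero =>
      rw [map_zero, map_zero, map_zero]
      exact (MonoidalPreadditive.tensor_zero _).symm
    | add a b ha hb =>
      rw [map_add, map_add, ha, hb, map_add]
      exact (MonoidalPreadditive.tensor_add _ _ _).symm
    | single g' s =>
      rw [outer_single, blockAct_single, powAct_single, powAct_single,
        MonoidalCategory.tensorHom_def, MonoidalCategory.tensorHom_def]
      erw [MonoidalLinear.smul_whiskerRight, MonoidalLinear.whiskerLeft_smul]
      rw [Linear.smul_comp, Linear.comp_smul, smul_smul]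

variable [HasFiniteBiproducts A] (h : p + q = n)

theorem blockAct_blockIncl (y : MonoidAlgebra ℚ (Equiv.Perm (Fin p) × Equiv.Perm (Fin q))) :
    blockAct X Y p q y ≫ blockIncl X Y h =
      blockIncl X Y h ≫ powAct (X ⊞ Y) n (algMap (youngEmb h) y) :=
  algHom_comp_eq_comp_algHom _ ((powAct (X ⊞ Y) n).comp (algMap (youngEmb h))) _ (fun g => by
    rw [AlgHom.comp_apply, algMap_single, powAct_single, ← Prod.mk.eta (p := g), blockAct_single,
      one_smul, one_smul, action_blockIncl]) y

theorem powAct_blockProj (y : MonoidAlgebra ℚ (Equiv.Perm (Fin p) × Equiv.Perm (Fin q))) :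
    powAct (X ⊞ Y) n (algMap (youngEmb h) y) ≫ blockProj X Y h =
      blockProj X Y h ≫ blockAct X Y p q y :=
  algHom_comp_eq_comp_algHom ((powAct (X ⊞ Y) n).comp (algMap (youngEmb h))) _ _ (fun g => by
    rw [AlgHom.comp_apply, algMap_single, powAct_single, ← Prod.mk.eta (p := g), blockAct_single,
      one_smul, one_smul, action_blockProj]) y

variable [MonoidalPreadditive A]

theorem blockIncl_powAct_blockProj (x : PermAlg n) :
    blockIncl X Y h ≫ powAct (X ⊞ Y) n x ≫ blockProj X Y h =
      blockAct X Y p q (restrictCoeff (youngEmb h) (youngEmb_injective h) x) := by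
  induction x using MonoidAlgebra.induction_linear with
  | zero =>
    rw [map_zero, map_zero, map_zero]
    exact (congrArg _ zero_comp).trans comp_zero
  | add a b ha hb =>
    rw [map_add, map_add, map_add, ← ha, ← hb, ← Preadditive.comp_add]
    exact congrArg _ (Preadditive.add_comp _ _ _ _ _ _)
  | single g r =>
    rw [powAct_single, Linear.smul_comp, Linear.comp_smul]
    by_cases hg : g ∈ Set.range (youngEmb h)
    · obtain ⟨⟨a, b⟩, rfl⟩ := hg
      rw [restrictCoeff_single, blockAct_single, action_blockProj,
        reassoc_of% (blockIncl_blockProj X Y h)]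
    · rw [restrictCoeff_single_of_notMem _ _ hg, blockIncl_action_blockProj_of_notMem X Y h g hg,
        smul_zero, map_zero]

theorem blockIncl_powAct_blockProj_of_ne {p' q' : ℕ} (h' : p' + q' = n) (hp : p ≠ p')
    (x : PermAlg n) : blockIncl X Y h ≫ powAct (X ⊞ Y) n x ≫ blockProj X Y h' = 0 := by
  induction x using MonoidAlgebra.induction_linear with
  | zero =>
    rw [map_zero]
    exact (congrArg _ zero_comp).trans comp_zero
  | add a b ha hb =>
    rw [map_add]
    refine (congrArg _ (Preadditive.add_comp _ _ _ _ _ _)).trans ?_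
    rw [Preadditive.comp_add, ha, hb, add_zero]
  | single g r =>
    rw [powAct_single, Linear.smul_comp, Linear.comp_smul,
      blockIncl_action_blockProj_of_ne X Y h h' hp, smul_zero]

theorem sum_powAct_comp_blockProj {I : Type*} {κ : I → Type*} [Fintype (Σ i, κ i)]
    {f : I → MonoidAlgebra ℚ (Equiv.Perm (Fin p) × Equiv.Perm (Fin q))} {e x : PermAlg n}
    {v w : (Σ i, κ i) → PermAlg n}
    (hvw : IsRestrictionFamily (youngEmb h) (youngEmb_injective h) f e v w) (hx : x * e = x) :
    ∑ s, powAct (X ⊞ Y) n (v s) ≫ blockProj X Y h ≫ blockIncl X Y h ≫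
      powAct (X ⊞ Y) n (x * w s) ≫ blockProj X Y h = powAct (X ⊞ Y) n x ≫ blockProj X Y h := by
  conv_rhs => rw [← hvw.sum_mul x hx, map_sum, Preadditive.sum_comp]
  refine Finset.sum_congr rfl fun s _ => ?_
  rw [powAct_mul _ _ (v s), Category.assoc, powAct_blockProj, ← blockIncl_powAct_blockProj]

theorem powAct_eq_sum {I : antidiagonal n → Type*} {κ : ∀ d, I d → Type*}
    [∀ d, Fintype (Σ i, κ d i)]
    {f : ∀ d, I d → MonoidAlgebra ℚ (Equiv.Perm (Fin d.1.1) × Equiv.Perm (Fin d.1.2))}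
    {e : PermAlg n} (he : e * e = e) {v w : ∀ d, (Σ i, κ d i) → PermAlg n}
    (hvw : ∀ d, IsRestrictionFamily (youngEmb (antidiagonal_fst_add_snd d))
      (youngEmb_injective _) (f d) e (v d) (w d)) :
    powAct (X ⊞ Y) n e = ∑ d, ∑ s, powAct (X ⊞ Y) n (v d s) ≫
      blockProj X Y (antidiagonal_fst_add_snd d) ≫ blockIncl X Y (antidiagonal_fst_add_snd d) ≫
        powAct (X ⊞ Y) n (w d s) := by
  refine sub_eq_zero.1 (eq_zero_of_blockProj X Y _ fun p q h g => ?_)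
  let x : PermAlg n := MonoidAlgebra.single g 1
  have action_eq : tensorPowAction (X ⊞ Y) n g = powAct (X ⊞ Y) n x := by
    rw [powAct_single, one_smul]
  have powAct_powAct (d s) : powAct (X ⊞ Y) n (w d s) ≫ powAct (X ⊞ Y) n x =
      powAct (X ⊞ Y) n (x * e * w d s) := by
    rw [mul_assoc, ((hvw d).right_mem s).1, powAct_mul]
  rw [action_eq, Preadditive.sub_comp, sub_eq_zero, Preadditive.sum_comp,
    Finset.sum_eq_single ⟨(p, q), mem_antidiagonal.mpr h⟩]
  · rw [← Category.assoc, ← powAct_mul, Preadditive.sum_comp,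
      ← sum_powAct_comp_blockProj X Y h (hvw ⟨(p, q), _⟩) (by rw [mul_assoc, he])]
    refine Finset.sum_congr rfl fun s _ => ?_
    simp only [Category.assoc, reassoc_of% powAct_powAct]
  · intro d _ hd
    rw [Preadditive.sum_comp]
    refine Finset.sum_eq_zero fun s _ => ?_
    simp only [Category.assoc, reassoc_of% powAct_powAct]
    rw [blockIncl_powAct_blockProj_of_ne X Y (antidiagonal_fst_add_snd d) h fun hp =>
      hd (antidiagonal_subtype_ext hp), comp_zero, comp_zero]
  · exact fun hd => absurd (Finset.mem_univ _) hd

end GroupAlgebraActions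

section SchurFunctorOfSum

/-- Flattening of a nested direct sum. -/
def biproductSigmaProdIso {C : Type u} [Category.{v} C] [Preadditive C] [HasFiniteBiproducts C]
    {K L : Type} [Fintype K] [Fintype L] (T : K → L → Type) [∀ k l, Fintype (T k l)]
    (F : K → L → C) :
    (⨁ fun s : Σ i : K × L, T i.1 i.2 => F s.1.1 s.1.2) ≅
      ⨁ fun k => ⨁ fun l => ⨁ fun _ : T k l => F k l :=
  biproduct.whiskerEquiv (g := fun s : Σ (k : K) (l : L), T k l => F s.1 s.2.1)
      Equiv.sigmaAssocProd (fun _ => Iso.refl _) ≪≫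
    (biproductBiproductIso _ fun k (s : Σ l, T k l) => F k s.1).symm ≪≫
    biproduct.mapIso fun k => (biproductBiproductIso _ fun l (_ : T k l) => F k l).symm

variable {A : Type u} [Category.{v} A] [Preadditive A] [Linear ℚ A] [IsIdempotentComplete A]
  [MonoidalCategory A] [SymmetricCategory A] {p q n : ℕ}

/-- The inclusion of `S_μ(X)` into `X^{⊗ n}`. -/
def schurIncl (μ : n.Partition) (X : A) : schurObj μ X ⟶ tensorPow X n :=
  (schurImage_spec (tensorPowAction X n) μ).choose

/-- The projection of `X^{⊗ n}` to `S_μ(X)` that splits the idempotent of `μ`. -/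
def schurProj (μ : n.Partition) (X : A) : tensorPow X n ⟶ schurObj μ X :=
  (schurImage_spec (tensorPowAction X n) μ).choose_spec.choose

theorem schurIncl_schurProj (μ : n.Partition) (X : A) : schurIncl μ X ≫ schurProj μ X = 𝟙 _ :=
  (schurImage_spec (tensorPowAction X n) μ).choose_spec.choose_spec.1

theorem schurProj_schurIncl (μ : n.Partition) (X : A) :
    schurProj μ X ≫ schurIncl μ X = powAct X n (schurIdempotent μ) :=
  (schurImage_spec (tensorPowAction X n) μ).choose_spec.choose_spec.2

theorem tensor_schurIncl_schurProj (μ : p.Partition) (η : q.Partition) (X Y : A) :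
    (schurIncl μ X ⊗ₘ schurIncl η Y) ≫ (schurProj μ X ⊗ₘ schurProj η Y) = 𝟙 _ := by
  rw [tensorHom_comp_tensorHom, schurIncl_schurProj, schurIncl_schurProj, id_tensorHom_id]

theorem tensor_schurProj_schurIncl (μ : p.Partition) (η : q.Partition) (X Y : A)
    [MonoidalPreadditive A] [MonoidalLinear ℚ A] :
    (schurProj μ X ⊗ₘ schurProj η Y) ≫ (schurIncl μ X ⊗ₘ schurIncl η Y) =
      blockAct X Y p q (outer (schurIdempotent μ) (schurIdempotent η)) := by
  rw [tensorHom_comp_tensorHom, schurProj_schurIncl, schurProj_schurIncl, blockAct_outer]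

variable [HasFiniteBiproducts A] (X Y : A) (h : p + q = n) (μ : p.Partition) (η : q.Partition)
  (π : n.Partition)

/-- The morphism `S_μ(X) ⊗ S_η(Y) ⟶ S_π(X ⊕ Y)` given by an element `w` of `e_π ℚΣ_n e`, where `e`
is the image of `e_μ ⊗ e_η` in `ℚΣ_n`. -/
def lrIncl (w : PermAlg n) : schurObj μ X ⊗ schurObj η Y ⟶ schurObj π (X ⊞ Y) :=
  (schurIncl μ X ⊗ₘ schurIncl η Y) ≫ blockIncl X Y h ≫ powAct (X ⊞ Y) n w ≫ schurProj π (X ⊞ Y)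

/-- The morphism `S_π(X ⊕ Y) ⟶ S_μ(X) ⊗ S_η(Y)` given by an element `v` of `e ℚΣ_n e_π`, where `e`
is the image of `e_μ ⊗ e_η` in `ℚΣ_n`. -/
def lrProj (v : PermAlg n) : schurObj π (X ⊞ Y) ⟶ schurObj μ X ⊗ schurObj η Y :=
  schurIncl π (X ⊞ Y) ≫ powAct (X ⊞ Y) n v ≫ blockProj X Y h ≫ (schurProj μ X ⊗ₘ schurProj η Y)

variable {X Y μ η π} {v w : PermAlg n}

theorem lrIncl_comp_lrProj {p' q' : ℕ} (h' : p' + q' = n) {μ' : p'.Partition} {η' : q'.Partition}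
    (hw : schurIdempotent π * w = w) : lrIncl X Y h μ η π w ≫ lrProj X Y h' μ' η' π v =
      (schurIncl μ X ⊗ₘ schurIncl η Y) ≫ (blockIncl X Y h ≫ powAct (X ⊞ Y) n (v * w) ≫
        blockProj X Y h') ≫ (schurProj μ' X ⊗ₘ schurProj η' Y) := by
  have powAct_powAct : powAct (X ⊞ Y) n w ≫ schurProj π (X ⊞ Y) ≫ schurIncl π (X ⊞ Y) ≫
      powAct (X ⊞ Y) n v = powAct (X ⊞ Y) n (v * w) := by
    rw [reassoc_of% (schurProj_schurIncl π (X ⊞ Y)), ← Category.assoc, ← powAct_mul, hw,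
      ← powAct_mul]
  simp only [lrIncl, lrProj, Category.assoc, ← powAct_powAct]

variable [MonoidalPreadditive A]

theorem lrIncl_comp_lrProj_of_ne {p' q' : ℕ} (h' : p' + q' = n) (hp : p ≠ p') {μ' : p'.Partition}
    {η' : q'.Partition} (hw : schurIdempotent π * w = w) :
    lrIncl X Y h μ η π w ≫ lrProj X Y h' μ' η' π v = 0 := by
  rw [lrIncl_comp_lrProj h h' hw, blockIncl_powAct_blockProj_of_ne X Y h h' hp, zero_comp,
    comp_zero]

theorem lrIncl_comp_lrProj_eq_zero {μ' : p.Partition} {η' : q.Partition}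
    (hw : schurIdempotent π * w = w)
    (hvw : restrictCoeff (youngEmb h) (youngEmb_injective h) (v * w) = 0) :
    lrIncl X Y h μ η π w ≫ lrProj X Y h μ' η' π v = 0 := by
  rw [lrIncl_comp_lrProj h h hw, blockIncl_powAct_blockProj, hvw, map_zero]
  exact (congrArg _ zero_comp).trans comp_zero

variable [MonoidalLinear ℚ A]

theorem lrIncl_comp_lrProj_eq_id (hw : schurIdempotent π * w = w)
    (hvw : restrictCoeff (youngEmb h) (youngEmb_injective h) (v * w) =
      outer (schurIdempotent μ) (schurIdempotent η)) :
    lrIncl X Y h μ η π w ≫ lrProj X Y h μ η π v = 𝟙 _ := by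
  rw [lrIncl_comp_lrProj h h hw, blockIncl_powAct_blockProj, hvw, ← tensor_schurProj_schurIncl,
    Category.assoc, tensor_schurIncl_schurProj, Category.comp_id, tensor_schurIncl_schurProj]

theorem lrProj_comp_lrIncl
    (hw : w * algMap (youngEmb h) (outer (schurIdempotent μ) (schurIdempotent η)) = w) :
    lrProj X Y h μ η π v ≫ lrIncl X Y h μ η π w = schurIncl π (X ⊞ Y) ≫ (powAct (X ⊞ Y) n v ≫
      blockProj X Y h ≫ blockIncl X Y h ≫ powAct (X ⊞ Y) n w) ≫ schurProj π (X ⊞ Y) := by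
  have powAct_powAct := powAct_mul (X ⊞ Y) w
    (algMap (youngEmb h) (outer (schurIdempotent μ) (schurIdempotent η)))
  rw [hw] at powAct_powAct
  simp only [lrIncl, lrProj, Category.assoc]
  rw [reassoc_of% (tensor_schurProj_schurIncl μ η X Y), reassoc_of% (blockAct_blockIncl X Y h),
    ← reassoc_of% powAct_powAct]

variable (X Y π)

theorem nonempty_schurObj_biprod_iso :
    Nonempty (schurObj π (X ⊞ Y) ≅
      ⨁ fun d : antidiagonal n =>
        ⨁ fun μ : d.1.1.Partition => ⨁ fun η : d.1.2.Partition =>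
          ⨁ fun _ : Fin (lrCoeff (mem_antidiagonal.mp d.2) μ η π) =>
            schurObj μ X ⊗ schurObj η Y) := by
  choose v w hvw using fun d : antidiagonal n =>
    exists_lrFamily (antidiagonal_fst_add_snd d) π
  let S (d : antidiagonal n) := Σ i : d.1.1.Partition × d.1.2.Partition,
    Fin (lrCoeff (antidiagonal_fst_add_snd d) i.1 i.2 π)
  refine ⟨isoBiproductOf (J := Σ d, S d) (fun s => schurObj s.2.1.1 X ⊗ schurObj s.2.1.2 Y)
      (fun s => lrIncl X Y (antidiagonal_fst_add_snd s.1) s.2.1.1 s.2.1.2 π (w s.1 s.2))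
      (fun s => lrProj X Y (antidiagonal_fst_add_snd s.1) s.2.1.1 s.2.1.2 π (v s.1 s.2)) ?_ ?_ ?_ ≪≫
    (biproductBiproductIso S fun d s => schurObj s.1.1 X ⊗ schurObj s.1.2 Y).symm ≪≫
    biproduct.mapIso fun d => biproductSigmaProdIso
      (fun μ η => Fin (lrCoeff (antidiagonal_fst_add_snd d) μ η π))
      fun μ η => schurObj μ X ⊗ schurObj η Y⟩
  · rintro ⟨d, s⟩
    exact lrIncl_comp_lrProj_eq_id _ ((hvw d).right_mem s).1 ((hvw d).restrict_mul_self s)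
  · rintro ⟨d, s⟩ ⟨d', s'⟩ hne
    obtain rfl | hd := eq_or_ne d d'
    · exact lrIncl_comp_lrProj_eq_zero _ ((hvw d).right_mem s).1
        ((hvw d).restrict_mul_of_ne s' s fun hs => hne (by rw [hs]))
    · exact lrIncl_comp_lrProj_of_ne _ _ (fun hp => hd (antidiagonal_subtype_ext hp))
        ((hvw d).right_mem s).1
  · simp only [lrProj_comp_lrIncl _ ((hvw _).right_mem _).2]
    rw [← Preadditive.comp_sum, ← Preadditive.sum_comp, Fintype.sum_sigma,
      ← powAct_eq_sum X Y (schurIdempotent_mul_self π) hvw, ← schurProj_schurIncl, Category.assoc,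
      schurIncl_schurProj, Category.comp_id, schurIncl_schurProj]

end SchurFunctorOfSum

section DirectSums

variable {C : Type u} [Category.{v} C] [Preadditive C] [HasFiniteBiproducts C]

/-- The direct sum over `Option J`, with the summand of `none` split off. -/
def biproductOptionIso {J : Type} [Fintype J] (F : Option J → C) :
    ⨁ F ≅ F none ⊞ ⨁ fun j => F (some j) where
  hom := biprod.lift (biproduct.π F none) (biproduct.lift fun j => biproduct.π F (some j))
  inv := biprod.desc (biproduct.ι F none) (biproduct.desc fun j => biproduct.ι F (some j))
  hom_inv_id := by
    rw [biprod.lift_desc, biproduct.lift_desc, ← Fintype.sum_option fun j =>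
      biproduct.π F j ≫ biproduct.ι F j, biproduct.total]
  inv_hom_id := by
    refine biprod.hom_ext' _ _ (biprod.hom_ext _ _ ?_ (biproduct.hom_ext _ _ fun k => ?_))
      (biproduct.hom_ext' _ _ fun j => biprod.hom_ext _ _ ?_ (biproduct.hom_ext _ _ fun k => ?_))
    · simp
    · simp
    · simp
    · classical
      obtain rfl | hjk := eq_or_ne j k
      · simp
      · simp [biproduct.ι_π_ne _ hjk, biproduct.ι_π_ne _ ((Option.some_injective J).ne hjk)]

theorem cl_biproduct {J : Type} [Fintype J] (F : J → C) : cl (⨁ F) = ∑ j, cl (F j) := by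
  refine Fintype.induction_empty_option
    (P := fun J _ => ∀ F : J → C, cl (⨁ F) = ∑ j, cl (F j)) ?_ ?_ ?_ J F
  · intro α β _ e ih F
    let _ : Fintype α := Fintype.ofEquiv β e.symm
    rw [← e.sum_comp, ← ih fun a => F (e a)]
    exact (cl_eq_of_iso (biproduct.reindex e F)).symm
  · intro F
    rw [Fintype.sum_empty]
    have cl_eq_add_self : cl (⨁ F) = cl (⨁ F) + cl (⨁ F) := cl_of_iso_biprod
      { hom := 0
        inv := 0
        hom_inv_id := biproduct.hom_ext _ _ fun j => j.elim
        inv_hom_id := biprod.hom_ext _ _ (biproduct.hom_ext _ _ fun j => j.elim)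
          (biproduct.hom_ext _ _ fun j => j.elim) }
    exact left_eq_add.1 cl_eq_add_self
  · intro α _ ih F
    rw [cl_of_iso_biprod (biproductOptionIso F), ih, Fintype.sum_option]

end DirectSums

section Dimension

theorem repCl_biproduct {n : ℕ} {J : Type} [Fintype J]
    (F : J → FDRep ℚ (Equiv.Perm (Fin n))) : repCl (⨁ F) = ∑ j, repCl (F j) := by
  rw [repCl, cl_biproduct, map_sum]
  rfl

theorem repCl_eq_of_iso {n : ℕ} {V W : FDRep ℚ (Equiv.Perm (Fin n))} (e : V ≅ W) :
    repCl V = repCl W := congrArg (RepRing.of n) (cl_eq_of_iso e)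

theorem repCl_specht_mul {p q n : ℕ} (h : p + q = n) (μ : p.Partition) (η : q.Partition) :
    repCl (specht μ) * repCl (specht η) =
      ∑ π : n.Partition, ∑ _ : Fin (lrCoeff h μ η π), repCl (specht π) := by
  obtain ⟨e⟩ := nonempty_indProd_specht_iso h μ η
  rw [repCl_mul_repCl h, repCl_eq_of_iso e, repCl_biproduct]
  exact Finset.sum_congr rfl fun π _ => repCl_biproduct _

/-- The underlying vector space of a direct sum of representations. -/
def biprodLinearEquiv {G : Type} [Group G] (X Y : FDRep ℚ G) :
    ((X ⊞ Y : FDRep ℚ G) : Type) ≃ₗ[ℚ] X × Y :=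
  LinearEquiv.ofLinearMap
    ((repLin (biprod.fst : X ⊞ Y ⟶ X)).prod (repLin (biprod.snd : X ⊞ Y ⟶ Y)))
    ((repLin (biprod.inl : X ⟶ X ⊞ Y)).coprod (repLin (biprod.inr : Y ⟶ X ⊞ Y)))
    (LinearMap.ext fun ⟨x, y⟩ => Prod.ext
      (by
        change repLin biprod.fst (repLin biprod.inl x + repLin biprod.inr y) = x
        rw [map_add, ← repLin_comp, ← repLin_comp, biprod.inl_fst, biprod.inr_fst]
        exact add_zero x)
      (by
        change repLin biprod.snd (repLin biprod.inl x + repLin biprod.inr y) = y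
        rw [map_add, ← repLin_comp, ← repLin_comp, biprod.inl_snd, biprod.inr_snd]
        exact zero_add y))
    (LinearMap.ext fun z => by
      change repLin biprod.inl (repLin biprod.fst z) + repLin biprod.inr (repLin biprod.snd z) = z
      rw [← repLin_comp, ← repLin_comp, ← LinearMap.add_apply, ← repLin_add, biprod.total]
      rfl)

theorem finrank_of_iso_biprod {G : Type} [Group G] {X Y Z : FDRep ℚ G} (e : Z ≅ X ⊞ Y) :
    Module.finrank ℚ Z = Module.finrank ℚ X + Module.finrank ℚ Y := by
  rw [(FDRep.isoToLinearEquiv e).finrank_eq, (biprodLinearEquiv X Y).finrank_eq,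
    Module.finrank_prod]

/-- The homomorphism on `R` that sends the class of a representation to its dimension. -/
def repDim : RepRing →+ ℤ :=
  RepRing.lift fun n => K0.lift (fun V => (Module.finrank ℚ V : ℤ)) fun X Y Z ⟨e⟩ => by
    rw [finrank_of_iso_biprod e, Nat.cast_add]

theorem repDim_repCl {n : ℕ} (V : FDRep ℚ (Equiv.Perm (Fin n))) :
    repDim (repCl V) = Module.finrank ℚ V := by
  rw [repCl, repDim, RepRing.lift_of, K0.lift_cl]

end Dimension

section SmallDegree

theorem single_one_unitCoeff {k G : Type*} [CommRing k] [Group G] [Subsingleton G]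
    (x : MonoidAlgebra k G) : MonoidAlgebra.single 1 (unitCoeff x) = x := by
  classical
  induction x using MonoidAlgebra.induction_linear with
  | zero => rw [map_zero, MonoidAlgebra.single_zero]
  | add a b ha hb => rw [map_add, MonoidAlgebra.single_add, ha, hb]
  | single g r =>
    obtain rfl := Subsingleton.elim g 1
    rw [unitCoeff_single, if_pos rfl]

theorem rho_apply_of_subsingleton {G : Type} [Group G] [Subsingleton G] (V : FDRep ℚ G) (g : G)
    (v : V) : V.ρ g v = v := by
  rw [Subsingleton.elim g 1, map_one, Module.End.one_apply]

variable {n : ℕ} [Subsingleton (Equiv.Perm (Fin n))] (μ : n.Partition)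

theorem schurIdempotent_eq_one : schurIdempotent μ = 1 := by
  classical
  have unitCoeff_mul_self : unitCoeff (schurIdempotent μ) * unitCoeff (schurIdempotent μ) =
      unitCoeff (schurIdempotent μ) := by
    conv_rhs => rw [← schurIdempotent_mul_self, ← single_one_unitCoeff (schurIdempotent μ),
      MonoidAlgebra.single_mul_single, mul_one, unitCoeff_single, if_pos rfl]
  rw [← single_one_unitCoeff (schurIdempotent μ),
    (IsIdempotentElem.iff_eq_zero_or_one.1 unitCoeff_mul_self).resolve_left
      ((isCompleteSystem_schurIdempotent n).unitCoeff_ne_zero μ), MonoidAlgebra.one_def]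

theorem mem_spechtIdeal_of_subsingleton (y : PermAlg n) : y ∈ spechtIdeal μ := by
  rw [spechtIdeal_eq, schurIdempotent_eq_one, Ideal.span_singleton_one]
  exact Submodule.mem_top

theorem nonempty_specht_iso_trivial :
    Nonempty (specht μ ≅ FDRep.of (Representation.trivial ℚ (Equiv.Perm (Fin n)) ℚ)) := by
  classical
  let coeff : spechtIdeal μ →ₗ[ℚ] ℚ := unitCoeff ∘ₗ (spechtIdeal μ).subtype.restrictScalars ℚ
  let scalar : ℚ →ₗ[ℚ] spechtIdeal μ :=
    LinearMap.toSpanSingleton ℚ _ ⟨1, mem_spechtIdeal_of_subsingleton μ 1⟩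
  have coe_scalar (r : ℚ) : (scalar r : PermAlg n) = MonoidAlgebra.single 1 r := by
    rw [LinearMap.toSpanSingleton_apply]
    change r • (1 : PermAlg n) = _
    rw [MonoidAlgebra.one_def, MonoidAlgebra.smul_single, smul_eq_mul, mul_one]
  refine ⟨repIso (V := specht μ) (W := FDRep.of (Representation.trivial ℚ _ ℚ)) coeff scalar
    (fun g y => ?_) (fun g r => ?_) (LinearMap.ext fun y => Subtype.ext ?_)
    (LinearMap.ext fun r => ?_)⟩
  · rw [rho_apply_of_subsingleton, rho_apply_of_subsingleton]
  · rw [rho_apply_of_subsingleton, rho_apply_of_subsingleton]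
  · exact (coe_scalar _).trans (single_one_unitCoeff _)
  · exact (congrArg unitCoeff (coe_scalar r)).trans ((unitCoeff_single 1 r).trans (if_pos rfl))

end SmallDegree

section SchurFunctor

variable {A : Type u} [Category.{v} A] [Preadditive A] [Linear ℚ A] [IsIdempotentComplete A]
  [MonoidalCategory A] [SymmetricCategory A] {n : ℕ}

theorem schurIncl_powAct (μ : n.Partition) (X : A) :
    schurIncl μ X ≫ powAct X n (schurIdempotent μ) = schurIncl μ X := by
  rw [← schurProj_schurIncl, reassoc_of% schurIncl_schurProj μ X]

/-- The morphism `S_μ(f)` induced by `f`. -/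
def schurMap (μ : n.Partition) {X Y : A} (f : X ⟶ Y) : schurObj μ X ⟶ schurObj μ Y :=
  schurIncl μ X ≫ (tensorFam fun _ => f) ≫ schurProj μ Y

theorem schurMap_id (μ : n.Partition) (X : A) : schurMap μ (𝟙 X) = 𝟙 (schurObj μ X) := by
  rw [schurMap, tensorFam_id, Category.id_comp, schurIncl_schurProj]

theorem schurMap_comp (μ : n.Partition) {X Y Z : A} (f : X ⟶ Y) (g : Y ⟶ Z) :
    schurMap μ (f ≫ g) = schurMap μ f ≫ schurMap μ g := by
  simp only [schurMap, Category.assoc]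
  rw [← tensorFam_comp, Category.assoc, reassoc_of% schurProj_schurIncl μ Y,
    ← reassoc_of% powAct_comp_tensorFam (schurIdempotent μ) f,
    reassoc_of% schurIncl_powAct μ X]

/-- The isomorphism `S_μ(e)` induced by an isomorphism `e`. -/
def schurMapIso (μ : n.Partition) {X Y : A} (e : X ≅ Y) : schurObj μ X ≅ schurObj μ Y where
  hom := schurMap μ e.hom
  inv := schurMap μ e.inv
  hom_inv_id := by rw [← schurMap_comp, e.hom_inv_id, schurMap_id]
  inv_hom_id := by rw [← schurMap_comp, e.inv_hom_id, schurMap_id]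

theorem schurProj_schurIncl_of_subsingleton [Subsingleton (Equiv.Perm (Fin n))]
    (μ : n.Partition) (X : A) : schurProj μ X ≫ schurIncl μ X = 𝟙 _ := by
  rw [schurProj_schurIncl, schurIdempotent_eq_one, map_one]
  rfl

end SchurFunctor

section LambdaSigma

variable {A : Type u} [Category.{v} A] [Preadditive A] [Linear ℚ A] [HasFiniteBiproducts A]
  [IsIdempotentComplete A] [MonoidalCategory A] [MonoidalPreadditive A] [SymmetricCategory A]

theorem cl_schurObj_biprod [MonoidalLinear ℚ A] {X Y Z : A} (e : Z ≅ X ⊞ Y) {n : ℕ}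
    (π : n.Partition) :
    cl (schurObj π Z) = ∑ d : antidiagonal n, ∑ μ : d.1.1.Partition, ∑ η : d.1.2.Partition,
      ∑ _ : Fin (lrCoeff (mem_antidiagonal.mp d.2) μ η π),
        cl (schurObj μ X) * cl (schurObj η Y) := by
  obtain ⟨f⟩ := nonempty_schurObj_biprod_iso X Y π
  rw [cl_eq_of_iso (schurMapIso π e ≪≫ f)]
  simp only [cl_biproduct, K0.cl_mul_cl]

theorem lambdaSigma_of_iso_biprod [MonoidalLinear ℚ A] {X Y Z : A} (e : Z ≅ X ⊞ Y) :
    lambdaSigma Z = lambdaSigma X * lambdaSigma Y := by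
  refine PowerSeries.ext fun n => ?_
  rw [PowerSeries.coeff_mul, ← Finset.sum_coe_sort]
  simp only [lambdaSigma, PowerSeries.coeff_mk]
  have tmul_expand (π : n.Partition) : cl (schurObj π Z) ⊗ₜ[ℤ] repCl (specht π) =
      ∑ d : antidiagonal n, ∑ μ : d.1.1.Partition, ∑ η : d.1.2.Partition,
        ∑ _ : Fin (lrCoeff (mem_antidiagonal.mp d.2) μ η π),
          (cl (schurObj μ X) * cl (schurObj η Y)) ⊗ₜ[ℤ] repCl (specht π) := by
    rw [cl_schurObj_biprod e]
    simp only [TensorProduct.sum_tmul]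
  rw [Finset.sum_congr rfl fun π _ => tmul_expand π, Finset.sum_comm]
  refine Finset.sum_congr rfl fun d _ => ?_
  rw [Finset.sum_comm, Finset.sum_mul]
  refine Finset.sum_congr rfl fun μ _ => ?_
  rw [Finset.sum_comm, Finset.mul_sum]
  refine Finset.sum_congr rfl fun η _ => ?_
  rw [Algebra.TensorProduct.tmul_mul_tmul, repCl_specht_mul (mem_antidiagonal.mp d.2) μ η]
  simp only [TensorProduct.tmul_sum]

theorem coeff_lambdaSigma_of_subsingleton {n : ℕ} [Subsingleton (Equiv.Perm (Fin n))]
    [Subsingleton n.Partition] (X : A) :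
    PowerSeries.coeff n (lambdaSigma X) = cl (tensorPow X n) ⊗ₜ[ℤ]
      repCl (FDRep.of (Representation.trivial ℚ (Equiv.Perm (Fin n)) ℚ)) := by
  obtain ⟨e⟩ := nonempty_specht_iso_trivial (.indiscrete n)
  rw [lambdaSigma, PowerSeries.coeff_mk, Fintype.sum_subsingleton _ (.indiscrete n),
    repCl_eq_of_iso e, cl_eq_of_iso ⟨schurIncl _ X, schurProj _ X, schurIncl_schurProj _ X,
      schurProj_schurIncl_of_subsingleton _ X⟩]

theorem constantCoeff_lambdaSigma (X : A) :
    PowerSeries.constantCoeff (R := K0 A ⊗[ℤ] RepRing) (lambdaSigma X) = 1 := by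
  rw [← PowerSeries.coeff_zero_eq_constantCoeff_apply, coeff_lambdaSigma_of_subsingleton,
    ← RepRing.one_def]
  rfl

/-- The map `id ⊗ dim` from `K₀(A) ⊗ R` to `K₀(A)`. -/
def dimContract {B : Type*} [AddCommGroup B] : B ⊗[ℤ] RepRing →+ B :=
  ((TensorProduct.rid ℤ B).toLinearMap ∘ₗ
    LinearMap.lTensor B repDim.toIntLinearMap).toAddMonoidHom

theorem dimContract_tmul {B : Type*} [AddCommGroup B] (x : B) (r : RepRing) :
    dimContract (x ⊗ₜ[ℤ] r) = repDim r • x :=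
  TensorProduct.rid_tmul x (repDim r)

theorem dimContract_coeff_one_lambdaSigma (X : A) :
    dimContract (PowerSeries.coeff 1 (lambdaSigma X)) = cl X := by
  have repDim_trivial :
      repDim (repCl (FDRep.of (Representation.trivial ℚ (Equiv.Perm (Fin 1)) ℚ))) = 1 := by
    rw [repDim_repCl]
    exact congrArg Nat.cast (Module.finrank_self ℚ)
  rw [coeff_lambdaSigma_of_subsingleton, dimContract_tmul, repDim_trivial, one_smul]
  exact cl_eq_of_iso (ρ_ X)

end LambdaSigma

section OneUnits

variable {S : Type*} [CommRing S]

theorem constantCoeff_oneUnits (u : oneUnits S) :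
    PowerSeries.constantCoeff ((u : (PowerSeries S)ˣ) : PowerSeries S) = 1 :=
  congrArg Units.val (MonoidHom.mem_ker.1 u.2)

theorem exists_oneUnits_coe_eq {F : PowerSeries S} (hF : PowerSeries.constantCoeff F = 1) :
    ∃ u : oneUnits S, ((u : (PowerSeries S)ˣ) : PowerSeries S) = F := by
  obtain ⟨u, rfl⟩ : IsUnit F := PowerSeries.isUnit_iff_constantCoeff.2 (hF ▸ isUnit_one)
  exact ⟨⟨u, MonoidHom.mem_ker.2 (Units.ext hF)⟩, rfl⟩

variable (S) in
/-- The coefficient of `t`, as a homomorphism from `1 + t S[[t]]` to the additive group of `S`. -/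
def oneUnitsCoeff : Additive (oneUnits S) →+ S where
  toFun u := PowerSeries.coeff 1 ((u.toMul : (PowerSeries S)ˣ) : PowerSeries S)
  map_zero' := by
    change PowerSeries.coeff 1 (1 : PowerSeries S) = 0
    rw [PowerSeries.coeff_one, if_neg one_ne_zero]
  map_add' u v := by
    change PowerSeries.coeff 1 (((u.toMul : (PowerSeries S)ˣ) : PowerSeries S) *
      ((v.toMul : (PowerSeries S)ˣ) : PowerSeries S)) = _
    rw [PowerSeries.coeff_one_mul, constantCoeff_oneUnits, constantCoeff_oneUnits, mul_one,
      mul_one, add_comm]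

end OneUnits

section LambdaSigmaHom

variable {A : Type u} [Category.{v} A] [Preadditive A] [Linear ℚ A] [HasFiniteBiproducts A]
  [IsIdempotentComplete A] [MonoidalCategory A] [MonoidalPreadditive A] [SymmetricCategory A]

/-- `λ_Σ(X)` as an element of `1 + t (K₀(A) ⊗ R)[[t]]`. -/
def lambdaSigmaUnit (X : A) : oneUnits (K0 A ⊗[ℤ] RepRing) :=
  (exists_oneUnits_coe_eq (constantCoeff_lambdaSigma X)).choose

theorem coe_lambdaSigmaUnit (X : A) :
    ((lambdaSigmaUnit X : (PowerSeries (K0 A ⊗[ℤ] RepRing))ˣ) :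
      PowerSeries (K0 A ⊗[ℤ] RepRing)) = lambdaSigma X :=
  (exists_oneUnits_coe_eq (constantCoeff_lambdaSigma X)).choose_spec

variable [MonoidalLinear ℚ A]

theorem lambdaSigmaUnit_of_iso_biprod {X Y Z : A} (e : Z ≅ X ⊞ Y) :
    lambdaSigmaUnit Z = lambdaSigmaUnit X * lambdaSigmaUnit Y :=
  Subtype.ext (Units.ext (by
    rw [Subgroup.coe_mul, Units.val_mul, coe_lambdaSigmaUnit, coe_lambdaSigmaUnit,
      coe_lambdaSigmaUnit, lambdaSigma_of_iso_biprod e]))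

variable (A) in
/-- The extension of `λ_Σ` to the Grothendieck group. -/
def lambdaSigmaHom : K0 A →+ Additive (oneUnits (K0 A ⊗[ℤ] RepRing)) :=
  K0.lift (fun X => Additive.ofMul (lambdaSigmaUnit X)) fun X Y Z ⟨e⟩ => by
    rw [lambdaSigmaUnit_of_iso_biprod e, ofMul_mul]

theorem coe_lambdaSigmaHom_cl (X : A) :
    (((lambdaSigmaHom A (cl X)).toMul : (PowerSeries (K0 A ⊗[ℤ] RepRing))ˣ) :
      PowerSeries (K0 A ⊗[ℤ] RepRing)) = lambdaSigma X := by
  rw [lambdaSigmaHom, K0.lift_cl, toMul_ofMul, coe_lambdaSigmaUnit]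

theorem lambdaSigmaHom_injective : Function.Injective (lambdaSigmaHom A) := by
  have contract_coeff_one_comp :
      (dimContract.comp (oneUnitsCoeff _)).comp (lambdaSigmaHom A) = AddMonoidHom.id (K0 A) :=
    K0.hom_ext fun X =>
      (congrArg (fun F => dimContract (PowerSeries.coeff 1 F)) (coe_lambdaSigmaHom_cl X)).trans
        (dimContract_coeff_one_lambdaSigma X)
  exact Function.LeftInverse.injective (g := dimContract.comp (oneUnitsCoeff _))
    fun x => DFunLike.congr_fun contract_coeff_one_comp x

end LambdaSigmaHom

end

end GLR

theorem mainTheorem8 {A : Type u} [Category.{v} A] [Preadditive A] [Linear ℚ A]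
    [HasFiniteBiproducts A] [IsIdempotentComplete A] [MonoidalCategory A] [MonoidalPreadditive A]
    [MonoidalLinear ℚ A] [SymmetricCategory A] :
    (∃ φ : GLR.K0 A →+ Additive (GLR.oneUnits (GLR.K0 A ⊗[ℤ] GLR.RepRing)),
      (∀ X : A, (((φ (GLR.cl X)).toMul : (PowerSeries (GLR.K0 A ⊗[ℤ] GLR.RepRing))ˣ) :
        PowerSeries (GLR.K0 A ⊗[ℤ] GLR.RepRing)) = GLR.lambdaSigma X) ∧
      Function.Injective φ) ∧
    (∀ (p q n : ℕ) (h : p + q = n) (μ : p.Partition) (η : q.Partition),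
      Nonempty (GLR.indProd h (GLR.specht μ) (GLR.specht η) ≅
        ⨁ fun π : n.Partition => ⨁ fun _ : Fin (GLR.lrCoeff h μ η π) => GLR.specht π)) ∧
    (∀ (n : ℕ) (π : n.Partition) (X Y : A),
      Nonempty (GLR.schurObj π (X ⊞ Y) ≅
        ⨁ fun d : Finset.HasAntidiagonal.antidiagonal n =>
          ⨁ fun μ : d.1.1.Partition => ⨁ fun η : d.1.2.Partition =>
            ⨁ fun _ : Fin (GLR.lrCoeff (Finset.HasAntidiagonal.mem_antidiagonal.mp d.2) μ η π) =>
              GLR.schurObj μ X ⊗ GLR.schurObj η Y)) := by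
  exact ⟨⟨GLR.lambdaSigmaHom A, GLR.coe_lambdaSigmaHom_cl, GLR.lambdaSigmaHom_injective⟩,
    fun _ _ _ h μ η => GLR.nonempty_indProd_specht_iso h μ η,
    fun _ π X Y => GLR.nonempty_schurObj_biprod_iso X Y π⟩
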